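/- Let $M$ be a (connected) Riemann surface and $n\ge 0$ an integer. A smooth map $\psi:M\to G_m(\mathbb C^n)$ into the Grassmannian of $m$-dimensional subspaces of $\mathbb C^n$ ($0\le m\le n$) is identified with the smooth rank $m$ subbundle $\psi$ of the trivial bundle $\underline{\mathbb C}^n=M\times\mathbb C^n$ whose fibre at $x$ is $\psi(x)$; $\pi_\psi$ and $\pi_{\psi^\perp}$ are the orthogonal projections onto $\psi$ and $\psi^\perp$, and $z$ stands for an arbitrary local complex coordinate on $M$. The map $\psi$ is harmonic if it is a critical point of the energy $\frac12\int_D|d\psi|^2\omega_g$, with respect to compactly supported smooth variations, on relatively compact domains $D$ (for any metric $g$ compatible with the complex structure). The second fundamental form of $\psi$ is the bundle map $A'_\psi:\psi\to\psi^\perp$, $A'_\psi(s)=\pi_{\psi^\perp}\partial_z s$ for sections $s$ of $\psi$. For a harmonic map $\psi$, the Gauss bundle $G^{(1)}(\psi)$ is the smooth subbundle that coincides with the image of $A'_\psi$ off a closed discrete set ("filling out zeros"), and $G^{(i+1)}(\psi)=G^{(1)}(G^{(i)}(\psi))$. The isotropy order of $\psi$ is the greatest $r\in\{1,2,\dots,\infty\}$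 such that $\psi$ is orthogonal to $G^{(i)}(\psi)$ for all finite $i$ with $1\le i\le r$. With $\psi$ regarded as the $\mathrm U(n)$-valued map $\pi_\psi-\pi_{\psi^\perp}$ and $A^\psi_z=\frac12\psi^{-1}\partial_z\psi$, the map $\psi$ is called 2-nilconformal if $(A^\psi_z)^2=0$. For $t\in\{1,2,\dots,\infty\}$, a cyclic harmonic diagram $\psi_0\to\psi_1\to\cdots\to\psi_t\to\psi_0$ consists of mutually orthogonal subbundles $\psi_i$ ($0\le i\le t$) of $\underline{\mathbb C}^n$ with sum $\underline{\mathbb C}^n$, each of which corresponds to a harmonic map $M\to G_{m_i}(\mathbb C^n)$ ($m_i=0$ is allowed), such that for $i\ne j$ the component $\pi_{\psi_j}\circ A'_{\psi_i}$ vanishes unless $i<t$ and $j=i+1$, or $i=t$ and $j=0$. (Arrows may be zero. For $t=\infty$ the vertices are the $\psi_i$ with $i$ finite, together with a possibly zero $\psi_\infty$; the arrows are $\psi_i\to\psi_{i+1}$ for $i$ finite, and $\psi_\infty\to\psi_0$.) **Proposition.** 1. Given a cyclic harmonic diagram $\psi_0\to\psi_1\to\cdots\to\psi_t\to\psi_0$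 with $3\le t\le\infty$, the map $\psi:=\psi_0\oplus\psi_1:M\to G_{m_0+m_1}(\mathbb C^n)$ is a 2-nilconformal harmonic map, of isotropy order at least $t-1$ (where $\infty-1=\infty$). 2. Conversely, every 2-nilconformal harmonic map $\psi:M\to G_m(\mathbb C^n)$ is of the form $\psi=\psi_0\oplus\psi_1$ for some cyclic harmonic diagram $\psi_0\to\psi_1\to\cdots\to\psi_t\to\psi_0$ with $3\le t\le\infty$; in particular $m=m_0+m_1$. -/

import Mathlib

open scoped Manifold ContDiff

noncomputable section

namespace HarmonicGrassmann

/-- The Hermitian space `ℂⁿ`. -/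
abbrev Cn (n : ℕ) : Type := EuclideanSpace ℂ (Fin n)

/-- The endomorphisms `𝔤𝔩(n, ℂ)` of `ℂⁿ`. -/
abbrev EndCn (n : ℕ) : Type := Cn n →L[ℂ] Cn n

section Coordinates

variable {F : Type*} [NormedAddCommGroup F] [NormedSpace ℝ F]

/-- `∂g/∂u` for a function `g` of `w = u + i v`. -/
def partialRe (g : ℂ → F) (w : ℂ) : F := fderiv ℝ g w 1

/-- `∂g/∂v` for a function `g` of `w = u + i v`. -/
def partialIm (g : ℂ → F) (w : ℂ) : F := fderiv ℝ g w Complex.I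

/-- `∂g/∂w = (∂g/∂u - i ∂g/∂v) / 2`. -/
def dz [NormedSpace ℂ F] (g : ℂ → F) (w : ℂ) : F :=
  (1 / 2 : ℂ) • (partialRe g w - Complex.I • partialIm g w)

end Coordinates

variable {M : Type*} [TopologicalSpace M] {n : ℕ}

/-- `∂_z f` at the point `x`, with respect to the local coordinate `z`. -/
def dzAt {F : Type*} [NormedAddCommGroup F] [NormedSpace ℝ F] [NormedSpace ℂ F]
    (z : OpenPartialHomeomorph M ℂ) (f : M → F) (x : M) : F :=
  dz (f ∘ z.symm) (z x)

/-- The orthogonal projection `π_ψ`, as a function on `M`. -/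
def proj (ψ : M → Submodule ℂ (Cn n)) (x : M) : EndCn n := (ψ x).starProjection

/-- The orthogonal projection `π_{ψ^⊥}`, as a function on `M`. -/
def projPerp (ψ : M → Submodule ℂ (Cn n)) (x : M) : EndCn n := (ψ x)ᗮ.starProjection

/-! ### The second fundamental form -/

/-- The second fundamental form `A'_ψ(s) = π_{ψ^⊥} ∂_z s` of `ψ`, at the vector `v ∈ ψ_x`. It is
computed with the section `s = π_ψ v` of `ψ` (`v` being constant); any other section with the same
value at `x` gives the same result, see `secondFF_section`. -/
def secondFF (z : OpenPartialHomeomorph M ℂ) (ψ : M → Submodule ℂ (Cn n)) (x : M) (v : Cn n) :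
    Cn n :=
  projPerp ψ x (dzAt z (fun y => proj ψ y v) x)

/-- The Leibniz rule for a section `s = P s`. -/
theorem fderiv_section {V : Type*} [NormedAddCommGroup V] [NormedSpace ℂ V] [NormedSpace ℝ V]
    [IsScalarTower ℝ ℂ V] [SMulCommClass ℂ ℝ V] (P : ℂ → V →L[ℂ] V) (s : ℂ → V)
    (hPs : ∀ w, P w (s w) = s w) (w e : ℂ) (hP : DifferentiableAt ℝ P w)
    (hs : DifferentiableAt ℝ s w) :
    fderiv ℝ s w e = fderiv ℝ (fun y => P y (s w)) w e + P w (fderiv ℝ s w e) := by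
  let L : (V →L[ℂ] V) →L[ℝ] V →L[ℝ] V := ContinuousLinearMap.restrictScalarsL ℂ V V ℝ ℝ
  have h2 := L.hasFDerivAt_of_bilinear hP.hasFDerivAt hs.hasFDerivAt
  have h3 : (fun w => L (P w) (s w)) = s := funext hPs
  rw [h3] at h2
  have h4 := (L.flip (s w)).hasFDerivAt.comp w hP.hasFDerivAt
  have h5 : fderiv ℝ (fun y => P y (s w)) w = (L.flip (s w)).comp (fderiv ℝ P w) := h4.fderiv
  have h6 := congrArg (fun T => T e) h2.fderiv
  rw [h5]
  refine h6.trans ?_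
  rw [add_comm]
  rfl

/-- `A'_ψ` is the linear bundle map given on sections by `A'_ψ(s) = π_{ψ^⊥} ∂_z s`: the latter
depends on the value of the section only. -/
theorem secondFF_section (z : OpenPartialHomeomorph M ℂ) (ψ : M → Submodule ℂ (Cn n)) (x : M)
    (hx : x ∈ z.source) (s : M → Cn n) (hs : ∀ y, s y ∈ ψ y)
    (hds : DifferentiableAt ℝ (s ∘ z.symm) (z x))
    (hdψ : DifferentiableAt ℝ (proj ψ ∘ z.symm) (z x)) :
    projPerp ψ x (dzAt z s x) = secondFF z ψ x (s x) := by
  have hzx : z.symm (z x) = x := z.left_inv hx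
  have key : ∀ e : ℂ, fderiv ℝ (s ∘ z.symm) (z x) e =
      fderiv ℝ ((fun y => proj ψ y (s x)) ∘ z.symm) (z x) e
        + proj ψ x (fderiv ℝ (s ∘ z.symm) (z x) e) := by
    intro e
    have h := fderiv_section (proj ψ ∘ z.symm) (s ∘ z.symm)
      (fun w => Submodule.starProjection_eq_self_iff.2 (hs _)) (z x) e hdψ hds
    simp only [Function.comp_apply, hzx] at h
    exact h
  have hperp : ∀ u, projPerp ψ x (proj ψ x u) = 0 := by
    intro u
    exact (Submodule.starProjection_apply_eq_zero_iff _).2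
      (Submodule.le_orthogonal_orthogonal _ (Submodule.starProjection_apply_mem _ u))
  have hlin : ∀ e : ℂ, projPerp ψ x (fderiv ℝ (s ∘ z.symm) (z x) e) =
      projPerp ψ x (fderiv ℝ ((fun y => proj ψ y (s x)) ∘ z.symm) (z x) e) := by
    intro e
    conv_lhs => rw [key e]
    rw [map_add, hperp, add_zero]
  simp only [secondFF, dzAt, dz, partialRe, partialIm, map_smul, map_sub, hlin]

/-! ### Riemann surfaces and smooth maps into Grassmannians -/

/-- The local complex coordinates of the Riemann surface `M`: all charts in its maximal
holomorphic atlas. -/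
def coordinates (M : Type*) [TopologicalSpace M] [ChartedSpace ℂ M] :
    Set (OpenPartialHomeomorph M ℂ) :=
  IsManifold.maximalAtlas 𝓘(ℂ) ω M

variable [ChartedSpace ℂ M]

/-- Smooth maps `M → G_m(ℂⁿ)`, that is, smooth rank `m` subbundles of the trivial bundle
`M × ℂⁿ`. The Grassmannian is identified, as usual, with the submanifold of `𝔤𝔩(n, ℂ)` of
orthogonal projections of rank `m`. -/
structure IsSmoothMap (m : ℕ) (ψ : M → Submodule ℂ (Cn n)) : Prop where
  finrank_eq : ∀ x, Module.finrank ℂ (ψ x) = m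
  smooth : ContMDiff 𝓘(ℝ, ℂ) 𝓘(ℝ, EndCn n) ∞ (proj ψ)

/-! ### Harmonic maps -/

/-- The square of the Hilbert-Schmidt norm of an endomorphism. -/
def hsNormSq (A : EndCn n) : ℝ := ∑ i, ‖A (EuclideanSpace.single i 1)‖ ^ 2

/-- The energy `½ ∫_K |dψ|² ω_g` over a set `K` in the domain of the local coordinate `z`, for any
Riemannian metric `g` on `M` in the conformal class given by the complex structure: with
`z = u + i v` and `g = ρ (du² + dv²)`, the integrand is
`|dψ|² ω_g = (|∂ψ/∂u|² + |∂ψ/∂v|²) du dv`. The metric of the Grassmannian is induced from the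
Hilbert-Schmidt inner product of orthogonal projections. -/
def energy (z : OpenPartialHomeomorph M ℂ) (K : Set M) (ψ : M → Submodule ℂ (Cn n)) : ℝ :=
  (1 / 2) * ∫ w in z '' K,
    (hsNormSq (partialRe (proj ψ ∘ z.symm) w) + hsNormSq (partialIm (proj ψ ∘ z.symm) w))

/-- `Ψ s`, `s ∈ ℝ`, is a smooth variation of `ψ` through maps `M → G_m(ℂⁿ)`, fixed outside
`K`. -/
structure IsVariation (m : ℕ) (ψ : M → Submodule ℂ (Cn n)) (K : Set M)
    (Ψ : ℝ → M → Submodule ℂ (Cn n)) : Prop where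
  finrank_eq : ∀ s x, Module.finrank ℂ (Ψ s x) = m
  smooth : ContMDiff (𝓘(ℝ, ℝ).prod 𝓘(ℝ, ℂ)) 𝓘(ℝ, EndCn n) ∞
    (fun p : ℝ × M => proj (Ψ p.1) p.2)
  at_zero : Ψ 0 = ψ
  fixed : ∀ s, ∀ x ∉ K, Ψ s x = ψ x

/-- Harmonic maps `M → G_m(ℂⁿ)`: smooth maps that are critical points of the energy, with respect
to all smooth variations with compact support (in a coordinate domain). -/
structure IsHarmonic (m : ℕ) (ψ : M → Submodule ℂ (Cn n)) : Prop extends IsSmoothMap m ψ where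
  critical : ∀ z ∈ coordinates M, ∀ K : Set M, IsCompact K → K ⊆ z.source →
    ∀ Ψ : ℝ → M → Submodule ℂ (Cn n), IsVariation m ψ K Ψ →
      HasDerivAt (fun s => energy z K (Ψ s)) 0 0

/-! ### Nilconformality -/

/-- `A_z^φ = ½ φ⁻¹ ∂_z φ`. -/
def Az (z : OpenPartialHomeomorph M ℂ) (φ : M → EndCn n) (x : M) : EndCn n :=
  (1 / 2 : ℂ) • (Ring.inverse (φ x) * dzAt z φ x)

/-- The Cartan embedding of the Grassmannian in `U(n)`: a subspace is sent to the reflection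
`π_ψ - π_{ψ^⊥}`. -/
def cartan (ψ : M → Submodule ℂ (Cn n)) (x : M) : EndCn n := proj ψ x - projPerp ψ x

/-- `ψ` is 2-nilconformal: `(A_z^ψ)² = 0`, for every local coordinate. -/
def IsTwoNilconformal (ψ : M → Submodule ℂ (Cn n)) : Prop :=
  ∀ z ∈ coordinates M, ∀ x ∈ z.source, Az z (cartan ψ) x ^ 2 = 0

/-! ### Gauss bundles and isotropy order -/

/-- The image of `A'_ψ` at `x`. -/
def secondFFImage (z : OpenPartialHomeomorph M ℂ) (ψ : M → Submodule ℂ (Cn n)) (x : M) :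
    Set (Cn n) :=
  secondFF z ψ x '' (ψ x)

/-- `γ` is the (first) Gauss bundle of `ψ`: it is the smooth subbundle that is obtained from the
image of `A'_ψ` by filling out zeros, that is, it agrees with that image off a closed discrete
subset of `M`. -/
def IsGaussBundle (ψ γ : M → Submodule ℂ (Cn n)) : Prop :=
  (∃ k, IsSmoothMap k γ) ∧
    ∀ᶠ x in Filter.codiscrete M, ∀ z ∈ coordinates M, x ∈ z.source →
      (γ x : Set (Cn n)) = secondFFImage z ψ x

/-- The iterated Gauss bundles `G^{(i)}(ψ)`, `1 ≤ i ≤ r`, exist and are orthogonal to `ψ`. -/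
def IsotropicUpTo (r : ℕ) (ψ : M → Submodule ℂ (Cn n)) : Prop :=
  ∃ G : ℕ → M → Submodule ℂ (Cn n), G 0 = ψ ∧
    (∀ i < r, IsGaussBundle (G i) (G (i + 1))) ∧
    ∀ i, 1 ≤ i → i ≤ r → ∀ x, ψ x ⟂ G i x

/-- The isotropy order of `ψ`: the greatest `r ≤ ∞` such that `ψ` is orthogonal to `G^{(i)}(ψ)`
whenever `1 ≤ i ≤ r`. -/
def isotropyOrder (ψ : M → Submodule ℂ (Cn n)) : ℕ∞ :=
  sSup {r : ℕ∞ | ∀ i : ℕ, (i : ℕ∞) ≤ r → IsotropicUpTo i ψ}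

/-! ### Cyclic harmonic diagrams -/

/-- The component `A'_{ψ,χ} = π_χ ∘ A'_ψ` vanishes. -/
def ComponentVanishes (ψ χ : M → Submodule ℂ (Cn n)) : Prop :=
  ∀ z ∈ coordinates M, ∀ x ∈ z.source, ∀ v ∈ ψ x, proj χ x (secondFF z ψ x v) = 0

/-- The arrows of the cyclic diagram `ψ_0 → ψ_1 → ⋯ → ψ_t → ψ_0`. (For `t = ∞` these are the
arrows `ψ_i → ψ_{i+1}` for finite `i`, and an arrow `ψ_∞ → ψ_0`.) -/
def Arrow (t i j : ℕ∞) : Prop := (i < t ∧ j = i + 1) ∨ (i = t ∧ j = 0)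

/-- `ψ_0 → ψ_1 → ⋯ → ψ_t → ψ_0` is a harmonic diagram, where each vertex `ψ_i`, `0 ≤ i ≤ t`,
corresponds to a harmonic map `M → G_{m_i}(ℂⁿ)`. Vertices and arrows may be zero. -/
structure IsCyclicHarmonicDiagram (t : ℕ∞) (m : ℕ∞ → ℕ) (ψ : ℕ∞ → M → Submodule ℂ (Cn n)) :
    Prop where
  harmonic : ∀ i ≤ t, IsHarmonic (m i) (ψ i)
  orthogonal : ∀ i ≤ t, ∀ j ≤ t, i ≠ j → ∀ x, ψ i x ⟂ ψ j x
  sum_eq : ∀ x, ⨆ i, ⨆ _ : i ≤ t, ψ i x = ⊤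
  arrows : ∀ i ≤ t, ∀ j ≤ t, i ≠ j → ¬ Arrow t i j → ComponentVanishes (ψ i) (ψ j)

end HarmonicGrassmann

end

open HarmonicGrassmann

open scoped Manifold ContDiff

noncomputable section

/-! In a local coordinate a subbundle is its orthogonal projection `P`, and all notions become
identities between projections and their derivatives. Since P(∂P)P = 0, the second fundamental form
is (∂P)P. Harmonicity is (1 - P)(∂̄∂P)P = 0, that is, `P` commutes with its Laplacian
(`isHarmonic_of_equation`, `IsHarmonic.equation`), and 2-nilconformality is (∂P)² = 0
(`isTwoNilconformal_iff`).

From diagram to map: lump all vertices other than ψ₀, ψ₁ into one bundle ρ. Then ψ₀ → ψ₁ → ρ → ψ₀ is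
a cycle of length three, and differentiating the conditions that express its missing arrows shows
that ρ is harmonic (`HarmonicEquation.of_cycle`); so is its complement ψ = ψ₀ ⊕ ψ₁. Next, ∂P
exchanges ψ and ψᗮ. It kills ψ₀, maps ψ₁ into ψ₂, kills ψ₂ because t ≥ 3 makes the arrow from ψ₂ end
at ψ₃, and maps every other vertex into ψ₀. Hence (∂P)² = 0. Following the arrows, G^{(j)}(ψ) lies
in ψ₂ ⊕ ⋯ ⊕ ψ_{j+1} as long as j + 1 ≤ t, and this is orthogonal to ψ.

From map to diagram: t = 3 always suffices. Take ψ₂ = G(ψ), with ψ₃ its complement in ψᗮ, and ψ₀ =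
G(ψᗮ), with ψ₁ its complement in ψ. The equation (∂P)² = 0 says that no arrow leads from ψ₂ back to
ψ, nor from ψ₀ back to ψᗮ. A Gauss bundle is ∂̄-closed modulo its source, and the adjoint of this
statement excludes arrows from the complement into the Gauss bundle. Gauss bundles are harmonic by
`HarmonicEquation.gauss`; the complements are harmonic by `HarmonicEquation.of_cycle` again, applied
to ψ → ψ₂ → ψ₃ → ψ and to its analogue for ψᗮ.

The analytic input is the existence of Gauss bundles. For harmonic ψ the form A = (∂P)P satisfies
∂̄A = A(∂̄P) - (∂̄P)A. A local invertible solution of ∂̄g = -(∂̄P)g (`exists_gauge`, a Neumann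
series of Cauchy transforms) makes g⁻¹Ag holomorphic, so its image extends across the points where
the rank drops (`exists_analytic_idempotent`). The local extensions agree off isolated points, hence
everywhere, and glue (`exists_isGaussBundle`). -/

namespace HarmonicGrassmann

open MeasureTheory Set Filter Topology

/-! ### The Cauchy–Pompeiu formula. -/

section Dbar

variable {F : Type*} [NormedAddCommGroup F] [NormedSpace ℝ F] [NormedSpace ℂ F]

/-- `∂g/∂w̄ = (∂g/∂u + i ∂g/∂v) / 2`. -/
def dbar (g : ℂ → F) (w : ℂ) : F :=
  (1 / 2 : ℂ) • (partialRe g w + Complex.I • partialIm g w)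

/-- A continuous function of polar coordinates with bounded support in the radius is integrable. -/
theorem integrableOn_polar {F : Type*} [NormedAddCommGroup F] {G : ℝ × ℝ → F} (hG : Continuous G) (R : ℝ)
    (h0 : ∀ r θ, R < r → G (r, θ) = 0) :
    IntegrableOn G (Ioi (0 : ℝ) ×ˢ Ioo (-Real.pi) Real.pi) := by
  have h1 : IntegrableOn G (Icc 0 R ×ˢ Icc (-Real.pi) Real.pi) :=
    hG.continuousOn.integrableOn_compact (isCompact_Icc.prod isCompact_Icc)
  refine h1.of_forall_sdiff_eq_zero (measurableSet_Ioi.prod measurableSet_Ioo) ?_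
  rintro ⟨r, θ⟩ ⟨⟨hr, hθ⟩, h⟩
  refine h0 r θ (not_le.1 fun hR => h ⟨⟨le_of_lt hr, hR⟩, hθ.1.le, hθ.2.le⟩)

/-- The Cauchy–Pompeiu formula for functions with compact support. -/
theorem integral_inv_smul_dbar [IsScalarTower ℝ ℂ F] [CompleteSpace F] {f : ℂ → F} (hf : ContDiff ℝ 1 f)
    (hs : HasCompactSupport f) :
    ∫ w, w⁻¹ • dbar f w = -(Real.pi : ℂ) • f 0 := by
  obtain ⟨R, hR⟩ := hs.isCompact.isBounded.subset_closedBall 0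
  let e : ℝ → ℂ := fun θ => Real.cos θ + Real.sin θ * Complex.I
  have he : Continuous e := by fun_prop
  have hne : ∀ θ, ‖e θ‖ = 1 := fun θ => by
    have h := Complex.norm_exp_ofReal_mul_I θ
    rwa [Complex.exp_mul_I, ← Complex.ofReal_cos, ← Complex.ofReal_sin] at h
  have hed : ∀ θ, HasDerivAt e (Complex.I * e θ) θ := by
    intro θ
    have h1 := (Real.hasDerivAt_cos θ).ofReal_comp.add
      ((Real.hasDerivAt_sin θ).ofReal_comp.mul_const Complex.I)
    refine h1.congr_deriv ?_
    simp only [e, Complex.ofReal_neg]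
    linear_combination (-(Real.sin θ : ℂ)) * Complex.I_mul_I
  have hz : ∀ r θ, R < r → fderiv ℝ f ((r : ℂ) * e θ) = 0 := by
    intro r θ hr
    refine image_eq_zero_of_notMem_tsupport fun h => ?_
    have h2 := hR (tsupport_fderiv_subset ℝ h)
    rw [mem_closedBall_zero_iff, norm_mul, hne, mul_one, Complex.norm_real] at h2
    exact absurd (h2.trans' (le_abs_self r)) (not_le.2 hr)
  have hfz : ∀ r θ, R < r → f ((r : ℂ) * e θ) = 0 := by
    intro r θ hr
    refine image_eq_zero_of_notMem_tsupport fun h => ?_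
    have h2 := hR h
    rw [mem_closedBall_zero_iff, norm_mul, hne, mul_one, Complex.norm_real] at h2
    exact absurd (h2.trans' (le_abs_self r)) (not_le.2 hr)
  have hcf : Continuous (fderiv ℝ f) := hf.continuous_fderiv one_ne_zero
  -- `A` is ∂f/∂r and `B` is r⁻¹ ∂f/∂θ. In polar coordinates the integrand, with the Jacobian, is (A
  -- + iB)/2: the radial integral of `A` telescopes to -f(0), and the angular integral of `B`
  -- vanishes by periodicity.
  let A : ℝ × ℝ → F := fun p => fderiv ℝ f ((p.1 : ℂ) * e p.2) (e p.2)
  let B : ℝ × ℝ → F := fun p => fderiv ℝ f ((p.1 : ℂ) * e p.2) (Complex.I * e p.2)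
  have hA : Continuous A := by fun_prop
  have hB : Continuous B := by fun_prop
  have hAi := integrableOn_polar hA R fun r θ hr => by simp [A, hz r θ hr]
  have hBi := integrableOn_polar hB R fun r θ hr => by simp [B, hz r θ hr]
  have hfd : ∀ w, HasFDerivAt f (fderiv ℝ f w) w := fun w =>
    (hf.differentiable one_ne_zero w).hasFDerivAt
  have hAint : ∫ p in Ioi (0 : ℝ) ×ˢ Ioo (-Real.pi) Real.pi, A p = -(2 * Real.pi) • f 0 := by
    rw [Measure.volume_eq_prod, ← setIntegral_prod_swap, setIntegral_prod _ (by
      rw [← Measure.volume_eq_prod]; exact hAi.swap)]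
    have : ∀ θ, ∫ r in Ioi (0 : ℝ), A (r, θ) = - f 0 := by
      intro θ
      have h1 := integral_Ioi_of_hasDerivAt_of_tendsto' (a := 0) (m := 0)
        (f := fun r : ℝ => f ((r : ℂ) * e θ)) (f' := fun r => A (r, θ)) ?_ ?_ ?_
      · simpa using h1
      · intro r _
        have h2 : HasDerivAt (fun r : ℝ => (r : ℂ) * e θ) (e θ) r := by
          simpa using (Complex.ofRealCLM.hasDerivAt (x := r)).mul_const (e θ)
        exact (hfd _).comp_hasDerivAt r h2
      · have h2 : IntegrableOn (fun r => A (r, θ)) (Icc 0 R) :=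
          (hA.comp (by fun_prop : Continuous fun r : ℝ => (r, θ))).continuousOn.integrableOn_compact
            isCompact_Icc
        refine h2.of_forall_sdiff_eq_zero measurableSet_Ioi ?_
        rintro r ⟨hr, h⟩
        have : R < r := not_le.1 fun hR => h ⟨le_of_lt hr, hR⟩
        simp [A, hz r θ this]
      · refine tendsto_const_nhds.congr' ?_
        filter_upwards [eventually_gt_atTop R] with r hr
        exact (hfz r θ hr).symm
    simp only [Prod.swap_prod_mk, this]
    simp [← two_mul, max_eq_left Real.two_pi_pos.le]
  have hBint : ∫ p in Ioi (0 : ℝ) ×ˢ Ioo (-Real.pi) Real.pi, B p = 0 := by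
    rw [Measure.volume_eq_prod, setIntegral_prod _ (by rw [← Measure.volume_eq_prod]; exact hBi)]
    refine (setIntegral_congr_fun measurableSet_Ioi fun r hr => ?_).trans (integral_zero _ _)
    have hr' : (r : ℝ) ≠ 0 := ne_of_gt hr
    rw [← integral_Ioc_eq_integral_Ioo, ← intervalIntegral.integral_of_le (by linarith [Real.pi_pos])]
    have h1 := intervalIntegral.integral_eq_sub_of_hasDerivAt (a := -Real.pi) (b := Real.pi)
      (f := fun θ : ℝ => r⁻¹ • f ((r : ℂ) * e θ)) (f' := fun θ => B (r, θ)) ?_ ?_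
    · rw [h1]; simp [e]
    · intro θ _
      have h2 := ((hfd ((r : ℂ) * e θ)).comp_hasDerivAt θ ((hed θ).const_mul (r : ℂ))).const_smul r⁻¹
      refine h2.congr_deriv ?_
      have : (r : ℂ) * (Complex.I * e θ) = r • (Complex.I * e θ) := by simp
      rw [this, map_smul, smul_smul, inv_mul_cancel₀ hr', one_smul]
    · exact (hB.comp (by fun_prop : Continuous fun θ : ℝ => (r, θ))).intervalIntegrable _ _
  have key : ∀ p ∈ polarCoord.target, p.1 • ((Complex.polarCoord.symm p)⁻¹ •
      dbar f (Complex.polarCoord.symm p)) = (1 / 2 : ℂ) • (A p + Complex.I • B p) := by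
    rintro ⟨r, θ⟩ ⟨hr, -⟩
    have hr' : (r : ℂ) ≠ 0 := by exact_mod_cast ne_of_gt hr
    have hcs : (Real.cos θ : ℂ) ^ 2 + (Real.sin θ : ℂ) ^ 2 = 1 := by
      exact_mod_cast Real.cos_sq_add_sin_sq θ
    have hinv : (e θ)⁻¹ = Real.cos θ - Real.sin θ * Complex.I := by
      refine inv_eq_of_mul_eq_one_right ?_
      simp only [e]
      linear_combination hcs - (Real.sin θ : ℂ) ^ 2 * Complex.I_mul_I
    have h1 : e θ = Real.cos θ • (1 : ℂ) + Real.sin θ • Complex.I := by simp [e]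
    have h2 : Complex.I * e θ = (-Real.sin θ) • (1 : ℂ) + Real.cos θ • Complex.I := by
      simp only [e, Complex.real_smul, Complex.ofReal_neg]
      linear_combination (Real.sin θ : ℂ) * Complex.I_mul_I
    have h3 : Complex.polarCoord.symm (r, θ) = r * e θ := by simp [e]
    have hRC : ∀ (a : ℝ) (x : F), a • x = (a : ℂ) • x := fun a x => (algebraMap_smul ℂ a x).symm
    simp only [A, B, h3, dbar, partialRe, partialIm]
    rw [mul_inv, hinv]
    set T := fderiv ℝ f (↑r * e θ)
    rw [h2, h1]
    simp only [map_add, map_smul, hRC, smul_add, smul_smul]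
    simp only [Complex.ofReal_neg]
    rw [show ((r:ℂ) * ((r:ℂ)⁻¹ * (Real.cos θ - Real.sin θ * Complex.I) * (1/2))) =
      (1/2) * (Real.cos θ : ℂ) + (1/2) * (Complex.I * -(Real.sin θ)) by field_simp; ring]
    rw [show ((r:ℂ) * ((r:ℂ)⁻¹ * (Real.cos θ - Real.sin θ * Complex.I) * (1/2 * Complex.I))) =
      (1/2) * (Real.sin θ : ℂ) + (1/2) * (Complex.I * (Real.cos θ)) by
        field_simp; linear_combination -(Real.sin θ : ℂ) * Complex.I_sq]
    simp only [add_smul]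
    abel
  rw [← Complex.integral_comp_polarCoord_symm,
    setIntegral_congr_fun polarCoord.open_target.measurableSet key, integral_smul]
  change (1 / 2 : ℂ) • ∫ p in Ioi (0 : ℝ) ×ˢ Ioo (-Real.pi) Real.pi, (A p + Complex.I • B p) = _
  have hadd := integral_add hAi (hBi.smul Complex.I)
  simp only [Pi.smul_apply] at hadd
  rw [hadd, integral_smul, hAint, hBint, smul_zero, add_zero,
    ← algebraMap_smul ℂ (-(2 * Real.pi)) (f 0), smul_smul]
  congr 1
  simp

end Dbar

/-! ### The Cauchy transform and its estimates on small discs. -/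

section CauchyTransform

/-- The Jacobian r of polar coordinates cancels the singularity 1/r. -/
theorem integral_ball_norm_inv {ε : ℝ} (hε : 0 < ε) :
    IntegrableOn (fun w : ℂ => ‖w‖⁻¹) (Metric.ball 0 ε) ∧
      ∫ w in Metric.ball (0 : ℂ) ε, ‖w‖⁻¹ = 2 * Real.pi * ε := by
  have hpow : ∀ y ∈ Ioo (0 : ℝ) ε, y ^ (Module.finrank ℝ ℂ - 1) • y⁻¹ = 1 := fun y hy => by
    simp [Complex.finrank_real_complex, hy.1.ne']
  refine ⟨(integrableOn_fun_norm_addHaar volume (f := fun y : ℝ => y⁻¹)).2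
    (IntegrableOn.congr_fun (f := fun _ => 1) (integrableOn_const (by simp))
      (fun y hy => (hpow y hy).symm) measurableSet_Ioo), ?_⟩
  have h1 := integral_fun_norm_addHaar (volume : Measure ℂ) (indicator (Iio ε) fun y : ℝ => y⁻¹)
  have h2 : (fun w : ℂ => indicator (Iio ε) (fun y : ℝ => y⁻¹) ‖w‖) =
      indicator (Metric.ball 0 ε) fun w => ‖w‖⁻¹ := by
    ext w; simp [indicator]
  have h3 : ∀ y ∈ Ioi (0 : ℝ), y ^ (Module.finrank ℝ ℂ - 1) • indicator (Iio ε) (fun y : ℝ => y⁻¹) y =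
      indicator (Iio ε) (fun _ => (1 : ℝ)) y := by
    intro y hy
    by_cases h : y < ε
    · simpa [indicator, h] using hpow y ⟨hy, h⟩
    · simp [indicator, h]
  rw [h2, integral_indicator Metric.isOpen_ball.measurableSet,
    setIntegral_congr_fun measurableSet_Ioi h3, setIntegral_indicator measurableSet_Iio,
    Ioi_inter_Iio] at h1
  rw [h1]
  simp [Complex.finrank_real_complex, Measure.real, Complex.volume_ball, hε.le]
  ring

/-- The kernel `1 / (π w)` of the Cauchy transform. -/
def cauchyKernel (w : ℂ) : ℂ := (Real.pi : ℂ)⁻¹ * w⁻¹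

theorem locallyIntegrable_cauchyKernel : LocallyIntegrable cauchyKernel := by
  intro x
  refine ⟨Metric.ball 0 (‖x‖ + 1), Metric.isOpen_ball.mem_nhds (by simp), ?_⟩
  have h := (integral_ball_norm_inv (ε := ‖x‖ + 1) (by positivity)).1
  refine Integrable.mono' (h.const_mul Real.pi⁻¹) ?_ (Eventually.of_forall fun w => ?_)
  · exact (measurable_const.mul measurable_inv).aestronglyMeasurable
  · simp [cauchyKernel, abs_of_pos Real.pi_pos]

/-- The disc need not be centred at the pole. Near 0 the integrand contributes at most 2πε; farther
away it is at most ε⁻¹, on a disc of area πε². The bound is therefore independent of `a`. -/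
theorem integral_closedBall_norm_inv_le {ε : ℝ} (hε : 0 < ε) (a : ℂ) :
    IntegrableOn (fun w : ℂ => ‖w‖⁻¹) (Metric.closedBall a ε) ∧
    ∫ w in Metric.closedBall a ε, ‖w‖⁻¹ ≤ 3 * Real.pi * ε := by
  obtain ⟨h1, h2⟩ := integral_ball_norm_inv hε
  have hg : IntegrableOn (fun w : ℂ => indicator (Metric.ball 0 ε) (fun w => ‖w‖⁻¹) w + ε⁻¹)
      (Metric.closedBall a ε) :=
    ((integrable_indicator_iff Metric.isOpen_ball.measurableSet).2 h1).integrableOn.add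
      (integrableOn_const (by simp [Complex.volume_closedBall, ENNReal.mul_eq_top]))
  have hle : ∀ w : ℂ, ‖w‖⁻¹ ≤ indicator (Metric.ball 0 ε) (fun w => ‖w‖⁻¹) w + ε⁻¹ := by
    intro w
    by_cases h : w ∈ Metric.ball (0 : ℂ) ε
    · simp only [indicator_of_mem h]
      linarith [inv_pos.2 hε]
    · simp only [indicator_of_notMem h, zero_add]
      exact inv_anti₀ hε (by simpa using h)
  have hi : IntegrableOn (fun w : ℂ => ‖w‖⁻¹) (Metric.closedBall a ε) := by
    refine Integrable.mono' hg (measurable_norm.inv).aestronglyMeasurable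
      (Eventually.of_forall fun w => ?_)
    simpa using hle w
  refine ⟨hi, (integral_mono hi hg hle).trans ?_⟩
  rw [integral_add ((integrable_indicator_iff Metric.isOpen_ball.measurableSet).2 h1).integrableOn
      (integrableOn_const (by simp [Complex.volume_closedBall, ENNReal.mul_eq_top]))]
  have h3 : ∫ w in Metric.closedBall a ε, indicator (Metric.ball 0 ε) (fun w : ℂ => ‖w‖⁻¹) w ≤
      2 * Real.pi * ε := by
    rw [← h2, ← integral_indicator Metric.isOpen_ball.measurableSet]
    exact setIntegral_le_integral ((integrable_indicator_iff Metric.isOpen_ball.measurableSet).2 h1)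
      (Eventually.of_forall fun w => indicator_nonneg (fun _ _ => by positivity) w)
  have h4 : ∫ _ in Metric.closedBall a ε, ε⁻¹ = Real.pi * ε := by
    simp [Measure.real, Complex.volume_closedBall, hε.le]
    field_simp
  linarith

variable {F : Type*} [NormedAddCommGroup F] [NormedSpace ℝ F] [NormedSpace ℂ F]
  [IsScalarTower ℝ ℂ F]

/-- The Cauchy transform, which inverts `∂/∂w̄` on functions with compact support. -/
def cauchyTransform (f : ℂ → F) : ℂ → F :=
  convolution cauchyKernel f (ContinuousLinearMap.lsmul ℝ ℂ) volume

theorem cauchyTransform_apply (f : ℂ → F) (z : ℂ) :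
    cauchyTransform f z = ∫ w, cauchyKernel w • f (z - w) := rfl

theorem contDiff_cauchyTransform {f : ℂ → F} (hf : ContDiff ℝ ∞ f) (hs : HasCompactSupport f) :
    ContDiff ℝ ∞ (cauchyTransform f) :=
  hs.contDiff_convolution_right _ locallyIntegrable_cauchyKernel hf

theorem fderiv_cauchyTransform {f : ℂ → F} (hf : ContDiff ℝ ∞ f) (hs : HasCompactSupport f) :
    fderiv ℝ (cauchyTransform f) = cauchyTransform (fderiv ℝ f) := by
  ext1 z
  exact (hs.hasFDerivAt_convolution_right _ locallyIntegrable_cauchyKernel (hf.of_le (by simp)) z).fderiv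

/-- One power of the radius is gained, uniformly in `z`: the factor is π⁻¹ times the bound 3πε for
the integral of ‖w‖⁻¹. This smallness makes the Neumann series converge. -/
theorem norm_cauchyTransform_le {f : ℂ → F} {c : ℂ} {ε A : ℝ} (hε : 0 < ε) 
    (hs : tsupport f ⊆ Metric.closedBall c ε) (hA : ∀ w, ‖f w‖ ≤ A) (z : ℂ) :
    ‖cauchyTransform f z‖ ≤ 3 * ε * A := by
  have hA0 : 0 ≤ A := (norm_nonneg _).trans (hA 0)
  obtain ⟨hi, hle⟩ := integral_closedBall_norm_inv_le hε (z - c)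
  have hb : ∀ w, ‖cauchyKernel w • f (z - w)‖ ≤
      indicator (Metric.closedBall (z - c) ε) (fun w => Real.pi⁻¹ * A * ‖w‖⁻¹) w := by
    intro w
    by_cases h : w ∈ Metric.closedBall (z - c) ε
    · rw [indicator_of_mem h, norm_smul, cauchyKernel, norm_mul, norm_inv, norm_inv,
        Complex.norm_real, Real.norm_of_nonneg Real.pi_pos.le, mul_right_comm]
      gcongr
      exact hA _
    · rw [indicator_of_notMem h, image_eq_zero_of_notMem_tsupport (f := f), smul_zero, norm_zero]
      intro h'
      refine h ?_
      have := hs h'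
      rw [mem_closedBall_iff_norm] at this ⊢
      rwa [← norm_neg, show -(w - (z - c)) = z - w - c by ring]
  rw [cauchyTransform_apply]
  refine (norm_integral_le_of_norm_le ((integrable_indicator_iff
    Metric.isClosed_closedBall.measurableSet).2 (hi.const_mul _)) (Eventually.of_forall hb)).trans ?_
  rw [integral_indicator Metric.isClosed_closedBall.measurableSet, integral_const_mul]
  have : Real.pi⁻¹ * A * (3 * Real.pi * ε) = 3 * ε * A := by field_simp
  rw [← this]
  gcongr

theorem hasCompactSupport_of_tsupport_subset_closedBall {E : Type*} [Zero E] {f : ℂ → E} {c : ℂ}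
    {ε : ℝ} (hs : tsupport f ⊆ Metric.closedBall c ε) : HasCompactSupport f :=
  (isCompact_closedBall c ε).of_isClosed_subset (isClosed_tsupport f) hs

/-- Derivatives commute with the convolution, so each order reduces to the sup bound. The space `F`
is quantified inside the induction because a derivative replaces it by `ℂ →L[ℝ] F`. -/
theorem norm_iteratedFDeriv_cauchyTransform_le {c : ℂ} {ε A : ℝ} (hε : 0 < ε) (k : ℕ) :
    ∀ {F : Type _} [NormedAddCommGroup F] [NormedSpace ℝ F] [NormedSpace ℂ F]
      [IsScalarTower ℝ ℂ F] {f : ℂ → F}, ContDiff ℝ ∞ f →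
    tsupport f ⊆ Metric.closedBall c ε → (∀ w, ‖iteratedFDeriv ℝ k f w‖ ≤ A) → ∀ z,
    ‖iteratedFDeriv ℝ k (cauchyTransform f) z‖ ≤ 3 * ε * A := by
  induction k with
  | zero =>
    intro F _ _ _ _ f hf hs hA z
    simp only [norm_iteratedFDeriv_zero] at hA ⊢
    exact norm_cauchyTransform_le hε hs hA z
  | succ k ih =>
    intro F _ _ _ _ f hf hs hA z
    rw [← norm_iteratedFDeriv_fderiv,
      fderiv_cauchyTransform hf (hasCompactSupport_of_tsupport_subset_closedBall hs)]
    refine ih (hf.fderiv_right (by simp)) ((tsupport_fderiv_subset ℝ).trans hs) (fun w => ?_) z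
    rw [norm_iteratedFDeriv_fderiv]
    exact hA w

theorem dbar_cauchyTransform [CompleteSpace F] {f : ℂ → F} (hf : ContDiff ℝ ∞ f)
    (hs : HasCompactSupport f) (z : ℂ) : dbar (cauchyTransform f) z = f z := by
  have hf1 : ContDiff ℝ 1 f := hf.of_le (by simp)
  have happ : ∀ e : ℂ, (cauchyTransform (fderiv ℝ f) z) e =
      ∫ w, cauchyKernel w • (fderiv ℝ f (z - w) e) := by
    intro e
    rw [cauchyTransform_apply, ContinuousLinearMap.integral_apply]
    · rfl
    · exact (hs.fderiv ℝ).convolutionExists_right (ContinuousLinearMap.lsmul ℝ ℂ)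
        locallyIntegrable_cauchyKernel (hf1.continuous_fderiv one_ne_zero) z
  have hint : ∀ e : ℂ, Integrable fun w => cauchyKernel w • (fderiv ℝ f (z - w) e) := by
    intro e
    have h := (hs.fderiv_apply ℝ e).convolutionExists_right (ContinuousLinearMap.lsmul ℝ ℂ)
        locallyIntegrable_cauchyKernel ((hf1.continuous_fderiv_apply one_ne_zero).comp (by fun_prop : Continuous fun w : ℂ => (w, e))) z
    exact h
  have h1 : dbar (cauchyTransform f) z = ∫ w, cauchyKernel w • dbar f (z - w) := by
    simp only [dbar, partialRe, partialIm, fderiv_cauchyTransform hf hs, happ]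
    have hI : Integrable fun w => Complex.I • cauchyKernel w • (fderiv ℝ f (z - w) Complex.I) :=
      (hint Complex.I).smul Complex.I
    rw [← integral_smul, ← integral_add (hint _) hI, ← integral_smul]
    congr 1
    ext w
    simp only [smul_add]
    congr 1
    · rw [smul_comm]
    · rw [smul_comm Complex.I, smul_comm (1 / 2 : ℂ)]
  -- The reflection moves `z` to the origin, where Cauchy–Pompeiu applies; the sign it puts on ∂̄
  -- cancels the sign in that formula.
  let g : ℂ → F := fun w => f (z - w)
  have hg : ContDiff ℝ 1 g := hf1.comp (contDiff_const.sub contDiff_id)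
  have hgs : HasCompactSupport g := hs.comp_homeomorph (Homeomorph.subLeft z)
  have hgd : ∀ w, dbar g w = - dbar f (z - w) := by
    intro w
    have : fderiv ℝ g w = - fderiv ℝ f (z - w) := by
      have h2 := (hf1.differentiable one_ne_zero (z - w)).hasFDerivAt.comp w
        ((hasFDerivAt_id (𝕜 := ℝ) w).const_sub z)
      refine HasFDerivAt.fderiv (h2.congr_fderiv ?_)
      ext; simp
    simp only [dbar, partialRe, partialIm, this, neg_apply, smul_neg, ← neg_add]
  have h3 := integral_inv_smul_dbar hg hgs
  rw [h1]
  have h4 : ∀ w, cauchyKernel w • dbar f (z - w) = (-(Real.pi : ℂ)⁻¹) • (w⁻¹ • dbar g w) := by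
    intro w
    rw [hgd, cauchyKernel, smul_neg, smul_neg, neg_smul, neg_neg, mul_smul]
  simp only [h4]
  rw [integral_smul, h3, smul_smul]
  simp [g, Real.pi_ne_zero]

end CauchyTransform

/-! ### Local solution of ∂̄g = Bg by a Neumann series. -/

section LocalGauge

section Gauge
variable {n : ℕ}

theorem norm_iteratedFDeriv_mul_le {b h : ℂ → EndCn n} (hb : ContDiff ℝ ∞ b) (hh : ContDiff ℝ ∞ h)
    (k : ℕ) (x : ℂ) :
    ‖iteratedFDeriv ℝ k (fun y => b y * h y) x‖ ≤ ∑ i ∈ Finset.range (k + 1),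
      (k.choose i : ℝ) * ‖iteratedFDeriv ℝ i b x‖ * ‖iteratedFDeriv ℝ (k - i) h x‖ := 
  _root_.norm_iteratedFDeriv_mul_le hb hh x (by exact_mod_cast le_top)

/-- The terms of the Neumann series for `∂g/∂w̄ = b g`. -/
def neumannTerm (b : ℂ → EndCn n) : ℕ → ℂ → EndCn n
  | 0 => fun _ => 1
  | m + 1 => cauchyTransform fun w => b w * neumannTerm b m w

theorem tsupport_mul_subset {b : ℂ → EndCn n} {c : ℂ} {ε : ℝ}
    (hs : tsupport b ⊆ Metric.closedBall c ε) (h : ℂ → EndCn n) :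
    tsupport (fun w => b w * h w) ⊆ Metric.closedBall c ε :=
  (tsupport_mul_subset_left (f := b) (g := h)).trans hs

theorem contDiff_neumannTerm {b : ℂ → EndCn n} (hb : ContDiff ℝ ∞ b) {c : ℂ} {ε : ℝ}
    (hs : tsupport b ⊆ Metric.closedBall c ε) (m : ℕ) : ContDiff ℝ ∞ (neumannTerm b m) := by
  induction m with
  | zero => exact contDiff_const
  | succ m ih =>
    exact contDiff_cauchyTransform (hb.mul ih)
      (hasCompactSupport_of_tsupport_subset_closedBall (tsupport_mul_subset hs _))

theorem exists_norm_iteratedFDeriv_le_of_tsupport {b : ℂ → EndCn n} (hb : ContDiff ℝ ∞ b) {c : ℂ}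
    {ε : ℝ} (hs : tsupport b ⊆ Metric.closedBall c ε) (k : ℕ) :
    ∃ C, ∀ x, ‖iteratedFDeriv ℝ k b x‖ ≤ C :=
  ((hasCompactSupport_of_tsupport_subset_closedBall hs).iteratedFDeriv k).exists_bound_of_continuous
    (hb.continuous_iteratedFDeriv (by exact_mod_cast le_top))

/-- Induction on the order k, then on m. In the Leibniz expansion of the k-th derivative of b·h only
one term contains the k-th derivative of h, and its coefficient 3εC ≤ 1/8 does not depend on k; all
other terms involve lower orders, already bounded. So one radius serves every order, and the sum of
the series is smooth. -/
theorem norm_neumannTerm_le {b : ℂ → EndCn n} (hb : ContDiff ℝ ∞ b) {c : ℂ} {ε C : ℝ} (hε : 0 < ε)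
    (hs : tsupport b ⊆ Metric.closedBall c ε) (hC : ∀ w, ‖b w‖ ≤ C) (hεC : 3 * ε * C ≤ 1 / 8)
    (k : ℕ) : ∃ A, (k = 0 → A = 1) ∧ 0 ≤ A ∧ 
      ∀ m x, ‖iteratedFDeriv ℝ k (neumannTerm b m) x‖ ≤ A * (1 / 4) ^ m := by
  have hC0 : 0 ≤ C := (norm_nonneg _).trans (hC 0)
  have hone : ‖(1 : EndCn n)‖ ≤ 1 := ContinuousLinearMap.norm_id_le
  induction k using Nat.strong_induction_on with
  | _ k ih =>
  choose! A' hA'0 hA'nn hA' using ih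
  choose M hM using exists_norm_iteratedFDeriv_le_of_tsupport hb hs
  have hM0 : ∀ j, 0 ≤ M j := fun j => (norm_nonneg _).trans (hM j 0)
  set D := 3 * ε * ∑ i ∈ Finset.range k,
    (k.choose (i + 1) : ℝ) * M (i + 1) * A' (k - (i + 1)) with hD
  have hD0 : 0 ≤ D := by
    refine mul_nonneg (by positivity) (Finset.sum_nonneg fun i hi => ?_)
    exact mul_nonneg (mul_nonneg (by positivity) (hM0 _))
      (hA'nn _ (by have := Finset.mem_range.1 hi; omega))
  have hk0 : k = 0 → D = 0 := by rintro rfl; simp [hD]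
  -- The constant A = 1 + 8D satisfies A/8 + D ≤ A/4, which closes the induction on m; the summand 1
  -- covers m = 0. For k = 0 the sum `D` is empty, so A = 1, as invertibility of the series
  -- requires.
  refine ⟨1 + 8 * D, fun hk => by rw [hk0 hk]; ring, by positivity, fun m => ?_⟩
  induction m with
  | zero =>
    intro x
    have h1 : ‖iteratedFDeriv ℝ k (neumannTerm b 0) x‖ ≤ 1 := by
      rcases Nat.eq_zero_or_pos k with rfl | hk
      · rw [norm_iteratedFDeriv_zero]; exact hone
      · have : neumannTerm b 0 = fun _ => (1 : EndCn n) := rfl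
        rw [this, iteratedFDeriv_const_of_ne hk.ne']
        simp
    simpa using h1.trans (by linarith)
  | succ m ihm =>
    have hcd := contDiff_neumannTerm hb hs m
    have key : ∀ y, ‖iteratedFDeriv ℝ k (fun w => b w * neumannTerm b m w) y‖ ≤
        (C * (1 + 8 * D) + ∑ i ∈ Finset.range k,
          (k.choose (i + 1) : ℝ) * M (i + 1) * A' (k - (i + 1))) * (1 / 4) ^ m := by
      intro y
      refine (norm_iteratedFDeriv_mul_le hb hcd k y).trans ?_
      rw [Finset.sum_range_succ', add_comm, add_mul, Finset.sum_mul]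
      refine add_le_add ?_ (Finset.sum_le_sum fun i hi => ?_)
      · simp only [Nat.choose_zero_right, Nat.cast_one, one_mul, norm_iteratedFDeriv_zero,
          Nat.sub_zero, mul_assoc]
        exact mul_le_mul (hC y) (ihm y) (norm_nonneg _) hC0
      · have hik := Finset.mem_range.1 hi
        rw [mul_assoc, mul_assoc, mul_assoc]
        refine mul_le_mul_of_nonneg_left ?_ (by positivity)
        exact mul_le_mul (hM _ y) (hA' _ (by omega) m y) (norm_nonneg _) (hM0 _)
    intro x
    refine (norm_iteratedFDeriv_cauchyTransform_le hε k (hb.mul hcd) (tsupport_mul_subset hs _)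
      key x).trans ?_
    have h1 : 3 * ε * (C * (1 + 8 * D)) ≤ 1 / 8 * (1 + 8 * D) := by
      rw [← mul_assoc]; gcongr
    have h2 : 3 * ε * (C * (1 + 8 * D)) + D ≤ (1 + 8 * D) * (1 / 4) := by linarith
    calc _ = (3 * ε * (C * (1 + 8 * D)) + D) * (1 / 4) ^ m := by rw [hD]; ring
      _ ≤ (1 + 8 * D) * (1 / 4) * (1 / 4) ^ m :=
        mul_le_mul_of_nonneg_right h2 (pow_nonneg (by norm_num) m)
      _ = _ := by rw [pow_succ']; ring

theorem dbar_tsum_of_norm_le {F : Type*} [NormedAddCommGroup F] [NormedSpace ℝ F]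
    [NormedSpace ℂ F] [CompleteSpace F] {f : ℕ → ℂ → F} {u : ℕ → ℝ} (hu : Summable u)
    (hf : ∀ m, Differentiable ℝ (f m)) (hf' : ∀ m x, ‖fderiv ℝ (f m) x‖ ≤ u m)
    (hf0 : ∀ x, Summable fun m => f m x) (x : ℂ) :
    HasSum (fun m => dbar (f m) x) (dbar (fun y => ∑' m, f m y) x) := by
  have hs : Summable fun m => fderiv ℝ (f m) x := Summable.of_norm_bounded hu fun m => hf' m x
  have h := fderiv_tsum_apply hu hf hf' (hf0 0) x
  have happ : ∀ e : ℂ, HasSum (fun m => fderiv ℝ (f m) x e)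
      (fderiv ℝ (fun y => ∑' m, f m y) x e) := by
    intro e
    rw [h]
    exact hs.hasSum.mapL (ContinuousLinearMap.apply ℝ F e)
  exact ((happ 1).add ((happ Complex.I).const_smul Complex.I)).const_smul _

theorem contDiff_of_contDiffAt_tsupport {E F : Type*} [NormedAddCommGroup E] [NormedSpace ℝ E]
    [NormedAddCommGroup F] [NormedSpace ℝ F] {k : ℕ∞ω} {f : E → F}
    (h : ∀ x ∈ tsupport f, ContDiffAt ℝ k f x) : ContDiff ℝ k f := by
  refine contDiff_iff_contDiffAt.2 fun x => ?_
  by_cases hx : x ∈ tsupport f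
  · exact h x hx
  · exact contDiffAt_const.congr_of_eventuallyEq (notMem_tsupport_iff_eventuallyEq.1 hx)

/-- Local solvability of `∂g/∂w̄ = B g`, with `g` smooth and invertible. -/
theorem exists_gauge {B : ℂ → EndCn n} {U : Set ℂ} {w₀ : ℂ} (hU : U ∈ 𝓝 w₀)
    (hB : ContDiffOn ℝ ∞ B U) :
    ∃ g : ℂ → EndCn n, ContDiff ℝ ∞ g ∧ (∀ w, IsUnit (g w)) ∧
      ∀ᶠ w in 𝓝 w₀, dbar g w = B w * g w := by
  set C := ‖B w₀‖ + 1 with hCdef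
  have hC0 : 0 < C := by positivity
  have hcont : ContinuousAt B w₀ := (hB.continuousOn).continuousAt hU
  have hev : ∀ᶠ w in 𝓝 w₀, ‖B w‖ ≤ C :=
    (hcont.norm.eventually_lt_const (by simp [hCdef] : ‖B w₀‖ < C)).mono fun _ h => h.le
  obtain ⟨R, hR, hball⟩ := Metric.nhds_basis_ball.mem_iff.1 (inter_mem (interior_mem_nhds.2 hU) hev)
  -- The second bound yields 3εC ≤ 1/8; the first keeps the support of the cutoff inside the ball
  -- where `B` is smooth and bounded by `C`.
  set ε := min (R / 2) (1 / (24 * C)) with hεdef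
  have hε : 0 < ε := by positivity
  have hεR : ε < R := (min_le_left _ _).trans_lt (by linarith)
  have hεC : 3 * ε * C ≤ 1 / 8 := by
    have : ε ≤ 1 / (24 * C) := min_le_right _ _
    calc 3 * ε * C ≤ 3 * (1 / (24 * C)) * C := by gcongr
      _ = 1 / 8 := by field_simp; norm_num
  let χ : ContDiffBump w₀ := ⟨ε / 2, ε, by positivity, by linarith⟩
  let b : ℂ → EndCn n := fun w => χ w • B w
  have hts : tsupport b ⊆ Metric.closedBall w₀ ε := by
    refine (tsupport_smul_subset_left χ B).trans ?_
    rw [χ.tsupport_eq]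
  have hsub : ∀ w ∈ Metric.closedBall w₀ ε, w ∈ interior U ∧ ‖B w‖ ≤ C := fun w hw =>
    hball (Metric.closedBall_subset_ball hεR hw)
  have hb : ContDiff ℝ ∞ b := by
    refine contDiff_of_contDiffAt_tsupport fun w hw => ?_
    exact χ.contDiffAt.smul (hB.contDiffAt (mem_interior_iff_mem_nhds.1 (hsub w (hts hw)).1))
  have hbC : ∀ w, ‖b w‖ ≤ C := by
    intro w
    by_cases hw : w ∈ Metric.closedBall w₀ ε
    · rw [norm_smul, Real.norm_of_nonneg χ.nonneg]
      calc χ w * ‖B w‖ ≤ 1 * C := mul_le_mul χ.le_one (hsub w hw).2 (norm_nonneg _) zero_le_one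
        _ = C := one_mul C
    · rw [image_eq_zero_of_notMem_tsupport fun h => hw (hts h), norm_zero]
      exact hC0.le
  choose A hA1 hA0 hA using norm_neumannTerm_le hb hε hts hbC hεC
  have hsum : ∀ k, Summable fun m : ℕ => A k * (1 / 4 : ℝ) ^ m := fun k =>
    (summable_geometric_of_lt_one (by norm_num) (by norm_num)).mul_left _
  have hcd := contDiff_neumannTerm hb hts
  have hbound : ∀ m x, ‖neumannTerm b m x‖ ≤ (1 / 4 : ℝ) ^ m := fun m x => by
    have := hA 0 m x
    rwa [norm_iteratedFDeriv_zero, hA1 0 rfl, one_mul] at this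
  have hgeo : Summable fun m : ℕ => (1 / 4 : ℝ) ^ m :=
    summable_geometric_of_lt_one (by norm_num) (by norm_num)
  have hs0 : ∀ x, Summable fun m => neumannTerm b m x := fun x =>
    Summable.of_norm_bounded hgeo fun m => hbound m x
  refine ⟨fun w => ∑' m, neumannTerm b m w, ?_, ?_, ?_⟩
  · exact contDiff_tsum (N := ⊤) hcd (fun k _ => hsum k) fun k m x _ => hA k m x
  · intro w
    -- Beyond the constant term 1, the series is bounded by the sum of 4⁻ᵐ over m ≥ 1, which is 1/3.
    have h1 : ‖1 - ∑' m, neumannTerm b m w‖ < 1 := by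
      rw [(hs0 w).tsum_eq_zero_add]
      have h2 : ‖∑' m, neumannTerm b (m + 1) w‖ ≤ 1 / 3 := by
        refine tsum_of_norm_bounded (g := fun m : ℕ => (1 / 4 : ℝ) * (1 / 4) ^ m) ?_ fun m => ?_
        · have h := (hasSum_geometric_of_lt_one (r := (1 / 4 : ℝ)) (by norm_num)
            (by norm_num)).mul_left (1 / 4)
          rwa [show (1 / 4 : ℝ) * (1 - 1 / 4)⁻¹ = 1 / 3 by norm_num] at h
        · rw [← pow_succ']; exact hbound _ _
      have h3 : neumannTerm b 0 w = 1 := rfl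
      rw [h3, sub_add_cancel_left, norm_neg]
      linarith
    have := (Units.oneSub _ h1).isUnit
    simpa using this
  · have hd := dbar_tsum_of_norm_le (hsum 1) (fun m => (hcd m).differentiable (by simp))
      (fun m x => by
        have h := hA 1 m x
        rwa [norm_iteratedFDeriv_one] at h) hs0
    have hterm : ∀ w m, dbar (neumannTerm b (m + 1)) w = b w * neumannTerm b m w := fun w m =>
      dbar_cauchyTransform (hb.mul (hcd m))
        (hasCompactSupport_of_tsupport_subset_closedBall (tsupport_mul_subset hts _)) w
    -- Applying ∂̄ shifts the series by one term, so the equation with the cut-off coefficient `b`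
    -- holds globally; near `w₀` the cutoff is 1.
    have hall : ∀ w, dbar (fun y => ∑' m, neumannTerm b m y) w =
        b w * ∑' m, neumannTerm b m w := by
      intro w
      refine (hd w).unique ?_
      have h0 : dbar (neumannTerm b 0) w = 0 := by
        have : neumannTerm b 0 = fun _ => (1 : EndCn n) := rfl
        simp [dbar, partialRe, partialIm, this]
      have h1 : HasSum (fun m => dbar (neumannTerm b (m + 1)) w)
          (b w * ∑' m, neumannTerm b m w) := by
        simp only [hterm]
        exact (hs0 w).hasSum.mul_left _
      have := (hasSum_nat_add_iff' (f := fun m => dbar (neumannTerm b m) w) 1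
        (g := b w * ∑' m, neumannTerm b m w)).1 (by simpa [h0] using h1)
      exact this
    have hχ := χ.eventuallyEq_one
    filter_upwards [hχ] with w hw
    rw [hall w]
    simp only [b, hw, Pi.one_apply, one_smul]

end Gauge

end LocalGauge

/-! ### Calculus of ∂ and ∂̄, in particular for endomorphism-valued functions. -/

section Wirtinger

variable {F : Type*} [NormedAddCommGroup F] [NormedSpace ℝ F] [NormedSpace ℂ F]

theorem dz_congr {f g : ℂ → F} {w : ℂ} (h : f =ᶠ[𝓝 w] g) : dz f w = dz g w := by
  simp only [dz, partialRe, partialIm, h.fderiv_eq]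

theorem dbar_congr {f g : ℂ → F} {w : ℂ} (h : f =ᶠ[𝓝 w] g) : dbar f w = dbar g w := by
  simp only [dbar, partialRe, partialIm, h.fderiv_eq]

theorem dz_eq_zero_of_eqOn {f : ℂ → F} {U : Set ℂ} (hU : IsOpen U) (h : ∀ w ∈ U, f w = 0) {w : ℂ}
    (hw : w ∈ U) : dz f w = 0 := by
  rw [dz_congr (g := fun _ => 0) (eventually_of_mem (hU.mem_nhds hw) h)]
  simp [dz, partialRe, partialIm]

theorem dbar_eq_zero_of_eqOn {f : ℂ → F} {U : Set ℂ} (hU : IsOpen U) (h : ∀ w ∈ U, f w = 0) {w : ℂ}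
    (hw : w ∈ U) : dbar f w = 0 := by
  rw [dbar_congr (g := fun _ => 0) (eventually_of_mem (hU.mem_nhds hw) h)]
  simp [dbar, partialRe, partialIm]

theorem dz_add {f g : ℂ → F} {w : ℂ} (hf : DifferentiableAt ℝ f w) (hg : DifferentiableAt ℝ g w) :
    dz (fun y => f y + g y) w = dz f w + dz g w := by
  simp only [dz, partialRe, partialIm, fderiv_fun_add hf hg, add_apply, smul_add, smul_sub]
  abel

theorem dz_sub {f g : ℂ → F} {w : ℂ} (hf : DifferentiableAt ℝ f w) (hg : DifferentiableAt ℝ g w) :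
    dz (fun y => f y - g y) w = dz f w - dz g w := by
  simp only [dz, partialRe, partialIm, fderiv_fun_sub hf hg, sub_apply, smul_sub]
  abel

theorem dbar_add {f g : ℂ → F} {w : ℂ} (hf : DifferentiableAt ℝ f w)
    (hg : DifferentiableAt ℝ g w) : dbar (fun y => f y + g y) w = dbar f w + dbar g w := by
  simp only [dbar, partialRe, partialIm, fderiv_fun_add hf hg, add_apply, smul_add]
  abel

theorem dz_const_sub (c : F) (f : ℂ → F) (w : ℂ) : dz (fun y => c - f y) w = - dz f w := by
  simp only [dz, partialRe, partialIm, fderiv_const_sub, neg_apply, smul_neg, smul_sub]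
  abel

theorem dbar_const_sub (c : F) (f : ℂ → F) (w : ℂ) : dbar (fun y => c - f y) w = - dbar f w := by
  simp only [dbar, partialRe, partialIm, fderiv_const_sub, neg_apply, smul_neg, smul_add]
  abel

theorem dbar_neg (f : ℂ → F) (w : ℂ) : dbar (fun y => - f y) w = - dbar f w := by
  simpa using dbar_const_sub 0 f w

section Smooth
variable {U : Set ℂ} {f : ℂ → F}

omit [NormedSpace ℂ F] in
theorem contDiffOn_fderiv_apply (hU : IsOpen U) (hf : ContDiffOn ℝ ∞ f U) (e : ℂ) :
    ContDiffOn ℝ ∞ (fun w => fderiv ℝ f w e) U :=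
  (hf.fderiv_of_isOpen hU (by simp)).clm_apply contDiffOn_const

theorem contDiffOn_dz (hU : IsOpen U) (hf : ContDiffOn ℝ ∞ f U) : ContDiffOn ℝ ∞ (dz f) U :=
  ((contDiffOn_fderiv_apply hU hf 1).sub
    ((contDiffOn_fderiv_apply hU hf Complex.I).const_smul Complex.I)).const_smul (1 / 2 : ℂ)

theorem contDiffOn_dbar (hU : IsOpen U) (hf : ContDiffOn ℝ ∞ f U) : ContDiffOn ℝ ∞ (dbar f) U :=
  ((contDiffOn_fderiv_apply hU hf 1).add
    ((contDiffOn_fderiv_apply hU hf Complex.I).const_smul Complex.I)).const_smul (1 / 2 : ℂ)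

omit [NormedSpace ℂ F] in
theorem ContDiffOn.differentiableAt_of_isOpen (hU : IsOpen U) (hf : ContDiffOn ℝ ∞ f U) {w : ℂ}
    (hw : w ∈ U) : DifferentiableAt ℝ f w :=
  (hf.contDiffAt (hU.mem_nhds hw)).differentiableAt (by simp)

omit [NormedSpace ℂ F] in
theorem fderiv_fderiv_comm (hU : IsOpen U) (hf : ContDiffOn ℝ ∞ f U) {w : ℂ} (hw : w ∈ U)
    (a b : ℂ) : fderiv ℝ (fun y => fderiv ℝ f y a) w b = fderiv ℝ (fun y => fderiv ℝ f y b) w a := by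
  have h2 : ContDiffAt ℝ 2 f w := (hf.contDiffAt (hU.mem_nhds hw)).of_le (by norm_cast)
  have hs := h2.isSymmSndFDerivAt (by simp)
  have hd : DifferentiableAt ℝ (fderiv ℝ f) w :=
    (h2.fderiv_right (m := 1) (by norm_num)).differentiableAt one_ne_zero
  have key : ∀ c d : ℂ, fderiv ℝ (fun y => fderiv ℝ f y c) w d = fderiv ℝ (fderiv ℝ f) w d c := by
    intro c d
    have h := hd.hasFDerivAt.clm_apply (hasFDerivAt_const c w)
    rw [h.fderiv]
    simp
  rw [key, key]
  exact hs b a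

theorem fderiv_half_smul_add (hU : IsOpen U) (hf : ContDiffOn ℝ ∞ f U) {w : ℂ} (hw : w ∈ U)
    (c e : ℂ) : fderiv ℝ (fun y => (1 / 2 : ℂ) • (fderiv ℝ f y 1 + c • fderiv ℝ f y Complex.I)) w e =
      (1 / 2 : ℂ) • (fderiv ℝ (fun y => fderiv ℝ f y 1) w e
        + c • fderiv ℝ (fun y => fderiv ℝ f y Complex.I) w e) := by
  have h1 := ((contDiffOn_fderiv_apply hU hf 1).contDiffAt (hU.mem_nhds hw)).differentiableAt
    (by simp)
  have h2 := ((contDiffOn_fderiv_apply hU hf Complex.I).contDiffAt (hU.mem_nhds hw)).differentiableAt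
    (by simp)
  have h3 := (h1.hasFDerivAt.add (h2.hasFDerivAt.const_smul c)).const_smul (1 / 2 : ℂ)
  exact congrArg (fun T => T e) h3.fderiv

theorem dbar_dz_eq (hU : IsOpen U) (hf : ContDiffOn ℝ ∞ f U) {w : ℂ} (hw : w ∈ U) :
    dbar (dz f) w = (1 / 4 : ℂ) • (partialRe (partialRe f) w + partialIm (partialIm f) w) := by
  have hdz : dz f = fun y => (1 / 2 : ℂ) • (fderiv ℝ f y 1 + (-Complex.I) • fderiv ℝ f y Complex.I) := by
    ext y; simp [dz, partialRe, partialIm, sub_eq_add_neg]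
  have hc := fderiv_fderiv_comm hU hf hw 1 Complex.I
  rw [hdz]
  simp only [dbar, partialRe, partialIm, fderiv_half_smul_add hU hf hw]
  rw [hc]
  simp only [smul_add, smul_smul]
  have e1 : (1 / 2 : ℂ) * (Complex.I * (1 / 2 * -Complex.I)) = 1 / 4 := by
    linear_combination (-1 / 4 : ℂ) * Complex.I_sq
  rw [e1, show (1 / 2 : ℂ) * (1 / 2) = 1 / 4 by norm_num,
    show (1 / 2 : ℂ) * (1 / 2 * -Complex.I) = -(1 / 2 * (Complex.I * (1 / 2))) by ring]
  simp only [neg_smul]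
  abel

theorem dz_dbar_eq (hU : IsOpen U) (hf : ContDiffOn ℝ ∞ f U) {w : ℂ} (hw : w ∈ U) :
    dz (dbar f) w = (1 / 4 : ℂ) • (partialRe (partialRe f) w + partialIm (partialIm f) w) := by
  have hc := fderiv_fderiv_comm hU hf hw 1 Complex.I
  have hdb : dbar f = fun y => (1 / 2 : ℂ) • (fderiv ℝ f y 1 + Complex.I • fderiv ℝ f y Complex.I) := rfl
  rw [hdb]
  simp only [dz, partialRe, partialIm, fderiv_half_smul_add hU hf hw]
  rw [hc]
  simp only [smul_add, smul_smul, smul_sub]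
  have e1 : (1 / 2 : ℂ) * (Complex.I * (1 / 2 * Complex.I)) = -(1 / 4) := by
    linear_combination (1 / 4 : ℂ) * Complex.I_sq
  rw [e1, show (1 / 2 : ℂ) * (1 / 2) = 1 / 4 by norm_num,
    show (1 / 2 : ℂ) * (1 / 2 * Complex.I) = (1 / 2 * (Complex.I * (1 / 2))) by ring]
  simp only [neg_smul]
  abel

theorem dbar_dz_comm (hU : IsOpen U) (hf : ContDiffOn ℝ ∞ f U) {w : ℂ} (hw : w ∈ U) :
    dbar (dz f) w = dz (dbar f) w := (dbar_dz_eq hU hf hw).trans (dz_dbar_eq hU hf hw).symm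

end Smooth

theorem dz_clm_apply {n : ℕ} {P : ℂ → EndCn n} {w : ℂ} (hP : DifferentiableAt ℝ P w) (v : Cn n) :
    dz (fun y => P y v) w = dz P w v := by
  have h : ∀ e : ℂ, fderiv ℝ (fun y => P y v) w e = fderiv ℝ P w e v := by
    intro e
    let L : EndCn n →L[ℝ] Cn n := (ContinuousLinearMap.apply ℂ (Cn n) v).restrictScalars ℝ
    exact congrArg (fun T => T e) (L.hasFDerivAt.comp w hP.hasFDerivAt).fderiv
  simp only [dz, partialRe, partialIm, h]
  rfl

section Algebra

variable {n : ℕ} {f g : ℂ → EndCn n} {w : ℂ}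

theorem fderiv_mul_apply (hf : DifferentiableAt ℝ f w) (hg : DifferentiableAt ℝ g w) (e : ℂ) :
    fderiv ℝ (fun y => f y * g y) w e = fderiv ℝ f w e * g w + f w * fderiv ℝ g w e := by
  have h := congrArg (fun T => T e) (hf.hasFDerivAt.mul' hg.hasFDerivAt).fderiv
  exact h.trans (add_comm _ _)

theorem dz_mul (hf : DifferentiableAt ℝ f w) (hg : DifferentiableAt ℝ g w) :
    dz (fun y => f y * g y) w = dz f w * g w + f w * dz g w := by
  simp only [dz, partialRe, partialIm, fderiv_mul_apply hf hg]
  simp only [smul_sub, smul_add, sub_mul, mul_sub, smul_mul_assoc, mul_smul_comm]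
  abel

theorem dbar_mul (hf : DifferentiableAt ℝ f w) (hg : DifferentiableAt ℝ g w) :
    dbar (fun y => f y * g y) w = dbar f w * g w + f w * dbar g w := by
  simp only [dbar, partialRe, partialIm, fderiv_mul_apply hf hg]
  simp only [smul_add, add_mul, mul_add, smul_mul_assoc, mul_smul_comm]
  abel

theorem fderiv_star_apply (hf : DifferentiableAt ℝ f w) (e : ℂ) :
    fderiv ℝ (fun y => star (f y)) w e = star (fderiv ℝ f w e) := by
  have h := hf.hasFDerivAt.star
  exact congrArg (fun T => T e) h.fderiv

theorem star_half_smul_add (c : ℂ) (a b : EndCn n) :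
    star ((1 / 2 : ℂ) • (a + c • b)) = (1 / 2 : ℂ) • (star a + star c • star b) := by
  rw [star_smul, star_add a (c • b), star_smul]
  simp

theorem star_dz (hf : DifferentiableAt ℝ f w) :
    star (dz f w) = dbar (fun y => star (f y)) w := by
  simp only [dz, dbar, partialRe, partialIm, fderiv_star_apply hf]
  rw [sub_eq_add_neg, ← neg_smul, star_half_smul_add]
  simp only [star_neg, RCLike.star_def, Complex.conj_I, neg_neg]

theorem star_dbar (hf : DifferentiableAt ℝ f w) :
    star (dbar f w) = dz (fun y => star (f y)) w := by
  simp only [dz, dbar, partialRe, partialIm, fderiv_star_apply hf]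
  rw [sub_eq_add_neg, ← neg_smul, star_half_smul_add]
  simp only [RCLike.star_def, Complex.conj_I]

end Algebra
end Wirtinger

/-! ### Noncommutative identities behind the harmonic equations; in those on Laplacians, `p'`, `pb`,
`l` stand for ∂p, ∂̄p, ∂̄∂. -/

section RingIdentities

variable {R : Type*} [Ring R]

/-- The derivative of an idempotent is off-diagonal: sandwiching p'p + pp' = p' between two copies
of `p` gives x + x = x for x = pp'p. -/
theorem mul_deriv_mul_eq_zero {p p' : R} (hp : p * p = p) (h : p' * p + p * p' = p') :
    p * p' * p = 0 := by
  have e : p * (p' * p + p * p') * p = p * p' * (p * p) + (p * p) * p' * p := by noncomm_ring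
  rw [h, hp] at e
  simpa using e.symm

/-- The product rule for ab = 0 gives a'b = -ab', which moves the derivative from one projection to
the other. -/
theorem mul_deriv_mul_flip {a b a' b' : R} (hd : a' * b + a * b' = 0) (ha : a * a = a)
    (hb : b * b = b) (h : a * b' * b = 0) : a * a' * b = 0 := by
  calc a * a' * b = a * (a' * b + a * b') * b - a * a * b' * b + a * (a' * (b - b * b)) := by
        noncomm_ring
    _ = 0 := by rw [hd, ha, hb, h]; simp

theorem mul_neg_mul_eq_zero {p l r : R} (h : p * l * r = 0) : p * -l * r = 0 := by
  rw [mul_neg, neg_mul, h, neg_zero]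

/-- In a cycle `q → p → r → q` of subbundles, the component of the Laplacian of `r` towards the
vertex that is not the target of its arrow vanishes. -/
theorem mul_laplacian_mul_eq_zero {p q r q' r' qb rb l : R} (hsum : p + q + r = 1)
    (hqq : q * q = q) (hr : r * r = r) 
    (hrr : r * r' * r = 0) (hrrb : r * rb * r = 0) (hqr : q * r' * r = 0)
    (hqp : q * qb * p = 0) (hd : q' * r + q * r' = 0)
    (h2 : qb * (r' * r) + q * (l * r + r' * rb) = 0) :
    q * l * r = 0 := by
  -- Of the three components of r'r, those along `q` and `r` vanish: the only arrow from `r` goes to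
  -- `p`.
  have e1 : r' * r = p * (r' * r) := by
    calc r' * r = (p + q + r) * (r' * r) := by rw [hsum, one_mul]
      _ = p * (r' * r) + q * r' * r + r * r' * r := by noncomm_ring
      _ = _ := by rw [hrr, hqr, add_zero, add_zero]
  have e2 : q * qb * (r' * r) = 0 := by rw [e1, ← mul_assoc, hqp, zero_mul]
  have e3 : q * r' * rb * r = 0 := by
    rw [eq_neg_of_add_eq_zero_right hd,
      show -(q' * r) * rb * r = -(q' * (r * rb * r)) by noncomm_ring, hrrb, mul_zero, neg_zero]
  calc q * l * r = q * (qb * (r' * r) + q * (l * r + r' * rb)) * r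
        - q * qb * (r' * r) * r - q * (r' * rb) * r + (q - q * q) * (l * r * r + r' * rb * r)
        + q * l * (r - r * r)  := by noncomm_ring
    _ = - (q * r' * rb * r) := by rw [h2, e2, hqq, hr]; noncomm_ring
    _ = 0 := by rw [e3, neg_zero]

/-- In a cycle `p → q → r → p` of subbundles, the component of the Laplacian of `r` towards the
target of its arrow vanishes. -/
theorem mul_laplacian_mul_target_eq_zero {p q r p' q' r' pb rb lp lr : R} (hsum : p + q + r = 1)
    (hpp : p * p = p) (hq : q * q = q)
    (hrr : r * r' * r = 0) (hrrb : r * rb * r = 0) (hppb : p * pb * p = 0) (hqr : q * r' * r = 0)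
    (hpr : p * rb * r = 0) (hpq : p * q' * q = 0) (hd : p' * q + p * q' = 0)
    (hlp : p * lp * r = 0)
    (h2 : lp * r + p' * rb + (pb * r' + p * lr) = 0) :
    p * lr * r = 0 := by
  have e1 : r' * r = p * (r' * r) := by
    calc r' * r = (p + q + r) * (r' * r) := by rw [hsum, one_mul]
      _ = p * (r' * r) + q * r' * r + r * r' * r := by noncomm_ring
      _ = _ := by rw [hrr, hqr, add_zero, add_zero]
  have e2 : rb * r = q * (rb * r) := by
    calc rb * r = (p + q + r) * (rb * r) := by rw [hsum, one_mul]
      _ = q * (rb * r) + p * rb * r + r * rb * r := by noncomm_ring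
      _ = _ := by rw [hrrb, hpr, add_zero, add_zero]
  have e3 : p * pb * (r' * r) = 0 := by rw [e1, ← mul_assoc, hppb, zero_mul]
  have e4 : p * p' * (rb * r) = 0 := by
    rw [e2, ← hq, show p * p' * (q * q * (rb * r)) = p * (p' * q) * q * (rb * r) by noncomm_ring,
      eq_neg_of_add_eq_zero_left hd,
      show p * -(p * q') * q * (rb * r) = -(p * (p * q' * q) * (rb * r)) by noncomm_ring, hpq]
    simp
  calc p * lr * r = p * (lp * r + p' * rb + (pb * r' + p * lr)) * r
        - p * lp * r * r - p * p' * (rb * r) - p * pb * (r' * r) + (p - p * p) * (lr * r) := by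
          noncomm_ring
    _ = 0 := by rw [h2, e3, e4, hlp, hpp]; simp

/-- The Gauss bundle `p` of a harmonic `q`, with `r` the remaining summand: the component of the
Laplacian of `p` along `r` vanishes. -/
theorem gauss_laplacian_rest {p q r p' q' r' pb rb l : R} (hsum : p + q + r = 1)
    (hq : q * q = q) (hp : p * p = p) (hr : r * r = r) (hppb : p * pb * p = 0) (hrpb : r * pb * p = 0)
    (hd : r' * q + r * q' = 0) (hdb : rb * p + r * pb = 0) (hpp : p * p' * p = 0)
    (hrq : r * q' * q = 0)
    (h2 : r' * (pb * p) + r * (l * p + pb * p') = 0) : r * l * p = 0 := by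
  have e1 : pb * p = q * (pb * p) := by
    calc pb * p = (p + q + r) * (pb * p) := by rw [hsum, one_mul]
      _ = q * (pb * p) + p * pb * p + r * pb * p := by noncomm_ring
      _ = _ := by rw [hppb, hrpb, add_zero, add_zero]
  have e2 : r * r' * (pb * p) = 0 := by
    rw [e1, ← hq, show r * r' * (q * q * (pb * p)) = r * (r' * q) * q * (pb * p) by noncomm_ring,
      eq_neg_of_add_eq_zero_left hd,
      show r * -(r * q') * q * (pb * p) = -(r * (r * q' * q) * (pb * p)) by noncomm_ring, hrq]
    simp
  have e3 : r * pb * p' * p = 0 := by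
    rw [eq_neg_of_add_eq_zero_right hdb,
      show -(rb * p) * p' * p = -(rb * (p * p' * p)) by noncomm_ring, hpp]
    simp
  calc r * l * p = r * (r' * (pb * p) + r * (l * p + pb * p')) * p
        - r * r' * (pb * p) * p - r * pb * p' * p + (r - r * r) * (l * p * p + pb * p' * p)
        + r * l * (p - p * p) := by noncomm_ring
    _ = 0 := by rw [h2, e2, e3, hr, hp]; simp

/-- The Gauss bundle `p` of a harmonic `q`, with `r` the remaining summand: the component of the
Laplacian of `p` along `q` vanishes. -/
theorem gauss_laplacian_base {p q r p' q' pb qb lp lq : R} (hsum : p + q + r = 1)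
    (hq : q * q = q) (hqq : q * q' * q = 0) (hqqb : q * qb * q = 0) (hppb : p * pb * p = 0)
    (hrpb : r * pb * p = 0) (hpp : p * p' * p = 0) (hqr : q * qb * r = 0) (hlq : q * lq * p = 0)
    (h2 : lq * p + q' * pb + (qb * p' + q * lp) = 0) : q * lp * p = 0 := by
  have e1 : pb * p = q * (pb * p) := by
    calc pb * p = (p + q + r) * (pb * p) := by rw [hsum, one_mul]
      _ = q * (pb * p) + p * pb * p + r * pb * p := by noncomm_ring
      _ = _ := by rw [hppb, hrpb, add_zero, add_zero]
  have e2 : p' * p = q * (p' * p) + r * (p' * p) := by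
    calc p' * p = (p + q + r) * (p' * p) := by rw [hsum, one_mul]
      _ = q * (p' * p) + r * (p' * p) + p * p' * p := by noncomm_ring
      _ = _ := by rw [hpp, add_zero]
  have e3 : q * q' * (pb * p) = 0 := by rw [e1, ← mul_assoc, hqq, zero_mul]
  have e4 : q * qb * (p' * p) = 0 := by
    rw [e2, mul_add, ← mul_assoc (q * qb), ← mul_assoc (q * qb), hqqb, hqr, zero_mul, add_zero]
  calc q * lp * p = q * (lq * p + q' * pb + (qb * p' + q * lp)) * p
        - q * lq * p * p - q * q' * (pb * p) - q * qb * (p' * p) + (q - q * q) * (lp * p) := by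
          noncomm_ring
    _ = 0 := by rw [h2, e3, e4, hlq, hq]; simp

/-- The `∂`-bar equation of the second fundamental form `q' q` of a harmonic `q`. -/
theorem laplacian_mul_add_eq {q q' qb l : R} (hd : q' * q + q * q' = q')
    (hl : (1 - q) * l * q = 0)
    (h2 : qb * (q' * q) + q * (l * q + q' * qb) = 0) :
    l * q + q' * qb = q' * q * qb - qb * (q' * q) := by
  have e1 : l * q = q * l * q := by
    have : l * q - q * l * q = (1 - q) * l * q := by noncomm_ring
    rwa [hl, sub_eq_zero] at this
  have e3 : q' * qb = q' * q * qb + q * q' * qb := by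
    rw [← add_mul, hd]
  calc l * q + q' * qb = q * l * q + (q' * q * qb + q * q' * qb) := by rw [e1, ← e3]
    _ = (qb * (q' * q) + q * (l * q + q' * qb)) + q' * q * qb - qb * (q' * q) := by noncomm_ring
    _ = _ := by rw [h2, zero_add]

end RingIdentities

/-! ### Projection-valued functions and the harmonic map equation. -/

section SmoothProjections

variable {n : ℕ}

/-- Smooth functions on `U` with values in the orthogonal projections. -/
structure IsSmoothProjection (P : ℂ → EndCn n) (U : Set ℂ) : Prop where
  smooth : ContDiffOn ℝ ∞ P U
  proj : ∀ w ∈ U, IsStarProjection (P w)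

/-- The harmonic map equation for a function with values in the orthogonal projections. -/
def HarmonicEquation (P : ℂ → EndCn n) (U : Set ℂ) : Prop :=
  ∀ w ∈ U, (1 - P w) * dbar (dz P) w * P w = 0

theorem star_endCn_zero : star (0 : EndCn n) = 0 := star_zero (EndCn n)

variable {P Q R : ℂ → EndCn n} {U : Set ℂ} {w : ℂ}

namespace IsSmoothProjection

theorem one_sub (hP : IsSmoothProjection P U) : IsSmoothProjection (fun w => 1 - P w) U :=
  ⟨contDiffOn_const.sub hP.smooth, fun w hw => (hP.proj w hw).one_sub⟩

variable (hP : IsSmoothProjection P U) (hQ : IsSmoothProjection Q U) (hU : IsOpen U) (hw : w ∈ U)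
include hP hU hw

theorem differentiableAt : DifferentiableAt ℝ P w := ContDiffOn.differentiableAt_of_isOpen hU hP.smooth hw

theorem differentiableAt_dz : DifferentiableAt ℝ (dz P) w :=
  ContDiffOn.differentiableAt_of_isOpen hU (contDiffOn_dz hU hP.smooth) hw

theorem differentiableAt_dbar : DifferentiableAt ℝ (dbar P) w :=
  ContDiffOn.differentiableAt_of_isOpen hU (contDiffOn_dbar hU hP.smooth) hw

omit hU in
theorem mul_self : P w * P w = P w := (hP.proj w hw).isIdempotentElem

omit hU in
theorem star_eq : star (P w) = P w := (hP.proj w hw).isSelfAdjoint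

theorem star_dz : star (dz P w) = dbar P w := by
  rw [HarmonicGrassmann.star_dz (hP.differentiableAt hU hw)]
  exact dbar_congr (eventually_of_mem (hU.mem_nhds hw) fun y hy => hP.star_eq hy)

theorem star_dbar : star (dbar P w) = dz P w := by
  rw [← hP.star_dz hU hw, star_star]

theorem star_laplacian : star (dbar (dz P) w) = dbar (dz P) w := by
  rw [HarmonicGrassmann.star_dbar (hP.differentiableAt_dz hU hw),
    dz_congr (eventually_of_mem (hU.mem_nhds hw) fun y hy => hP.star_dz hU hy),
    dbar_dz_comm hU hP.smooth hw]

theorem dz_mul_self : dz P w * P w + P w * dz P w = dz P w := by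
  rw [← dz_mul (hP.differentiableAt hU hw) (hP.differentiableAt hU hw)]
  exact dz_congr (eventually_of_mem (hU.mem_nhds hw) fun y hy => hP.mul_self hy)

theorem dbar_mul_self : dbar P w * P w + P w * dbar P w = dbar P w := by
  rw [← dbar_mul (hP.differentiableAt hU hw) (hP.differentiableAt hU hw)]
  exact dbar_congr (eventually_of_mem (hU.mem_nhds hw) fun y hy => hP.mul_self hy)

theorem mul_dz_mul : P w * dz P w * P w = 0 :=
  mul_deriv_mul_eq_zero (hP.mul_self hw) (hP.dz_mul_self hU hw)

theorem mul_dbar_mul : P w * dbar P w * P w = 0 :=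
  mul_deriv_mul_eq_zero (hP.mul_self hw) (hP.dbar_mul_self hU hw)

include hQ
variable (h : ∀ w ∈ U, P w * Q w = 0)
include h

theorem dz_mul_add : dz P w * Q w + P w * dz Q w = 0 := by
  rw [← dz_mul (hP.differentiableAt hU hw) (hQ.differentiableAt hU hw)]
  exact dz_eq_zero_of_eqOn hU h hw

theorem dbar_mul_add : dbar P w * Q w + P w * dbar Q w = 0 := by
  rw [← dbar_mul (hP.differentiableAt hU hw) (hQ.differentiableAt hU hw)]
  exact dbar_eq_zero_of_eqOn hU h hw

theorem laplacian_mul_add : dbar (dz P) w * Q w + dz P w * dbar Q w +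
    (dbar P w * dz Q w + P w * dbar (dz Q) w) = 0 := by
  have h1 := dbar_eq_zero_of_eqOn hU (fun y hy => hP.dz_mul_add hQ hU hy h) hw
  rwa [dbar_add ((hP.differentiableAt_dz hU hw).fun_mul (hQ.differentiableAt hU hw))
    ((hP.differentiableAt hU hw).fun_mul (hQ.differentiableAt_dz hU hw)),
    dbar_mul (hP.differentiableAt_dz hU hw) (hQ.differentiableAt hU hw),
    dbar_mul (hP.differentiableAt hU hw) (hQ.differentiableAt_dz hU hw)] at h1

omit hU hQ in
theorem mul_eq_zero_symm (hQ : IsSmoothProjection Q U) : Q w * P w = 0 := by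
  have := congrArg star (h w hw)
  rw [star_mul, hP.star_eq hw, hQ.star_eq hw] at this
  exact this.trans star_endCn_zero

omit h in
/-- `A'_P` has no component along `Q` if and only if `A''_Q` has no component along `P`. -/
theorem mul_dbar_mul_of_mul_dz_mul (hPQ : P w * dz P w * Q w = 0) : Q w * dbar P w * P w = 0 := by
  have := congrArg star hPQ
  rw [star_mul, star_mul, hP.star_eq hw, hQ.star_eq hw, hP.star_dz hU hw, ← mul_assoc] at this
  exact this.trans star_endCn_zero

end IsSmoothProjection

/-- The derivative of the condition `P (∂Q) Q = 0`. -/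
theorem dbar_mul_dz_mul (hP : IsSmoothProjection P U) (hQ : IsSmoothProjection Q U) (hU : IsOpen U)
    (h : ∀ w ∈ U, P w * dz Q w * Q w = 0) (hw : w ∈ U) :
    dbar P w * (dz Q w * Q w) + P w * (dbar (dz Q) w * Q w + dz Q w * dbar Q w) = 0 := by
  have h1 := dbar_eq_zero_of_eqOn hU (f := fun y => P y * (dz Q y * Q y))
    (fun y hy => by rw [← mul_assoc]; exact h y hy) hw
  rwa [dbar_mul (hP.differentiableAt hU hw)
    ((hQ.differentiableAt_dz hU hw).fun_mul (hQ.differentiableAt hU hw)),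
    dbar_mul (hQ.differentiableAt_dz hU hw) (hQ.differentiableAt hU hw)] at h1

/-- The derivative of the condition `P (∂bar Q) Q = 0`. -/
theorem dz_mul_dbar_mul (hP : IsSmoothProjection P U) (hQ : IsSmoothProjection Q U) (hU : IsOpen U)
    (h : ∀ w ∈ U, P w * dbar Q w * Q w = 0) (hw : w ∈ U) :
    dz P w * (dbar Q w * Q w) + P w * (dbar (dz Q) w * Q w + dbar Q w * dz Q w) = 0 := by
  have h1 := dz_eq_zero_of_eqOn hU (f := fun y => P y * (dbar Q y * Q y))
    (fun y hy => by rw [← mul_assoc]; exact h y hy) hw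
  rwa [dz_mul (hP.differentiableAt hU hw)
    ((hQ.differentiableAt_dbar hU hw).fun_mul (hQ.differentiableAt hU hw)),
    dz_mul (hQ.differentiableAt_dbar hU hw) (hQ.differentiableAt hU hw),
    ← dbar_dz_comm hU hQ.smooth hw] at h1

/-- The harmonic map equation in terms of the components of the Laplacian. -/
theorem HarmonicEquation.mul_laplacian_mul (hP : IsSmoothProjection P U) (hU : IsOpen U)
    (hh : HarmonicEquation P U) (hw : w ∈ U) : P w * dbar (dz P) w * (1 - P w) = 0 := by
  have := congrArg star (hh w hw)
  rw [star_mul, star_mul, hP.star_eq hw, hP.one_sub.star_eq hw, hP.star_laplacian hU hw,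
    ← mul_assoc] at this
  exact this.trans star_endCn_zero

theorem laplacian_one_sub (P : ℂ → EndCn n) (w : ℂ) :
    dbar (dz fun y => 1 - P y) w = - dbar (dz P) w := by
  rw [show dz (fun y => 1 - P y) = fun y => - dz P y from funext (dz_const_sub 1 P), dbar_neg]

theorem HarmonicEquation.one_sub (hP : IsSmoothProjection P U) (hU : IsOpen U)
    (hh : HarmonicEquation P U) : HarmonicEquation (fun y => 1 - P y) U := by
  intro w hw
  rw [laplacian_one_sub, sub_sub_cancel]
  exact mul_neg_mul_eq_zero (hh.mul_laplacian_mul hP hU hw)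

/-- In a cycle `P → Q → R → P` of subbundles, `R` is harmonic. -/
theorem HarmonicEquation.of_cycle (hP : IsSmoothProjection P U) (hQ : IsSmoothProjection Q U)
    (hR : IsSmoothProjection R U) (hU : IsOpen U) (hsum : ∀ w ∈ U, P w + Q w + R w = 1)
    (hPQ : ∀ w ∈ U, P w * Q w = 0) (hPR : ∀ w ∈ U, P w * R w = 0) (hQR : ∀ w ∈ U, Q w * R w = 0)
    (h1 : ∀ w ∈ U, R w * dz P w * P w = 0) (h2 : ∀ w ∈ U, P w * dz Q w * Q w = 0)
    (h3 : ∀ w ∈ U, Q w * dz R w * R w = 0) : HarmonicEquation R U := by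
  intro w hw
  have hs := hsum w hw
  have hQP : ∀ w ∈ U, Q w * P w = 0 := fun w hw => hP.mul_eq_zero_symm hw hPQ hQ
  have hRP : ∀ w ∈ U, R w * P w = 0 := fun w hw => hP.mul_eq_zero_symm hw hPR hR
  have hRQ : ∀ w ∈ U, R w * Q w = 0 := fun w hw => hQ.mul_eq_zero_symm hw hQR hR
  -- moving the derivative to the other factor
  have flip : ∀ {A B : ℂ → EndCn n}, IsSmoothProjection A U → IsSmoothProjection B U →
      (∀ w ∈ U, A w * B w = 0) → A w * dz B w * B w = 0 → A w * dz A w * B w = 0 := by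
    intro A B hA hB hAB h
    exact mul_deriv_mul_flip (hA.dz_mul_add hB hU hw hAB) (hA.mul_self hw) (hB.mul_self hw) h
  have hqp : Q w * dbar Q w * P w = 0 :=
    mul_deriv_mul_flip (hQ.dbar_mul_add hP hU hw hQP) (hQ.mul_self hw) (hP.mul_self hw)
      (hP.mul_dbar_mul_of_mul_dz_mul hQ hU hw (flip hP hQ hPQ (h2 w hw)))
  have hrq : R w * dbar R w * Q w = 0 :=
    mul_deriv_mul_flip (hR.dbar_mul_add hQ hU hw hRQ) (hR.mul_self hw) (hQ.mul_self hw)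
      (hQ.mul_dbar_mul_of_mul_dz_mul hR hU hw (flip hQ hR hQR (h3 w hw)))
  have hpr : P w * dbar R w * R w = 0 :=
    hR.mul_dbar_mul_of_mul_dz_mul hP hU hw (flip hR hP hRP (h1 w hw))
  have c1 : Q w * dbar (dz R) w * R w = 0 :=
    mul_laplacian_mul_eq_zero (p := P w) hs (hQ.mul_self hw) (hR.mul_self hw) (hR.mul_dz_mul hU hw)
      (hR.mul_dbar_mul hU hw) (h3 w hw) hqp (hQ.dz_mul_add hR hU hw hQR)
      (dbar_mul_dz_mul hQ hR hU h3 hw)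
  -- The previous argument with the cycle rotated, so that `P` plays the role of `R`. Its adjoint
  -- `c3` is the component needed for `c4`, where applying ∂̄∂ to PR = 0 transfers it from the
  -- Laplacian of `P` to that of `R`.
  have c2 : R w * dbar (dz P) w * P w = 0 :=
    mul_laplacian_mul_eq_zero (p := Q w) (by rw [← hs]; abel) (hR.mul_self hw) (hP.mul_self hw)
      (hP.mul_dz_mul hU hw) (hP.mul_dbar_mul hU hw) (h1 w hw) hrq (hR.dz_mul_add hP hU hw hRP)
      (dbar_mul_dz_mul hR hP hU h1 hw)
  have c3 : P w * dbar (dz P) w * R w = 0 := by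
    have := congrArg star c2
    rw [star_mul, star_mul, hP.star_eq hw, hR.star_eq hw, hP.star_laplacian hU hw,
      ← mul_assoc] at this
    exact this.trans star_endCn_zero
  have c4 : P w * dbar (dz R) w * R w = 0 :=
    mul_laplacian_mul_target_eq_zero hs (hP.mul_self hw) (hQ.mul_self hw) (hR.mul_dz_mul hU hw)
      (hR.mul_dbar_mul hU hw) (hP.mul_dbar_mul hU hw) (h3 w hw) hpr (h2 w hw)
      (hP.dz_mul_add hQ hU hw hPQ) c3 (hP.laplacian_mul_add hR hU hw hPR)
  rw [show 1 - R w = P w + Q w by rw [← hs]; abel, add_mul, add_mul, c1, c4, add_zero]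

/-- A holomorphic subbundle `P` of `Qᗮ` that contains the image of the second fundamental form of a
harmonic `Q` is harmonic, provided that it is antiholomorphically attached to `Q` only. -/
theorem HarmonicEquation.gauss (hP : IsSmoothProjection P U) (hQ : IsSmoothProjection Q U)
    (hR : IsSmoothProjection R U) (hU : IsOpen U) (hsum : ∀ w ∈ U, P w + Q w + R w = 1)
    (hPQ : ∀ w ∈ U, P w * Q w = 0) (hPR : ∀ w ∈ U, P w * R w = 0) (hQR : ∀ w ∈ U, Q w * R w = 0)
    (h1 : ∀ w ∈ U, R w * dz Q w * Q w = 0) (h2 : ∀ w ∈ U, R w * dbar P w * P w = 0)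
    (hh : HarmonicEquation Q U) : HarmonicEquation P U := by
  intro w hw
  have hs := hsum w hw
  have hQP : ∀ w ∈ U, Q w * P w = 0 := fun w hw => hP.mul_eq_zero_symm hw hPQ hQ
  have hRP : ∀ w ∈ U, R w * P w = 0 := fun w hw => hP.mul_eq_zero_symm hw hPR hR
  have hRQ : ∀ w ∈ U, R w * Q w = 0 := fun w hw => hQ.mul_eq_zero_symm hw hQR hR
  have c1 : R w * dbar (dz P) w * P w = 0 :=
    gauss_laplacian_rest hs (hQ.mul_self hw) (hP.mul_self hw) (hR.mul_self hw)
      (hP.mul_dbar_mul hU hw) (h2 w hw) (hR.dz_mul_add hQ hU hw hRQ)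
      (hR.dbar_mul_add hP hU hw hRP) (hP.mul_dz_mul hU hw) (h1 w hw) (dz_mul_dbar_mul hR hP hU h2 hw)
  have hqr : Q w * dbar Q w * R w = 0 := by
    have := congrArg star (h1 w hw)
    rw [star_mul, star_mul, hQ.star_eq hw, hR.star_eq hw, hQ.star_dz hU hw, ← mul_assoc] at this
    exact this.trans star_endCn_zero
  -- Harmonicity of `Q` enters only here; `P` maps into the complement of `Q`.
  have hlq : Q w * dbar (dz Q) w * P w = 0 := by
    have e : P w = (1 - Q w) * P w := by rw [sub_mul, one_mul, hQP w hw, sub_zero]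
    rw [e, ← mul_assoc, hh.mul_laplacian_mul hQ hU hw, zero_mul]
  have c2 : Q w * dbar (dz P) w * P w = 0 :=
    gauss_laplacian_base hs (hQ.mul_self hw) (hQ.mul_dz_mul hU hw) (hQ.mul_dbar_mul hU hw)
      (hP.mul_dbar_mul hU hw) (h2 w hw) (hP.mul_dz_mul hU hw) hqr hlq
      (hQ.laplacian_mul_add hP hU hw hQP)
  rw [show 1 - P w = R w + Q w by rw [← hs]; abel, add_mul, add_mul, c1, c2, add_zero]

/-- The second fundamental form of a harmonic `P` is holomorphic, up to a change of gauge. -/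
theorem HarmonicEquation.dbar_secondFF (hP : IsSmoothProjection P U) (hU : IsOpen U)
    (hh : HarmonicEquation P U) (hw : w ∈ U) :
    dbar (fun y => dz P y * P y) w = dz P w * P w * dbar P w - dbar P w * (dz P w * P w) := by
  rw [dbar_mul (hP.differentiableAt_dz hU hw) (hP.differentiableAt hU hw)]
  exact laplacian_mul_add_eq (hP.dz_mul_self hU hw) (hh w hw)
    (dbar_mul_dz_mul hP hP hU (fun y hy => hP.mul_dz_mul hU hy) hw)

end SmoothProjections

/-! ### Filling out zeros for holomorphic families of endomorphisms. -/

section FillingOutZeros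

variable {n : ℕ}

/-- Adding the span of `v` to the range of an idempotent `e` that kills `v`. -/
theorem exists_idempotent_range_sup {e : EndCn n} (he : e * e = e) {v a : Cn n} (hev : e v = 0)
    (hav : inner ℂ a v ≠ 0) (e' : EndCn n)
    (he' : e' = e + (inner ℂ a v)⁻¹ • (InnerProductSpace.rankOne ℂ v a * (1 - e))) :
    e' * e' = e' ∧ e'.range = e.range ⊔ Submodule.span ℂ {v} := by
  have happ : ∀ x, e' x = e x + ((inner ℂ a v)⁻¹ * inner ℂ a (x - e x)) • v := by
    intro x
    rw [he']
    simp [mul_smul, InnerProductSpace.rankOne_apply, inner_sub_right]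
  have hee : ∀ x, e (e x) = e x := fun x => congrArg (fun T : EndCn n => T x) he
  have h1 : ∀ x, e' (e x) = e x := by intro x; rw [happ, hee]; simp
  have h2 : e' v = v := by rw [happ, hev]; simp [hav]
  constructor
  · ext1 x
    change e' (e' x) = e' x
    conv_lhs => rw [happ x]
    rw [map_add, map_smul, h1, h2, ← happ]
  · apply le_antisymm
    · rintro _ ⟨x, rfl⟩
      change e' x ∈ _
      rw [happ]
      exact Submodule.add_mem_sup ⟨x, rfl⟩ (Submodule.smul_mem _ _ (Submodule.mem_span_singleton_self v))
    · refine sup_le ?_ ?_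
      · rintro _ ⟨x, rfl⟩
        exact ⟨e x, h1 x⟩
      · rw [Submodule.span_singleton_le_iff_mem]
        exact ⟨v, h2⟩

/-- Subtract from `h` its part in the range of `E` and divide by the power of w - w₀ to which the
remainder vanishes. What is left is nonzero at `w₀` and spans the same line nearby, so a rank-one
correction of `E` stays analytic there. The idempotents are oblique, because orthogonal projections
do not vary holomorphically. -/
theorem exists_analytic_idempotent_insert {E : ℂ → EndCn n} {h : ℂ → Cn n} {w₀ : ℂ}
    (hE : AnalyticAt ℂ E w₀) (hEE : ∀ᶠ w in 𝓝 w₀, E w * E w = E w) (hh : AnalyticAt ℂ h w₀) :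
    ∃ E' : ℂ → EndCn n, AnalyticAt ℂ E' w₀ ∧ (∀ᶠ w in 𝓝 w₀, E' w * E' w = E' w) ∧
      ∀ᶠ w in 𝓝[≠] w₀, (E' w).range = (E w).range ⊔ Submodule.span ℂ {h w} := by
  have hEh : AnalyticAt ℂ (fun w => E w (h w)) w₀ := by
    have := (ContinuousLinearMap.id ℂ (EndCn n)).analyticAt_bilinear (E w₀, h w₀)
    exact this.comp₂ hE hh
  set u : ℂ → Cn n := fun w => h w - E w (h w) with hu
  have hua : AnalyticAt ℂ u w₀ := hh.sub hEh
  have hspan : ∀ w, (E w).range ⊔ Submodule.span ℂ {h w} = (E w).range ⊔ Submodule.span ℂ {u w} := by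
    intro w
    apply le_antisymm
    · refine sup_le le_sup_left ((Submodule.span_singleton_le_iff_mem _ _).2 ?_)
      have : h w = E w (h w) + u w := by simp [hu]
      rw [this]
      exact Submodule.add_mem_sup ⟨_, rfl⟩ (Submodule.mem_span_singleton_self _)
    · refine sup_le le_sup_left ((Submodule.span_singleton_le_iff_mem _ _).2 ?_)
      exact Submodule.sub_mem _ (Submodule.mem_sup_right (Submodule.mem_span_singleton_self _))
        (Submodule.mem_sup_left ⟨_, rfl⟩)
  by_cases h0 : ∀ᶠ w in 𝓝 w₀, u w = 0
  · refine ⟨E, hE, hEE, (h0.filter_mono nhdsWithin_le_nhds).mono fun w hw => ?_⟩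
    rw [hspan, hw]; simp
  obtain ⟨k, v, hva, hv0, huv⟩ := hua.exists_eventuallyEq_pow_smul_nonzero_iff.2 h0
  have hne : ∀ᶠ w in 𝓝[≠] w₀, w - w₀ ≠ 0 := by
    filter_upwards [self_mem_nhdsWithin] with w hw
    exact sub_ne_zero.2 hw
  have hEv : AnalyticAt ℂ (fun w => E w (v w)) w₀ := by
    have := (ContinuousLinearMap.id ℂ (EndCn n)).analyticAt_bilinear (E w₀, v w₀)
    exact this.comp₂ hE hva
  -- Away from `w₀` the power of w - w₀ can be cancelled in E u = 0; at `w₀` the equation follows by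
  -- continuity.
  have hEv0 : ∀ᶠ w in 𝓝 w₀, E w (v w) = 0 := by
    refine (ContinuousAt.eventuallyEq_nhds_iff_eventuallyEq_nhdsNE (g := fun _ => (0 : Cn n))
      hEv.continuousAt continuousAt_const).1 ?_
    filter_upwards [hEE.filter_mono nhdsWithin_le_nhds, huv.filter_mono nhdsWithin_le_nhds, hne]
      with w h1 h2 h3
    have h4 : E w (u w) = 0 := by
      rw [hu]
      have : E w (E w (h w)) = E w (h w) := congrArg (fun T : EndCn n => T (h w)) h1
      simp [this]
    rw [h2, map_smul] at h4
    exact (smul_eq_zero.1 h4).resolve_left (pow_ne_zero _ h3)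
  -- Pairing with a constant vector keeps the functional holomorphic in w; it is nonzero on v w for
  -- w near `w₀`.
  set a := v w₀
  have hia : AnalyticAt ℂ (fun w => inner ℂ a (v w)) w₀ := (innerSL ℂ a).analyticAt _ |>.comp hva
  have hi0 : ∀ᶠ w in 𝓝 w₀, inner ℂ a (v w) ≠ 0 :=
    hia.continuousAt.eventually_ne (inner_self_ne_zero.2 hv0)
  let S : Cn n →L[ℂ] EndCn n := (InnerProductSpace.rankOne ℂ (E := Cn n) (F := Cn n)).flip a
  refine ⟨fun w => E w + (inner ℂ a (v w))⁻¹ • (InnerProductSpace.rankOne ℂ (v w) a * (1 - E w)),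
    ?_, ?_, ?_⟩
  · refine hE.add ((hia.inv (inner_self_ne_zero.2 hv0)).smul ?_)
    exact ((S.analyticAt _).comp hva).mul (analyticAt_const.sub hE)
  · filter_upwards [hEE, hEv0, hi0] with w h1 h2 h3
    exact (exists_idempotent_range_sup h1 h2 h3 _ rfl).1
  · filter_upwards [hEE.filter_mono nhdsWithin_le_nhds, hEv0.filter_mono nhdsWithin_le_nhds,
      hi0.filter_mono nhdsWithin_le_nhds, huv.filter_mono nhdsWithin_le_nhds, hne]
      with w h1 h2 h3 h4 h5
    rw [(exists_idempotent_range_sup h1 h2 h3 _ rfl).2, hspan, h4,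
      Submodule.span_singleton_smul_eq (isUnit_iff_ne_zero.2 (pow_ne_zero _ h5))]

/-- The image of a holomorphic family of endomorphisms extends holomorphically across the points
where the rank drops. -/
theorem exists_analytic_idempotent {H : ℂ → EndCn n} {w₀ : ℂ} (hH : AnalyticAt ℂ H w₀) :
    ∃ E : ℂ → EndCn n, AnalyticAt ℂ E w₀ ∧ (∀ᶠ w in 𝓝 w₀, E w * E w = E w) ∧
      ∀ᶠ w in 𝓝[≠] w₀, (E w).range = (H w).range := by
  let b := (EuclideanSpace.basisFun (Fin n) ℂ).toBasis
  -- The range of `H` is spanned by the images of a basis, which are adjoined one at a time.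
  have key : ∀ s : Finset (Fin n), ∃ E : ℂ → EndCn n, AnalyticAt ℂ E w₀ ∧
      (∀ᶠ w in 𝓝 w₀, E w * E w = E w) ∧
      ∀ᶠ w in 𝓝[≠] w₀, (E w).range = Submodule.span ℂ ((fun i => H w (b i)) '' s) := by
    intro s
    induction s using Finset.induction_on with
    | empty =>
      refine ⟨fun _ => 0, analyticAt_const, by simp, Eventually.of_forall fun w => ?_⟩
      simp
    | insert i s hi ih =>
      obtain ⟨E, hE, hEE, hr⟩ := ih
      have hb : AnalyticAt ℂ (fun w => H w (b i)) w₀ :=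
        ((ContinuousLinearMap.apply ℂ (Cn n) (b i)).analyticAt _).comp hH
      obtain ⟨E', hE', hEE', hr'⟩ := exists_analytic_idempotent_insert hE hEE hb
      refine ⟨E', hE', hEE', ?_⟩
      filter_upwards [hr, hr'] with w h1 h2
      rw [h2, h1, Finset.coe_insert, image_insert_eq, Submodule.span_insert, sup_comm]
  obtain ⟨E, hE, hEE, hr⟩ := key Finset.univ
  refine ⟨E, hE, hEE, hr.mono fun w hw => ?_⟩
  rw [hw, Finset.coe_univ, image_univ, range_comp' (H w) b]
  rw [← ContinuousLinearMap.coe_coe, Submodule.span_image, b.span_eq, LinearMap.range_eq_map]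

end FillingOutZeros

/-! ### From oblique idempotents to orthogonal projections. -/

section ProjectionOntoRange

variable {n : ℕ}

/-- If ev + e*v = v, applying e gives ee*v = 0, hence e*v = 0. Then v = ev, and ⟨v, v⟩ = ⟨v, ev⟩ =
⟨e*v, v⟩ = 0. Injectivity suffices in finite dimension. -/
theorem isUnit_add_star_sub_one {e : EndCn n} (he : e * e = e) : IsUnit (e + star e - 1) := by
  have hinj : Function.Injective (e + star e - 1 : EndCn n) := by
    rw [injective_iff_map_eq_zero]
    intro v hv
    have h1 : e v + star e v = v := by simpa [sub_eq_zero] using hv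
    have hee : e (e v) = e v := congrArg (fun T : EndCn n => T v) he
    have h2 : e (star e v) = 0 := by
      have := congrArg e h1
      rw [map_add, hee] at this
      simpa using this
    have h3 : star e v = 0 := by
      rw [← inner_self_eq_zero (𝕜 := ℂ)]
      conv_lhs => rw [ContinuousLinearMap.star_eq_adjoint, ContinuousLinearMap.adjoint_inner_left,
        ← ContinuousLinearMap.star_eq_adjoint, h2, inner_zero_right]
    rw [h3, add_zero] at h1
    rw [← inner_self_eq_zero (𝕜 := ℂ)]
    conv_lhs => rw [← h1, ← ContinuousLinearMap.adjoint_inner_right,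
        ← ContinuousLinearMap.star_eq_adjoint, h1, h3, inner_zero_right]
  rw [ContinuousLinearMap.isUnit_iff_bijective]
  exact ⟨hinj, (LinearMap.injective_iff_surjective (f := ((e + star e - 1 : EndCn n) : Cn n →ₗ[ℂ] Cn n))).1 hinj⟩

/-- The orthogonal projection onto the range of an idempotent. -/
theorem starProjection_range_eq {e : EndCn n} (he : e * e = e) :
    e.range.starProjection = e * Ring.inverse (e + star e - 1) := by
  set p : EndCn n := e.range.starProjection with hp
  have hpe : p * e = e := by
    ext1 x
    exact Submodule.starProjection_eq_self_iff.2 ⟨x, rfl⟩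
  have hep : e * p = p := by
    ext1 x
    obtain ⟨y, hy⟩ : p x ∈ e.range := Submodule.starProjection_apply_mem _ x
    change e (p x) = p x
    rw [← hy]
    exact congrArg (fun T : EndCn n => T y) he
  have hps : star p = p := isStarProjection_starProjection.isSelfAdjoint
  have hpse : p * star e = p := by
    have := congrArg star hep
    rwa [star_mul, hps] at this
  have h : p * (e + star e - 1) = e := by rw [mul_sub, mul_add, hpe, hpse, mul_one, add_sub_cancel_right]
  have h2 := congrArg (fun T => T * Ring.inverse (e + star e - 1)) h
  rwa [mul_assoc, Ring.mul_inverse_cancel _ (isUnit_add_star_sub_one he), mul_one] at h2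

theorem contDiffAt_inverse_comp {f : ℂ → EndCn n} {w : ℂ} (hf : ContDiffAt ℝ ∞ f w)
    (hu : IsUnit (f w)) : ContDiffAt ℝ ∞ (fun y => Ring.inverse (f y)) w := by
  obtain ⟨u, hu⟩ := hu
  have h : ContDiffAt ℝ ∞ Ring.inverse (f w) := by
    rw [← hu]
    exact contDiffAt_ringInverse ℝ u
  exact h.comp w hf

theorem contDiffAt_star_comp {f : ℂ → EndCn n} {w : ℂ} (hf : ContDiffAt ℝ ∞ f w) :
    ContDiffAt ℝ ∞ (fun y => star (f y)) w :=
  (starL' ℝ : EndCn n ≃L[ℝ] EndCn n).contDiff.contDiffAt.comp w hf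

/-- The extension across rank drops produces oblique idempotents, whereas smoothness of a subbundle
is measured by its orthogonal projection. -/
theorem contDiffAt_starProjection_range {f : ℂ → EndCn n} {w : ℂ} (hf : ContDiffAt ℝ ∞ f w)
    (hff : ∀ᶠ y in 𝓝 w, f y * f y = f y) :
    ContDiffAt ℝ ∞ (fun y => (f y).range.starProjection) w := by
  have h1 : ContDiffAt ℝ ∞ (fun y => f y + star (f y) - 1) w :=
    (hf.add (contDiffAt_star_comp hf)).sub contDiffAt_const
  have h2 := hf.mul (contDiffAt_inverse_comp h1 (isUnit_add_star_sub_one hff.self_of_nhds))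
  exact h2.congr_of_eventuallyEq (hff.mono fun y hy => starProjection_range_eq hy)

end ProjectionOntoRange

/-! ### The Gauss bundle near a point. -/

section LocalGaussBundle

variable {n : ℕ}

/-- With primes for ∂̄ and `i` for g⁻¹, the left side is ∂̄(g⁻¹ag): a gauge with ∂̄g = -bg removes
the commutator from ∂̄a = ab - ba. -/
theorem conj_deriv_eq_zero {R : Type*} [Ring R] {g i a b i' a' g' : R} (hi : i' = i * b)
    (ha : a' = a * b - b * a) (hg : g' = -b * g) :
    i' * (a * g) + i * (a' * g + a * g') = 0 := by
  rw [hi, ha, hg]; noncomm_ring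

theorem deriv_inverse_eq {R : Type*} [Ring R] {g i b i' g' : R} (hgi : g * i = 1)
    (h : i' * g + i * g' = 0) (hg : g' = -b * g) : i' = i * b := by
  have h1 : (i' * g + i * g') * i = i' * (g * i) - i * b * (g * i) := by rw [hg]; noncomm_ring
  rw [h, hgi, zero_mul, mul_one, mul_one] at h1
  exact (sub_eq_zero.1 h1.symm)

theorem differentiableAt_complex_of_dbar_eq_zero {F : Type*} [NormedAddCommGroup F]
    [NormedSpace ℂ F] {f : ℂ → F} {w : ℂ} (hf : DifferentiableAt ℝ f w)
    (h : dbar f w = 0) : DifferentiableAt ℂ f w := by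
  refine differentiableAt_complex_iff_differentiableAt_real.2 ⟨hf, ?_⟩
  have h1 := (smul_eq_zero.1 h).resolve_left (by norm_num)
  have h2 : fderiv ℝ f w 1 = -(Complex.I • fderiv ℝ f w Complex.I) := eq_neg_of_add_eq_zero_left h1
  rw [h2, smul_neg, smul_smul, Complex.I_mul_I, neg_one_smul, neg_neg]

/-- Filling out zeros, locally: the image of the second fundamental form of a harmonic map extends
smoothly across the points where the rank drops. -/
theorem exists_local_gauss {P : ℂ → EndCn n} {U : Set ℂ} (hP : IsSmoothProjection P U)
    (hU : IsOpen U) (hh : HarmonicEquation P U) {w₀ : ℂ} (hw₀ : w₀ ∈ U) :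
    ∃ (γ : ℂ → Submodule ℂ (Cn n)) (V : Set ℂ), IsOpen V ∧ w₀ ∈ V ∧ V ⊆ U ∧
      ContDiffOn ℝ ∞ (fun w => (γ w).starProjection) V ∧
      ∀ w ∈ V, w ≠ w₀ → γ w = (dz P w * P w).range := by
  set A : ℂ → EndCn n := fun w => dz P w * P w with hA
  have hAs : ContDiffOn ℝ ∞ A U := (contDiffOn_dz hU hP.smooth).mul hP.smooth
  -- The coefficient -∂̄P is dictated by the equation ∂̄A = A(∂̄P) - (∂̄P)A for harmonic `P`; with
  -- it `H` = g⁻¹Ag becomes holomorphic near `w₀`.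
  obtain ⟨g, hg, hgu, hgd⟩ := exists_gauge (B := fun w => - dbar P w) (hU.mem_nhds hw₀)
    (contDiffOn_dbar hU hP.smooth).neg
  let gi : ℂ → EndCn n := fun w => Ring.inverse (g w)
  have hgi : ∀ w, ContDiffAt ℝ ∞ gi w := fun w => contDiffAt_inverse_comp hg.contDiffAt (hgu w)
  have hgid : ∀ w, DifferentiableAt ℝ gi w := fun w => (hgi w).differentiableAt (by simp)
  have hgdf : ∀ w, DifferentiableAt ℝ g w := hg.differentiable (by simp)
  have hgig : ∀ w, gi w * g w = 1 := fun w => Ring.inverse_mul_cancel _ (hgu w)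
  have hggi : ∀ w, g w * gi w = 1 := fun w => Ring.mul_inverse_cancel _ (hgu w)
  let H : ℂ → EndCn n := fun w => gi w * (A w * g w)
  have hHd : ∀ᶠ w in 𝓝 w₀, DifferentiableAt ℂ H w := by
    filter_upwards [hgd, hU.mem_nhds hw₀] with w hw hwU
    have hAd := ContDiffOn.differentiableAt_of_isOpen hU hAs hwU
    refine differentiableAt_complex_of_dbar_eq_zero
      ((hgid w).fun_mul (hAd.fun_mul (hgdf w))) ?_
    have h1 : dbar gi w * g w + gi w * dbar g w = 0 := by
      rw [← dbar_mul (hgid w) (hgdf w)]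
      refine (dbar_congr (Eventually.of_forall hgig)).trans ?_
      simp [dbar, partialRe, partialIm]
    have h2 := dbar_mul (hgid w) (hAd.fun_mul (hgdf w))
    rw [dbar_mul hAd (hgdf w)] at h2
    rw [h2]
    exact conj_deriv_eq_zero (deriv_inverse_eq (hggi w) h1 hw) (hh.dbar_secondFF hP hU hwU) hw
  have hHa : AnalyticAt ℂ H w₀ := by
    refine DifferentiableOn.analyticAt (s := {w | DifferentiableAt ℂ H w}) (fun w hw => ?_) hHd
    exact DifferentiableAt.differentiableWithinAt hw
  obtain ⟨E, hEa, hEE, hEr⟩ := exists_analytic_idempotent hHa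
  obtain ⟨V, hV, hVo, hwV⟩ := eventually_nhds_iff.1
    (((hEa.eventually_analyticAt).and (hEE.and (eventually_nhdsWithin_iff.1 hEr))).and (hU.mem_nhds hw₀))
  -- Undoing the gauge: this is an idempotent whose range off `w₀` is that of `A`.
  let F : ℂ → EndCn n := fun w => g w * (E w * gi w)
  have hFF : ∀ w ∈ V, F w * F w = F w := by
    intro w hw
    calc F w * F w = g w * (E w * (gi w * g w) * (E w * gi w)) := by simp only [F, mul_assoc]
      _ = F w := by rw [hgig, mul_one, ← mul_assoc (E w), (hV w hw).1.2.1]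
  refine ⟨fun w => (F w).range, V, hVo, hwV, fun w hw => (hV w hw).2, fun w hw => ?_, ?_⟩
  · refine ContDiffAt.contDiffWithinAt (contDiffAt_starProjection_range ?_
      (eventually_of_mem (hVo.mem_nhds hw) hFF))
    have hEc : ContDiffAt ℝ ∞ E w := ((hV w hw).1.1.contDiffAt (n := ∞)).restrict_scalars ℝ
    exact hg.contDiffAt.mul (hEc.mul (hgi w))
  · intro w hw hne
    have hr := (hV w hw).1.2.2 hne
    have hgia : ∀ x, gi w (g w x) = x := fun x => congrArg (fun T : EndCn n => T x) (hgig w)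
    have hgga : ∀ x, g w (gi w x) = x := fun x => congrArg (fun T : EndCn n => T x) (hggi w)
    apply le_antisymm
    · rintro _ ⟨x, rfl⟩
      obtain ⟨y, hy⟩ : E w (gi w x) ∈ (H w).range := hr ▸ ⟨gi w x, rfl⟩
      refine ⟨g w y, ?_⟩
      change A w (g w y) = g w (E w (gi w x))
      rw [← hy]
      exact (hgga _).symm
    · rintro _ ⟨x, rfl⟩
      obtain ⟨y, hy⟩ : H w (gi w x) ∈ (E w).range := hr.symm ▸ ⟨gi w x, rfl⟩
      refine ⟨g w y, ?_⟩
      change g w (E w (gi w (g w y))) = A w x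
      have hy' : E w y = gi w (A w (g w (gi w x))) := hy
      rw [hgia, hy', hgga, hgga]

end LocalGaussBundle

/-! ### The trace form and the first variation of the energy. -/

section Trace

variable {n : ℕ}

/-- The real part of the trace. -/
def traceRe (n : ℕ) : EndCn n →L[ℝ] ℝ :=
  LinearMap.toContinuousLinearMap
    { toFun := fun A => (LinearMap.trace ℂ (Cn n) (A : Cn n →ₗ[ℂ] Cn n)).re
      map_add' := fun A B => by simp
      map_smul' := fun c A => by
        have : ((c • A : EndCn n) : Cn n →ₗ[ℂ] Cn n) = (c : ℂ) • (A : Cn n →ₗ[ℂ] Cn n) := by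
          ext; simp
        rw [this]; simp }

theorem traceRe_apply (A : EndCn n) :
    traceRe n A = (LinearMap.trace ℂ (Cn n) (A : Cn n →ₗ[ℂ] Cn n)).re := rfl

theorem traceRe_mul_comm (A B : EndCn n) : traceRe n (A * B) = traceRe n (B * A) := by
  rw [traceRe_apply, traceRe_apply]
  exact congrArg Complex.re (LinearMap.trace_mul_comm ℂ (A : Cn n →ₗ[ℂ] Cn n) (B : Cn n →ₗ[ℂ] Cn n))

theorem hsNormSq_eq (A : EndCn n) : hsNormSq A = traceRe n (star A * A) := by
  rw [traceRe_apply, LinearMap.trace_eq_sum_inner _ (EuclideanSpace.basisFun (Fin n) ℂ), hsNormSq,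
    Complex.re_sum]
  refine Finset.sum_congr rfl fun i _ => ?_
  have : ((star A * A : EndCn n) : Cn n →ₗ[ℂ] Cn n) (EuclideanSpace.basisFun (Fin n) ℂ i) =
    star A (A (EuclideanSpace.single i 1)) := by simp
  rw [this, ContinuousLinearMap.star_eq_adjoint, ContinuousLinearMap.adjoint_inner_right,
    EuclideanSpace.basisFun_apply]
  exact norm_sq_eq_re_inner (𝕜 := ℂ) _

theorem hsNormSq_pos {A : EndCn n} (hA : A ≠ 0) : 0 < hsNormSq A := by
  have h0 : 0 ≤ hsNormSq A := Finset.sum_nonneg fun i _ => by positivity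
  refine lt_of_le_of_ne h0 fun h => hA ?_
  have h1 := (Finset.sum_eq_zero_iff_of_nonneg (fun i _ => by positivity)).1 h.symm
  refine ContinuousLinearMap.coe_injective ((EuclideanSpace.basisFun (Fin n) ℂ).toBasis.ext fun i => ?_)
  have h2 := h1 i (Finset.mem_univ i)
  simpa using h2

/-- A tangent vector of the Grassmannian is orthogonal to the endomorphisms that commute with the
projection. -/
theorem traceRe_mul_eq_zero {p l η : EndCn n} (hp : p * p = p) (hl : p * l = l * p)
    (hη : η * p + p * η = η) : traceRe n (l * η) = 0 := by
  have h1 : p * η * p = 0 := mul_deriv_mul_eq_zero hp hη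
  have h2 : traceRe n (l * (p * η)) = 0 := by
    have e : l * (p * η) = p * (l * p * η) := by
      rw [← mul_assoc p, ← mul_assoc p, hl, mul_assoc l p p, hp, mul_assoc]
    rw [e, traceRe_mul_comm, mul_assoc, mul_assoc, ← mul_assoc p, h1, mul_zero, map_zero]
  have h3 : traceRe n (l * (η * p)) = 0 := by
    rw [← mul_assoc, traceRe_mul_comm, ← mul_assoc, hl, mul_assoc, h2]
  rw [← hη, mul_add, map_add, h3, h2, add_zero]

end Trace

section FirstVariation

theorem hasDerivAt_setIntegral_of_contDiffOn {e : ℝ × ℂ → ℝ} {U K : Set ℂ} (hU : IsOpen U)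
    (hK : IsCompact K) (hKU : K ⊆ U) (he : ContDiffOn ℝ 1 e (univ ×ˢ U)) :
    HasDerivAt (fun s => ∫ w in K, e (s, w)) (∫ w in K, fderiv ℝ e (0, w) (1, 0)) 0 := by
  have hUo : IsOpen ((univ : Set ℝ) ×ˢ U) := isOpen_univ.prod hU
  have hc : ContinuousOn (fun q => fderiv ℝ e q (1, 0)) (univ ×ˢ U) :=
    (he.continuousOn_fderiv_of_isOpen hUo le_rfl).clm_apply continuousOn_const
  obtain ⟨C, hC⟩ := (isCompact_Icc (a := (-1 : ℝ)) (b := 1)).prod hK |>.exists_bound_of_continuousOn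
    (hc.mono (prod_mono (subset_univ _) hKU))
  have hslice : ∀ s : ℝ, ContinuousOn (fun w => e (s, w)) K := fun s =>
    he.continuousOn.comp (by fun_prop) fun w hw => ⟨mem_univ _, hKU hw⟩
  refine (hasDerivAt_integral_of_dominated_loc_of_deriv_le (F := fun s w => e (s, w))
    (F' := fun s w => fderiv ℝ e (s, w) (1, 0)) (bound := fun _ => C)
    (Metric.ball_mem_nhds 0 one_pos) ?_ ?_ ?_ ?_ ?_ ?_).2
  · exact Eventually.of_forall fun s => (hslice s).aestronglyMeasurable hK.measurableSet
  · exact (hslice 0).integrableOn_compact hK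
  · refine ContinuousOn.aestronglyMeasurable ?_ hK.measurableSet
    exact hc.comp (by fun_prop : Continuous fun w : ℂ => ((0 : ℝ), w)).continuousOn
      fun w hw => ⟨mem_univ _, hKU hw⟩
  · refine (ae_restrict_iff' hK.measurableSet).2 (Eventually.of_forall fun w hw s hs => ?_)
    rw [Metric.mem_ball, dist_zero_right, Real.norm_eq_abs, abs_lt] at hs
    exact hC (s, w) ⟨⟨hs.1.le, hs.2.le⟩, hw⟩
  · exact integrableOn_const hK.measure_lt_top.ne
  · refine (ae_restrict_iff' hK.measurableSet).2 (Eventually.of_forall fun w hw s hs => ?_)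
    have hd := (he.contDiffAt (hUo.mem_nhds (x := (s, w)) ⟨mem_univ _, hKU hw⟩)).differentiableAt one_ne_zero
    exact hd.hasFDerivAt.comp_hasDerivAt s ((hasDerivAt_id s).prodMk (hasDerivAt_const s w))

/-- The integral of a derivative of a function with compact support vanishes. -/
theorem setIntegral_fderiv_eq_zero {f : ℂ → ℝ} {U K : Set ℂ} (hU : IsOpen U)
    (hK : IsCompact K) (hKU : K ⊆ U) (hf : ContDiffOn ℝ 1 f U) (h0 : ∀ w ∈ U, w ∉ K → f w = 0)
    (e : ℂ) : ∫ w in K, fderiv ℝ f w e = 0 := by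
  have hfU : ∀ w ∈ U, indicator U f =ᶠ[𝓝 w] f := fun w hw =>
    eventually_of_mem (hU.mem_nhds hw) fun y hy => indicator_of_mem hy f
  have hsupp : tsupport (indicator U f) ⊆ K := by
    refine closure_minimal (fun w hw => ?_) hK.isClosed
    by_contra hwK
    refine hw ?_
    by_cases hwU : w ∈ U
    · rw [indicator_of_mem hwU, h0 w hwU hwK]
    · exact indicator_of_notMem hwU f
  have hcd : ContDiff ℝ 1 (indicator U f) := contDiff_of_contDiffAt_tsupport fun w hw =>
    (hf.contDiffAt (hU.mem_nhds (hKU (hsupp hw)))).congr_of_eventuallyEq (hfU w (hKU (hsupp hw)))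
  have hcs : HasCompactSupport (indicator U f) := hK.of_isClosed_subset (isClosed_tsupport _) hsupp
  have h1 : ∫ w, fderiv ℝ (indicator U f) w e = 0 := by
    have hi : Integrable fun w => fderiv ℝ (indicator U f) w e :=
      ((hcd.continuous_fderiv_apply one_ne_zero).comp
        (by fun_prop : Continuous fun w : ℂ => (w, e))).integrable_of_hasCompactSupport
          (hcs.fderiv_apply ℝ e)
    have := integral_mul_fderiv_eq_neg_fderiv_mul_of_integrable (μ := volume) (𝕜 := ℝ)
      (f := fun _ : ℂ => (1 : ℝ)) (g := indicator U f) (v := e) (by simp)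
      (by simpa using hi)
      (by simpa using hcd.continuous.integrable_of_hasCompactSupport hcs)
      (fun _ _ => differentiableAt_const _) (fun w _ => hcd.differentiable one_ne_zero w)
    simpa using this
  rw [setIntegral_congr_fun hK.measurableSet (g := fun w => fderiv ℝ (indicator U f) w e)
    fun w hw => congrArg (fun T : ℂ →L[ℝ] ℝ => T e) (hfU w (hKU hw)).symm.fderiv_eq,
    setIntegral_eq_integral_of_forall_compl_eq_zero, h1]
  intro w hw
  rw [image_eq_zero_of_notMem_tsupport (f := fderiv ℝ (indicator U f))
    fun h => hw (hsupp (tsupport_fderiv_subset ℝ h))]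
  rfl

variable {n : ℕ} {p : ℝ × ℂ → EndCn n} {U K : Set ℂ}

theorem fderiv_slice (hU : IsOpen U) (hp : ContDiffOn ℝ ∞ p (univ ×ˢ U)) (s : ℝ) {w : ℂ}
    (hw : w ∈ U) (c : ℂ) : fderiv ℝ (fun y => p (s, y)) w c = fderiv ℝ p (s, w) (0, c) := by
  have hd := (hp.contDiffAt ((isOpen_univ.prod hU).mem_nhds (x := (s, w)) ⟨mem_univ _, hw⟩)).differentiableAt
    (by simp)
  have h := hd.hasFDerivAt.comp w ((hasFDerivAt_const s w).prodMk (hasFDerivAt_id (𝕜 := ℝ) w))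
  exact congrArg (fun T => T c) h.fderiv

theorem contDiffOn_fderiv_slice (hU : IsOpen U) (hp : ContDiffOn ℝ ∞ p (univ ×ˢ U)) (v : ℝ × ℂ) :
    ContDiffOn ℝ ∞ (fun q => fderiv ℝ p q v) (univ ×ˢ U) :=
  (hp.fderiv_of_isOpen (isOpen_univ.prod hU) (by simp)).clm_apply contDiffOn_const

theorem contDiffOn_slice {F : Type*} [NormedAddCommGroup F] [NormedSpace ℝ F] {f : ℝ × ℂ → F}
    (hf : ContDiffOn ℝ ∞ f (univ ×ˢ U)) (s : ℝ) : ContDiffOn ℝ ∞ (fun w => f (s, w)) U :=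
  hf.comp (contDiff_const.prodMk contDiff_id).contDiffOn fun _ hw => ⟨mem_univ _, hw⟩

theorem fderiv_traceRe_mul {E : Type*} [NormedAddCommGroup E] [NormedSpace ℝ E] {f g : E → EndCn n}
    {x : E} (hf : DifferentiableAt ℝ f x) (hg : DifferentiableAt ℝ g x) (v : E) :
    fderiv ℝ (fun y => traceRe n (f y * g y)) x v =
      traceRe n (fderiv ℝ f x v * g x) + traceRe n (f x * fderiv ℝ g x v) := by
  have h := (traceRe n).hasFDerivAt.comp x (hf.hasFDerivAt.mul' hg.hasFDerivAt)
  have h2 := congrArg (fun T => T v) h.fderiv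
  refine h2.trans ?_
  rw [← map_add, add_comm]
  rfl

/-- The derivative of one of the two terms of the energy. -/
theorem hasDerivAt_energy_term (hU : IsOpen U) (hK : IsCompact K) (hKU : K ⊆ U)
    (hp : ContDiffOn ℝ ∞ p (univ ×ˢ U)) (hs : ∀ s, ∀ w ∈ U, star (p (s, w)) = p (s, w))
    (hfix : ∀ s, ∀ w ∈ U, w ∉ K → p (s, w) = p (0, w)) (c : ℂ) :
    IntegrableOn (fun w => traceRe n (fderiv ℝ (fun y => fderiv ℝ (fun y => p (0, y)) y c) w c *
        fderiv ℝ p (0, w) (1, 0))) K ∧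
    (∀ s, IntegrableOn (fun w => hsNormSq (fderiv ℝ (fun y => p (s, y)) w c)) K) ∧
    HasDerivAt (fun s => ∫ w in K, hsNormSq (fderiv ℝ (fun y => p (s, y)) w c))
      (-2 * ∫ w in K, traceRe n (fderiv ℝ (fun y => fderiv ℝ (fun y => p (0, y)) y c) w c *
        fderiv ℝ p (0, w) (1, 0))) 0 := by
  have hUo : IsOpen ((univ : Set ℝ) ×ˢ U) := isOpen_univ.prod hU
  set d : ℝ × ℂ → EndCn n := fun q => fderiv ℝ p q (0, c) with hd
  set η : ℂ → EndCn n := fun w => fderiv ℝ p (0, w) (1, 0) with hη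
  have hdc : ContDiffOn ℝ ∞ d (univ ×ˢ U) := contDiffOn_fderiv_slice hU hp _
  have hηc : ContDiffOn ℝ ∞ η U := contDiffOn_slice (contDiffOn_fderiv_slice hU hp (1, 0)) 0
  have hd0 : ContDiffOn ℝ ∞ (fun w => d (0, w)) U := contDiffOn_slice hdc 0
  have hmem : ∀ (s : ℝ) {w : ℂ}, w ∈ U → (s, w) ∈ (univ : Set ℝ) ×ˢ U := fun _ _ hw => ⟨mem_univ _, hw⟩
  have hpd : ∀ q ∈ (univ : Set ℝ) ×ˢ U, DifferentiableAt ℝ p q := fun q hq =>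
    (hp.contDiffAt (hUo.mem_nhds hq)).differentiableAt (by simp)
  have hdd : ∀ q ∈ (univ : Set ℝ) ×ˢ U, DifferentiableAt ℝ d q := fun q hq =>
    (hdc.contDiffAt (hUo.mem_nhds hq)).differentiableAt (by simp)
  have hstar : ∀ q ∈ (univ : Set ℝ) ×ˢ U, star (d q) = d q := by
    intro q hq
    have h1 := congrArg (fun T => T (0, c)) (hpd q hq).hasFDerivAt.star.fderiv
    have h2 : (fun y => star (p y)) =ᶠ[𝓝 q] p := eventually_of_mem (hUo.mem_nhds hq) fun y hy =>
      hs y.1 y.2 hy.2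
    rw [h2.fderiv_eq] at h1
    exact h1.symm
  have hslice : ∀ s, ∀ w ∈ U, hsNormSq (fderiv ℝ (fun y => p (s, y)) w c) =
      traceRe n (d (s, w) * d (s, w)) := by
    intro s w hw
    rw [fderiv_slice hU hp s hw, hsNormSq_eq]
    change traceRe n (star (d (s, w)) * d (s, w)) = _
    rw [hstar _ (hmem s hw)]
  have he : ContDiffOn ℝ ∞ (fun q => traceRe n (d q * d q)) (univ ×ˢ U) :=
    (traceRe n).contDiff.comp_contDiffOn (hdc.mul hdc)
  have hder := hasDerivAt_setIntegral_of_contDiffOn hU hK hKU (he.of_le (by simp))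
  -- Symmetry of second derivatives: the s-derivative of a coordinate derivative of `p` is the
  -- coordinate derivative of the variation field `η`.
  have hsymm : ∀ w ∈ U, fderiv ℝ d (0, w) (1, 0) = fderiv ℝ η w c := by
    intro w hw
    have h2 : ContDiffAt ℝ 2 p (0, w) :=
      (hp.contDiffAt (hUo.mem_nhds (hmem 0 hw))).of_le (by norm_cast)
    have hsy := h2.isSymmSndFDerivAt (by simp)
    have hdf : DifferentiableAt ℝ (fderiv ℝ p) (0, w) :=
      (h2.fderiv_right (m := 1) (by norm_num)).differentiableAt one_ne_zero
    have key : ∀ u v : ℝ × ℂ, fderiv ℝ (fun y => fderiv ℝ p y u) (0, w) v =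
        fderiv ℝ (fderiv ℝ p) (0, w) v u := by
      intro u v
      rw [(hdf.hasFDerivAt.clm_apply (hasFDerivAt_const u _)).fderiv]
      simp
    rw [hη, fderiv_slice (p := fun q => fderiv ℝ p q (1, 0)) hU (contDiffOn_fderiv_slice hU hp _) 0 hw,
      hd, key, key]
    exact hsy _ _
  -- The variation is constant in s off `K`, so the integration by parts below has no boundary term.
  have hη0 : ∀ w ∈ U, w ∉ K → η w = 0 := by
    intro w hw hwK
    have h1 := (hpd _ (hmem 0 hw)).hasFDerivAt.comp_hasDerivAt (0 : ℝ)
      ((hasDerivAt_id (0 : ℝ)).prodMk (hasDerivAt_const (0 : ℝ) w))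
    have h2 : (p ∘ fun s : ℝ => (s, w)) = fun _ => p (0, w) := funext fun s => hfix s w hw hwK
    exact h1.unique (by erw [h2]; exact hasDerivAt_const _ _)
  have hP2 : ∀ w ∈ U, fderiv ℝ (fun y => fderiv ℝ (fun y => p (0, y)) y c) w c =
      fderiv ℝ (fun y => d (0, y)) w c := by
    intro w hw
    rw [Filter.EventuallyEq.fderiv_eq (eventually_of_mem (hU.mem_nhds hw) fun y hy =>
      fderiv_slice hU hp 0 hy c)]
  have hP2c : ContDiffOn ℝ ∞ (fun w => fderiv ℝ (fun y => d (0, y)) w c) U :=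
    contDiffOn_fderiv_apply hU hd0 c
  have hηcc : ContDiffOn ℝ ∞ (fun w => fderiv ℝ η w c) U := contDiffOn_fderiv_apply hU hηc c
  have hint1 : IntegrableOn (fun w => traceRe n (fderiv ℝ (fun y => d (0, y)) w c * η w)) K :=
    ((traceRe n).contDiff.comp_contDiffOn (hP2c.mul hηc)).continuousOn.mono hKU
      |>.integrableOn_compact hK
  have hint2 : IntegrableOn (fun w => traceRe n (d (0, w) * fderiv ℝ η w c)) K :=
    ((traceRe n).contDiff.comp_contDiffOn (hd0.mul hηcc)).continuousOn.mono hKU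
      |>.integrableOn_compact hK
  have hparts : ∫ w in K, traceRe n (d (0, w) * fderiv ℝ η w c) =
      -∫ w in K, traceRe n (fderiv ℝ (fun y => d (0, y)) w c * η w) := by
    have hf : ContDiffOn ℝ ∞ (fun w => traceRe n (d (0, w) * η w)) U :=
      (traceRe n).contDiff.comp_contDiffOn (hd0.mul hηc)
    have h1 := setIntegral_fderiv_eq_zero hU hK hKU (hf.of_le (by simp))
      (fun w hw hwK => by rw [hη0 w hw hwK, mul_zero, map_zero]) c
    rw [setIntegral_congr_fun hK.measurableSet fun w hw => fderiv_traceRe_mul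
      ((hd0.contDiffAt (hU.mem_nhds (hKU hw))).differentiableAt (by simp))
      ((hηc.contDiffAt (hU.mem_nhds (hKU hw))).differentiableAt (by simp)) c,
      integral_add hint1 hint2] at h1
    linarith
  refine ⟨?_, ?_, ?_⟩
  · exact hint1.congr_fun (fun w hw => by simp only [hP2 w (hKU hw), hη]) hK.measurableSet
  · intro s
    have h1 : IntegrableOn (fun w => traceRe n (d (s, w) * d (s, w))) K :=
      ((contDiffOn_slice he s).continuousOn.mono hKU).integrableOn_compact hK
    exact h1.congr_fun (fun w hw => (hslice s w (hKU hw)).symm) hK.measurableSet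
  · have e1 : (fun s => ∫ w in K, hsNormSq (fderiv ℝ (fun y => p (s, y)) w c)) =
        fun s => ∫ w in K, traceRe n (d (s, w) * d (s, w)) := by
      ext s
      exact setIntegral_congr_fun hK.measurableSet fun w hw => hslice s w (hKU hw)
    rw [e1]
    refine hder.congr_deriv ?_
    rw [setIntegral_congr_fun hK.measurableSet (g := fun w => 2 * traceRe n (d (0, w) * fderiv ℝ η w c)),
      integral_const_mul, hparts, setIntegral_congr_fun hK.measurableSet
        (f := fun w => traceRe n (fderiv ℝ (fun y => fderiv ℝ (fun y => p (0, y)) y c) w c * η w))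
        (g := fun w => traceRe n (fderiv ℝ (fun y => d (0, y)) w c * η w))]
    · ring
    · intro w hw
      simp only [hP2 w (hKU hw)]
    · intro w hw
      dsimp only
      rw [fderiv_traceRe_mul (hdd _ (hmem 0 (hKU hw))) (hdd _ (hmem 0 (hKU hw))),
        traceRe_mul_comm, hsymm w (hKU hw)]
      ring

/-- The first variation formula. -/
theorem hasDerivAt_energy (hU : IsOpen U) (hK : IsCompact K) (hKU : K ⊆ U)
    (hp : ContDiffOn ℝ ∞ p (univ ×ˢ U)) (hs : ∀ s, ∀ w ∈ U, star (p (s, w)) = p (s, w))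
    (hfix : ∀ s, ∀ w ∈ U, w ∉ K → p (s, w) = p (0, w)) :
    HasDerivAt (fun s => (1 / 2) * ∫ w in K, (hsNormSq (partialRe (fun y => p (s, y)) w) +
        hsNormSq (partialIm (fun y => p (s, y)) w)))
      (-∫ w in K, traceRe n ((partialRe (partialRe fun y => p (0, y)) w +
        partialIm (partialIm fun y => p (0, y)) w) * fderiv ℝ p (0, w) (1, 0))) 0 := by
  obtain ⟨a1, b1, c1⟩ := hasDerivAt_energy_term hU hK hKU hp hs hfix 1
  obtain ⟨a2, b2, c2⟩ := hasDerivAt_energy_term hU hK hKU hp hs hfix Complex.I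
  have h := (c1.add c2).const_mul (1 / 2)
  have e1 : (fun s => (1 / 2) * ∫ w in K, (hsNormSq (partialRe (fun y => p (s, y)) w) +
        hsNormSq (partialIm (fun y => p (s, y)) w))) = fun s =>
        (1 / 2) * ((∫ w in K, hsNormSq (fderiv ℝ (fun y => p (s, y)) w 1)) +
          ∫ w in K, hsNormSq (fderiv ℝ (fun y => p (s, y)) w Complex.I)) := by
    ext s
    rw [← integral_add (b1 s) (b2 s)]
    rfl
  rw [e1]
  refine h.congr_deriv ?_
  simp only [add_mul, map_add]
  have e2 := integral_add a1 a2
  refine Eq.trans ?_ (congrArg Neg.neg e2.symm)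
  ring

end FirstVariation

/-! ### Holomorphic coordinates as charts of the underlying real surface. -/

section Charts

variable {M : Type*} [TopologicalSpace M] {n : ℕ}

theorem contDiffGroupoid_complex_le :
    contDiffGroupoid ω 𝓘(ℂ) ≤ contDiffGroupoid ∞ 𝓘(ℝ, ℂ) := by
  rw [contDiffGroupoid, contDiffGroupoid]
  apply groupoid_of_pregroupoid_le
  intro f s hfs
  exact (ContDiffOn.restrict_scalars ℝ hfs).of_le (by simp)

variable [ChartedSpace ℂ M]

theorem contDiffOn_transition {z z' : OpenPartialHomeomorph M ℂ} (hz : z ∈ coordinates M)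
    (hz' : z' ∈ coordinates M) : ContDiffOn ℂ ω (z' ∘ z.symm) (z.symm ≫ₕ z').source := by
  have h := (mem_groupoid_of_pregroupoid.1 (IsManifold.compatible_of_mem_maximalAtlas hz hz')).1
  simpa [contDiffPregroupoid] using h

theorem coordinates_subset : coordinates M ⊆ IsManifold.maximalAtlas 𝓘(ℝ, ℂ) ∞ M :=
  StructureGroupoid.maximalAtlas_mono contDiffGroupoid_complex_le

variable [IsManifold 𝓘(ℂ) ω M]


theorem chartAt_mem_coordinates (x : M) : chartAt ℂ x ∈ coordinates M :=
  IsManifold.chart_mem_maximalAtlas x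

theorem isManifold_real : IsManifold 𝓘(ℝ, ℂ) ∞ M :=
  have : HasGroupoid M (contDiffGroupoid ∞ 𝓘(ℝ, ℂ)) :=
    hasGroupoid_of_le (G₁ := contDiffGroupoid ω 𝓘(ℂ)) (by infer_instance) contDiffGroupoid_complex_le
  IsManifold.mk' _ _ _

theorem contMDiff_of_coordinates {F : Type*} [NormedAddCommGroup F] [NormedSpace ℝ F] {f : M → F}
    (h : ∀ x, ∃ z ∈ coordinates M, x ∈ z.source ∧ ContDiffAt ℝ ∞ (f ∘ z.symm) (z x)) :
    ContMDiff 𝓘(ℝ, ℂ) 𝓘(ℝ, F) ∞ f := by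
  have := isManifold_real (M := M)
  intro x
  obtain ⟨z, hz, hx, hf⟩ := h x
  refine ((hf.contMDiffAt).comp x
    (contMDiffAt_of_mem_maximalAtlas (coordinates_subset hz) hx)).congr_of_eventuallyEq ?_
  filter_upwards [z.open_source.mem_nhds hx] with y hy
  simp [z.left_inv hy]

theorem contDiffOn_comp_symm {F : Type*} [NormedAddCommGroup F] [NormedSpace ℝ F] {f : M → F}
    (hf : ContMDiff 𝓘(ℝ, ℂ) 𝓘(ℝ, F) ∞ f) {z : OpenPartialHomeomorph M ℂ} (hz : z ∈ coordinates M) :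
    ContDiffOn ℝ ∞ (f ∘ z.symm) z.target :=
  have := isManifold_real (M := M)
  contMDiffOn_iff_contDiffOn.1 (hf.comp_contMDiffOn
    (contMDiffOn_symm_of_mem_maximalAtlas (coordinates_subset hz)))

theorem IsSmoothMap.isSmoothProjection {m : ℕ} {ψ : M → Submodule ℂ (Cn n)} (hψ : IsSmoothMap m ψ)
    {z : OpenPartialHomeomorph M ℂ} (hz : z ∈ coordinates M) :
    IsSmoothProjection (proj ψ ∘ z.symm) z.target :=
  ⟨contDiffOn_comp_symm hψ.smooth hz, fun _ _ => isStarProjection_starProjection⟩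

theorem contDiffOn_prod_comp_symm {F : Type*} [NormedAddCommGroup F] [NormedSpace ℝ F] {f : ℝ × M → F}
    (hf : ContMDiff (𝓘(ℝ, ℝ).prod 𝓘(ℝ, ℂ)) 𝓘(ℝ, F) ∞ f)
    {z : OpenPartialHomeomorph M ℂ} (hz : z ∈ coordinates M) :
    ContDiffOn ℝ ∞ (fun q : ℝ × ℂ => f (q.1, z.symm q.2)) (univ ×ˢ z.target) := by
  have := isManifold_real (M := M)
  have h1 : ContMDiffOn 𝓘(ℝ, ℝ × ℂ) (𝓘(ℝ, ℝ).prod 𝓘(ℝ, ℂ)) ∞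
      (fun q : ℝ × ℂ => (q.1, z.symm q.2)) (univ ×ˢ z.target) := by
    refine ContMDiffOn.prodMk (contMDiff_iff_contDiff.2 contDiff_fst).contMDiffOn ?_
    exact (contMDiffOn_symm_of_mem_maximalAtlas (coordinates_subset hz)).comp
      (contMDiff_iff_contDiff.2 contDiff_snd).contMDiffOn fun q hq => hq.2
  exact contMDiffOn_iff_contDiffOn.1 (hf.comp_contMDiffOn h1)

theorem contMDiff_prod_of_coordinates {F : Type*} [NormedAddCommGroup F] [NormedSpace ℝ F]
    {f : ℝ × M → F} (h : ∀ x, ∃ z ∈ coordinates M, x ∈ z.source ∧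
      ∃ V ∈ 𝓝 (z x), ContDiffOn ℝ ∞ (fun q : ℝ × ℂ => f (q.1, z.symm q.2)) (univ ×ˢ V)) :
    ContMDiff (𝓘(ℝ, ℝ).prod 𝓘(ℝ, ℂ)) 𝓘(ℝ, F) ∞ f := by
  have := isManifold_real (M := M)
  rintro ⟨s, x⟩
  obtain ⟨z, hz, hx, V, hV, hf⟩ := h x
  have h1 : ContMDiffAt (𝓘(ℝ, ℝ).prod 𝓘(ℝ, ℂ)) 𝓘(ℝ, ℝ × ℂ) ∞
      (fun q : ℝ × M => (q.1, z q.2)) (s, x) := by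
    refine ContMDiffAt.prodMk_space contMDiffAt_fst ?_
    exact (contMDiffAt_of_mem_maximalAtlas (coordinates_subset hz) hx).comp (s, x) contMDiffAt_snd
  have h2 : ContDiffAt ℝ ∞ (fun q : ℝ × ℂ => f (q.1, z.symm q.2)) (s, z x) :=
    hf.contDiffAt (prod_mem_nhds univ_mem hV)
  refine (h2.contMDiffAt.comp (s, x) h1).congr_of_eventuallyEq ?_
  filter_upwards [continuous_snd.continuousAt.preimage_mem_nhds (z.open_source.mem_nhds hx)] with y hy
  simp [z.left_inv hy]

end Charts

/-! ### Unitary variations and the Euler–Lagrange equation. -/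

section Unitary
variable {n : ℕ}

/-- The image of a subspace under a unitary map. -/
theorem starProjection_map_unitary {u : EndCn n} (h1 : star u * u = 1)
    (V : Submodule ℂ (Cn n)) :
    (V.map (u : Cn n →ₗ[ℂ] Cn n)).starProjection = u * V.starProjection * star u := by
  have hi : ∀ x y, inner ℂ (u x) y = inner ℂ x (star u y) := fun x y =>
    (ContinuousLinearMap.adjoint_inner_right u x y).symm
  ext1 x
  symm
  refine (Submodule.eq_starProjection_of_mem_orthogonal
    (Submodule.mem_map_of_mem (Submodule.starProjection_apply_mem V (star u x))) ?_).symm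
  rw [Submodule.mem_orthogonal]
  rintro _ ⟨y, hy, rfl⟩
  have e : star u (u (V.starProjection (star u x))) = V.starProjection (star u x) :=
    congrArg (fun T : EndCn n => T (V.starProjection (star u x))) h1
  refine (hi _ _).trans ?_
  rw [map_sub]
  erw [e]
  exact Submodule.sub_starProjection_mem_orthogonal (star u x) y hy

theorem finrank_map_unitary {u : EndCn n} (h1 : star u * u = 1) (V : Submodule ℂ (Cn n)) :
    Module.finrank ℂ (V.map (u : Cn n →ₗ[ℂ] Cn n)) = Module.finrank ℂ V := by
  have hi : Function.Injective u := Function.LeftInverse.injective (g := (star u : EndCn n)) fun x =>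
    congrArg (fun T : EndCn n => T x) h1
  exact (Submodule.equivMapOfInjective (u : Cn n →ₗ[ℂ] Cn n) hi V).finrank_eq.symm

end Unitary

section Variation

/-- The family is exp(sB), unitary because `B` is skew-adjoint. It serves to move subspaces within a
Grassmannian in a prescribed direction. -/
theorem exists_unitary_family {A : Type*} [NormedRing A] [NormedAlgebra ℝ A] [CompleteSpace A]
    [StarRing A] [ContinuousStar A] [StarModule ℝ A] (B : A) (h : star B = - B) :
    ∃ u : ℝ → A, ContDiff ℝ ∞ u ∧ u 0 = 1 ∧ (∀ s, star (u s) * u s = 1) ∧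
      HasDerivAt u B 0 := by
  refine ⟨fun s => NormedSpace.exp (s • B), ?_, ?_, ?_, ?_⟩
  · have : ContDiff ℝ ∞ (NormedSpace.exp : A → A) := 
      contDiff_iff_contDiffAt.2 fun x => (NormedSpace.exp_analytic (𝕂 := ℝ) x).contDiffAt
    exact this.comp (contDiff_id.smul contDiff_const)
  · simp [NormedSpace.exp_zero]
  · intro s
    have h1 : s • B ∈ skewAdjoint A := by
      refine (skewAdjoint.mem_iff).2 ?_
      rw [star_smul, h]; simp
    let _ := NormedAlgebra.restrictScalars ℚ ℝ A
    exact (NormedSpace.exp_mem_unitary_of_mem_skewAdjoint h1).1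
  · have := hasDerivAt_exp_smul_const (𝕂 := ℝ) (𝔸 := A) B 0
    simpa [NormedSpace.exp_zero] using this

theorem exists_unitary_family_endCn (n : ℕ) (B : EndCn n) (h : star B = - B) :
    ∃ u : ℝ → EndCn n, ContDiff ℝ ∞ u ∧ u 0 = 1 ∧ (∀ s, star (u s) * u s = 1) ∧
      HasDerivAt u B 0 := 
  have : @StarModule ℝ (EndCn n) _ _ (NormedAlgebra.complexToReal (A := EndCn n)).toAlgebra.toSMul := 
    ⟨fun r a => (StarModule.star_smul (r : ℂ) a).trans (by simp)⟩
  exists_unitary_family (A := EndCn n) B h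

theorem fderiv_idempotent {A E : Type*} [NormedRing A] [NormedAlgebra ℝ A] [NormedAddCommGroup E] [NormedSpace ℝ E]
   {p : E → A} {S : Set E} (hS : IsOpen S) {x : E} (hx : x ∈ S) (hp : DifferentiableAt ℝ p x)
   (h : ∀ y ∈ S, p y * p y = p y) (v : E) : fderiv ℝ p x v * p x + p x * fderiv ℝ p x v = fderiv ℝ p x v := by
  have h1 : (fun y => p y * p y) =ᶠ[𝓝 x] p := eventually_of_mem (hS.mem_nhds hx) h
  have h2 := (hp.hasFDerivAt.mul' hp.hasFDerivAt).unique (hp.hasFDerivAt.congr_of_eventuallyEq h1)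
  have h3 := congrArg (fun T => T v) h2
  simp at h3
  rw [add_comm]
  exact h3

/-- The infinitesimal rotation of a projection is a commutator; `c` will be the value of a cutoff
function. -/
theorem hasDerivAt_conj {A : Type*} [NormedRing A] [NormedAlgebra ℝ A] [StarRing A] [ContinuousStar A] [StarModule ℝ A] {u : ℝ → A} {B : A} (hu : HasDerivAt u B 0) (h0 : u 0 = 1)
   (hB : star B = - B) (p : A) (c : ℝ) :
   HasDerivAt (fun s : ℝ => u (s * c) * p * star (u (s * c))) (c • (B * p - p * B)) 0 := by
  have h1 : HasDerivAt (fun s : ℝ => u (s * c)) (c • B) 0 := by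
    have := HasDerivAt.scomp (h := fun s : ℝ => s * c) (h' := c) (0:ℝ) (by simpa using hu) (by simpa using (hasDerivAt_id (0:ℝ)).mul_const c)
    exact (by simpa using this : HasDerivAt (u ∘ fun s => s * c) (c • B) 0)
  have h2 := (h1.mul_const p).mul h1.star
  refine h2.congr_deriv ?_
  simp [h0, hB, sub_eq_add_neg]

theorem hasDerivAt_conj_endCn {n : ℕ} {u : ℝ → EndCn n} {B : EndCn n} (hu : HasDerivAt u B 0)
    (h0 : u 0 = 1) (hB : star B = -B) (p : EndCn n) (c : ℝ) :
    HasDerivAt (fun s : ℝ => u (s * c) * p * star (u (s * c))) (c • (B * p - p * B)) 0 :=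
  have : @StarModule ℝ (EndCn n) _ _
      (NormedAlgebra.complexToReal (A := EndCn n)).toAlgebra.toSMul :=
    ⟨fun r a => (StarModule.star_smul (r : ℂ) a).trans (by simp)⟩
  hasDerivAt_conj (A := EndCn n) hu h0 hB p c

/-- The coordinate Laplacian `∂²/∂u² + ∂²/∂v²`. -/
def laplacian {F : Type*} [NormedAddCommGroup F] [NormedSpace ℝ F] (f : ℂ → F) (w : ℂ) : F :=
  partialRe (partialRe f) w + partialIm (partialIm f) w

variable {n : ℕ} {P : ℂ → EndCn n} {U : Set ℂ} {w : ℂ}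

theorem laplacian_eq_smul (hU : IsOpen U) (hP : ContDiffOn ℝ ∞ P U) (hw : w ∈ U) :
    laplacian P w = (4 : ℂ) • dbar (dz P) w := by
  rw [dbar_dz_eq hU hP hw, smul_smul]
  norm_num [laplacian]

theorem contDiffOn_laplacian (hU : IsOpen U) (hP : ContDiffOn ℝ ∞ P U) :
    ContDiffOn ℝ ∞ (laplacian P) U :=
  (contDiffOn_fderiv_apply hU (contDiffOn_fderiv_apply hU hP 1) 1).add
    (contDiffOn_fderiv_apply hU (contDiffOn_fderiv_apply hU hP Complex.I) Complex.I)

theorem HarmonicEquation.commute (hP : IsSmoothProjection P U) (hU : IsOpen U)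
    (hh : HarmonicEquation P U) (hw : w ∈ U) : P w * laplacian P w = laplacian P w * P w := by
  have h1 := hh w hw
  have h2 := hh.mul_laplacian_mul hP hU hw
  have h3 : P w * dbar (dz P) w = dbar (dz P) w * P w := by
    rw [sub_mul, sub_mul, one_mul, sub_eq_zero] at h1
    rw [mul_sub, mul_one, sub_eq_zero] at h2
    exact h2.trans h1.symm
  rw [laplacian_eq_smul hU hP.smooth hw]
  exact (mul_smul_comm _ _ _).trans ((congrArg _ h3).trans (smul_mul_assoc _ _ _).symm)

theorem mul_smul_mul_eq_zero {A : Type*} [Ring A] [Algebra ℂ A] {q l p : A} (c : ℂ)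
    (h : q * l * p = 0) : q * (c • l) * p = 0 := by
  rw [mul_smul_comm, smul_mul_assoc, h, smul_zero]

theorem harmonicEquation_of_commute (hP : IsSmoothProjection P U) (hU : IsOpen U)
    (h : ∀ w ∈ U, P w * laplacian P w - laplacian P w * P w = 0) : HarmonicEquation P U := by
  intro w hw
  have h1 := h w hw
  have h2 : dbar (dz P) w = (1 / 4 : ℂ) • laplacian P w := by
    rw [laplacian_eq_smul hU hP.smooth hw, smul_smul]; norm_num
  have h3 : (1 - P w) * laplacian P w * P w = 0 := by
    rw [mul_assoc, ← sub_eq_zero.1 h1, ← mul_assoc, sub_mul, one_mul, hP.mul_self hw, sub_self,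
      zero_mul]
  rw [h2]
  exact mul_smul_mul_eq_zero _ h3

theorem star_commutator_of_star_eq {R : Type*} [Ring R] [StarRing R] {p l : R} (hp : star p = p)
    (hl : star l = l) : star (p * l - l * p) = -(p * l - l * p) := by
  simp [hp, hl]

theorem star_commutator (hP : IsSmoothProjection P U) (hU : IsOpen U) (hw : w ∈ U) :
    star (P w * laplacian P w - laplacian P w * P w) =
      -(P w * laplacian P w - laplacian P w * P w) := by
  have h1 : star (laplacian P w) = laplacian P w := by
    rw [laplacian_eq_smul hU hP.smooth hw, star_smul, hP.star_laplacian hU hw]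
    simp
  exact star_commutator_of_star_eq (hP.star_eq hw) h1

end Variation

section Equation

variable {M : Type*} [TopologicalSpace M] [ChartedSpace ℂ M] [IsManifold 𝓘(ℂ) ω M] {n m : ℕ}
  {ψ : M → Submodule ℂ (Cn n)}

theorem hasDerivAt_energy_variation {z : OpenPartialHomeomorph M ℂ}
    (hz : z ∈ coordinates M) {K : Set M} (hK : IsCompact K) (hKz : K ⊆ z.source)
    {Ψ : ℝ → M → Submodule ℂ (Cn n)} (hΨ : IsVariation m ψ K Ψ) :
    HasDerivAt (fun s => energy z K (Ψ s))
      (-∫ w in z '' K, traceRe n (laplacian (proj ψ ∘ z.symm) w *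
        fderiv ℝ (fun q : ℝ × ℂ => proj (Ψ q.1) (z.symm q.2)) (0, w) (1, 0))) 0 := by
  have h := hasDerivAt_energy z.open_target (hK.image_of_continuousOn (z.continuousOn.mono hKz))
    (image_subset_iff.2 fun x hx => z.map_source (hKz hx)) (contDiffOn_prod_comp_symm hΨ.smooth hz)
    (fun s w _ => isStarProjection_starProjection.isSelfAdjoint) ?_
  · have h0 : (fun y => proj (Ψ 0) (z.symm y)) = proj ψ ∘ z.symm := by rw [hΨ.at_zero]; rfl
    simp only [h0] at h
    exact h
  · intro s w hw hwK
    have hx : z.symm w ∉ K := fun h => hwK ⟨_, h, z.right_inv hw⟩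
    simp only [proj, hΨ.fixed s _ hx, hΨ.at_zero]

/-- The first variation is minus the integral of the trace of ΔP times the variation field. The
equation makes ΔP commute with `P`, while a variation through projections is off-diagonal, so the
integrand vanishes pointwise. -/
theorem isHarmonic_of_equation (hψ : IsSmoothMap m ψ)
    (h : ∀ z ∈ coordinates M, HarmonicEquation (proj ψ ∘ z.symm) z.target) : IsHarmonic m ψ := by
  refine ⟨hψ, fun z hz K hK hKz Ψ hΨ => ?_⟩
  have hd := hasDerivAt_energy_variation hz hK hKz hΨ
  refine hd.congr_deriv (neg_eq_zero.2 ((setIntegral_congr_fun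
    (hK.image_of_continuousOn (z.continuousOn.mono hKz)).measurableSet ?_).trans
      (integral_zero ℂ ℝ)))
  rintro w ⟨x, hx, rfl⟩
  have hw := z.map_source (hKz hx)
  have hP := hψ.isSmoothProjection hz
  have hS : IsOpen ((univ : Set ℝ) ×ˢ z.target) := isOpen_univ.prod z.open_target
  refine traceRe_mul_eq_zero (hP.mul_self hw) ((h z hz).commute hP z.open_target hw) ?_
  have h1 := fderiv_idempotent hS (x := ((0 : ℝ), z x)) ⟨mem_univ _, hw⟩
    (((contDiffOn_prod_comp_symm hΨ.smooth hz).contDiffAt (hS.mem_nhds ⟨mem_univ _, hw⟩)).differentiableAt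
      (by simp)) (fun y _ => isStarProjection_starProjection.isIdempotentElem) (1, 0)
  have h0 : proj (Ψ 0) (z.symm (z x)) = (proj ψ ∘ z.symm) (z x) := by rw [hΨ.at_zero]; rfl
  simp only [h0] at h1
  exact h1

end Equation

section EulerLagrange

theorem setIntegral_bump_mul_neg {w₀ : ℂ} (χ : ContDiffBump w₀) {f : ℂ → ℝ}
    (hf : ContinuousOn f (Metric.closedBall w₀ χ.rOut))
    (hneg : ∀ w ∈ Metric.closedBall w₀ χ.rOut, f w < 0) :
    ∫ w in Metric.closedBall w₀ χ.rOut, χ w * f w < 0 := by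
  have hi : IntegrableOn (fun w => -(χ w * f w)) (Metric.closedBall w₀ χ.rOut) :=
    (((χ.contDiff (n := 0)).continuous.continuousOn.mul hf).neg).integrableOn_compact
      (isCompact_closedBall _ _)
  have hnn : 0 ≤ᵐ[volume.restrict (Metric.closedBall w₀ χ.rOut)] fun w => -(χ w * f w) :=
    (ae_restrict_iff' measurableSet_closedBall).2 (.of_forall fun w hw =>
      neg_nonneg.2 (mul_nonpos_of_nonneg_of_nonpos χ.nonneg (hneg w hw).le))
  have h := (setIntegral_pos_iff_support_of_nonneg_ae hnn hi).2 ?_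
  · rw [integral_neg] at h
    linarith
  · refine (Metric.isOpen_ball.measure_pos volume (Metric.nonempty_ball.2 χ.rOut_pos)).trans_le
      (measure_mono (t := Function.support (fun w => -(χ w * f w)) ∩ Metric.closedBall w₀ χ.rOut)
        fun w hw => ⟨?_, Metric.ball_subset_closedBall hw⟩)
    exact neg_ne_zero.2 (mul_ne_zero (χ.pos_of_mem_ball hw).ne'
      (hneg w (Metric.ball_subset_closedBall hw)).ne)

theorem clm_mul_smul {A : Type*} [NormedRing A] [NormedAlgebra ℝ A] (T : A →L[ℝ] ℝ) (a b : A)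
    (c : ℝ) : T (a * c • b) = c * T (a * b) := by
  simp

theorem traceRe_mul_commutator {n : ℕ} (l b p : EndCn n) :
    traceRe n (l * (b * p - p * b)) = traceRe n ((p * l - l * p) * b) := by
  rw [mul_sub, sub_mul, map_sub, map_sub, ← mul_assoc, traceRe_mul_comm (l * b), ← mul_assoc,
    ← mul_assoc]

variable {M : Type*} [TopologicalSpace M] {n m : ℕ}
  {ψ : M → Submodule ℂ (Cn n)}

open Classical in
/-- The variation `u(s χ) ψ` of `ψ`, for a one-parameter family `u` of unitary maps, and a
function `χ` on the domain of the coordinate `z`. -/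
def rotation (z : OpenPartialHomeomorph M ℂ) (χ : ℂ → ℝ) (u : ℝ → EndCn n)
    (ψ : M → Submodule ℂ (Cn n)) (s : ℝ) (x : M) : Submodule ℂ (Cn n) :=
  if x ∈ z.source then (ψ x).map (u (s * χ (z x)) : Cn n →ₗ[ℂ] Cn n) else ψ x

variable {z : OpenPartialHomeomorph M ℂ} {χ : ℂ → ℝ} {u : ℝ → EndCn n}

theorem rotation_eq_of_eq_zero (h0 : u 0 = 1) {x : M} (hx : x ∈ z.source → χ (z x) = 0) (s : ℝ) :
    rotation z χ u ψ s x = ψ x := by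
  unfold rotation
  split_ifs with h
  · rw [hx h, mul_zero, h0]
    exact Submodule.map_id _
  · rfl

theorem proj_rotation (hu : ∀ s, star (u s) * u s = 1) (s : ℝ) {w : ℂ} (hw : w ∈ z.target) :
    proj (rotation z χ u ψ s) (z.symm w) =
      u (s * χ w) * proj ψ (z.symm w) * star (u (s * χ w)) := by
  have h : rotation z χ u ψ s (z.symm w) =
      (ψ (z.symm w)).map (u (s * χ w) : Cn n →ₗ[ℂ] Cn n) := by
    unfold rotation
    rw [if_pos (z.map_target hw), z.right_inv hw]
  unfold proj
  simp only [h]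
  exact starProjection_map_unitary (hu _) _

variable [ChartedSpace ℂ M] [IsManifold 𝓘(ℂ) ω M]

theorem isVariation_rotation [T2Space M] (hψ : IsSmoothMap m ψ) (hz : z ∈ coordinates M) (h0 : u 0 = 1)
    (hu : ∀ s, star (u s) * u s = 1) (hus : ContDiff ℝ ∞ u) (hχ : ContDiff ℝ ∞ χ) {K : Set ℂ}
    (hK : IsCompact K) (hKz : K ⊆ z.target) (hχK : ∀ w ∉ K, χ w = 0) :
    IsVariation m ψ (z.symm '' K) (rotation z χ u ψ) := by
  have hKc : IsCompact (z.symm '' K) := hK.image_of_continuousOn (z.continuousOn_symm.mono hKz)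
  have hfix : ∀ s, ∀ x ∉ z.symm '' K, rotation z χ u ψ s x = ψ x := fun s x hx =>
    rotation_eq_of_eq_zero h0 (fun hxs => hχK _ fun h => hx ⟨_, h, z.left_inv hxs⟩) s
  refine ⟨fun s x => ?_, contMDiff_prod_of_coordinates fun x => ?_, ?_, hfix⟩
  · rw [← hψ.finrank_eq x]
    by_cases h : x ∈ z.source
    · have e : rotation z χ u ψ s x = _ := if_pos h
      rw [e]
      exact finrank_map_unitary (hu _) _
    · have e : rotation z χ u ψ s x = _ := if_neg h
      rw [e]
  · by_cases hx : x ∈ z.source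
    · refine ⟨z, hz, hx, z.target, z.open_target.mem_nhds (z.map_source hx), ?_⟩
      have h1 : ContDiffOn ℝ ∞ (fun q : ℝ × ℂ => proj ψ (z.symm q.2)) (univ ×ˢ z.target) :=
        (hψ.isSmoothProjection hz).smooth.comp contDiff_snd.contDiffOn fun q hq => hq.2
      have h2 : ContDiff ℝ ∞ (fun q : ℝ × ℂ => u (q.1 * χ q.2)) :=
        hus.comp (contDiff_fst.mul (hχ.comp contDiff_snd))
      have h3 : ContDiff ℝ ∞ (fun q : ℝ × ℂ => star (u (q.1 * χ q.2))) :=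
        (starL' ℝ : EndCn n ≃L[ℝ] EndCn n).contDiff.comp h2
      exact ((h2.contDiffOn.mul h1).mul h3.contDiffOn).congr fun q hq => proj_rotation hu _ hq.2
    -- Outside the coordinate domain the family is locally constant in s: the image of `K` is
    -- compact, hence closed in the Hausdorff surface, and nothing moves on its open complement.
    · have hxK : x ∈ (z.symm '' K)ᶜ := by
        rintro ⟨w, hw, rfl⟩
        exact hx (z.map_target (hKz hw))
      set c := chartAt ℂ x
      refine ⟨c, chartAt_mem_coordinates x, mem_chart_source ℂ x,
        c.target ∩ c.symm ⁻¹' (z.symm '' K)ᶜ, ?_, ?_⟩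
      · exact (c.isOpen_inter_preimage_symm hKc.isClosed.isOpen_compl).mem_nhds
          ⟨c.map_source (mem_chart_source ℂ x), by
            rw [mem_preimage, c.left_inv (mem_chart_source ℂ x)]; exact hxK⟩
      · have h1 : ContDiffOn ℝ ∞ (fun q : ℝ × ℂ => proj ψ (c.symm q.2)) (univ ×ˢ c.target) :=
          (hψ.isSmoothProjection (chartAt_mem_coordinates x)).smooth.comp contDiff_snd.contDiffOn
            fun q hq => hq.2
        refine (h1.mono (prod_mono le_rfl inter_subset_left)).congr fun q hq => ?_
        simp only [proj, hfix _ _ hq.2.2]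
  · ext1 x
    unfold rotation
    split_ifs
    · rw [zero_mul, h0]
      exact Submodule.map_id _
    · rfl

theorem fderiv_rotation (hz : z ∈ coordinates M) {K : Set M}
    (hv : IsVariation m ψ K (rotation z χ u ψ)) (h0 : u 0 = 1) (hu : ∀ s, star (u s) * u s = 1)
    {B : EndCn n} (hd : HasDerivAt u B 0) (hB : star B = -B) {w : ℂ} (hw : w ∈ z.target) :
    fderiv ℝ (fun q : ℝ × ℂ => proj (rotation z χ u ψ q.1) (z.symm q.2)) (0, w) (1, 0) =
      χ w • (B * proj ψ (z.symm w) - proj ψ (z.symm w) * B) := by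
  have h1 := ((contDiffOn_prod_comp_symm hv.smooth hz).contDiffAt
    ((isOpen_univ.prod z.open_target).mem_nhds (x := ((0 : ℝ), w)) ⟨mem_univ _, hw⟩)).differentiableAt
      (by simp) |>.hasFDerivAt
  have h2 := h1.comp_hasDerivAt (0 : ℝ) ((hasDerivAt_id (0 : ℝ)).prodMk (hasDerivAt_const (0 : ℝ) w))
  refine h2.unique ((hasDerivAt_conj_endCn hd h0 hB _ _).congr_of_eventuallyEq (.of_forall fun s => ?_))
  exact proj_rotation hu s hw

/-- If the skew-adjoint commutator `B` of P and ΔP were nonzero at `w₀`, rotating ψ by exp(sχB),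
with χ a bump function at `w₀`, would change the energy to first order. -/
theorem IsHarmonic.equation [T2Space M] (hh : IsHarmonic m ψ) (hz : z ∈ coordinates M) :
    HarmonicEquation (proj ψ ∘ z.symm) z.target := by
  have hP := hh.toIsSmoothMap.isSmoothProjection hz
  set P := proj ψ ∘ z.symm with hPdef
  refine harmonicEquation_of_commute hP z.open_target fun w₀ hw₀ => ?_
  by_contra hC
  have hB := star_commutator hP z.open_target hw₀
  set B := P w₀ * laplacian P w₀ - laplacian P w₀ * P w₀ with hBdef
  obtain ⟨u, hus, h0, hu, hd⟩ := exists_unitary_family_endCn n B hB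
  set f : ℂ → ℝ := fun w => traceRe n (laplacian P w * (B * P w - P w * B)) with hf
  have hfc : ContinuousOn f z.target := by
    have h1 := (contDiffOn_laplacian z.open_target hP.smooth).continuousOn
    have h2 := hP.smooth.continuousOn
    exact (traceRe n).continuous.comp_continuousOn (h1.mul ((continuousOn_const.mul h2).sub
      (h2.mul continuousOn_const)))
  -- By cyclicity of the trace the value is tr(B²), which is -‖B‖² in the Hilbert–Schmidt norm
  -- because `B` is skew-adjoint.
  have hf0 : f w₀ < 0 := by
    have h1 := hsNormSq_pos hC
    rw [hsNormSq_eq, hB] at h1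
    have h2 : f w₀ = traceRe n (B * B) := traceRe_mul_commutator _ _ _
    rw [show (-B) * B = -(B * B) from neg_mul B B, map_neg] at h1
    linarith
  obtain ⟨ε, hε, hball⟩ := Metric.nhds_basis_closedBall.mem_iff.1
    (inter_mem (z.open_target.mem_nhds hw₀)
      ((hfc.continuousAt (z.open_target.mem_nhds hw₀)).preimage_mem_nhds (Iio_mem_nhds hf0)))
  let χ : ContDiffBump w₀ := ⟨ε / 2, ε, half_pos hε, half_lt_self hε⟩
  have hsub : Metric.closedBall w₀ ε ⊆ z.target := fun w hw => (hball hw).1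
  have hv := isVariation_rotation hh.toIsSmoothMap hz h0 hu hus χ.contDiff
    (isCompact_closedBall w₀ ε) hsub fun w hw => by
      by_contra h
      have h2 : w ∈ Function.support χ := h
      rw [χ.support_eq] at h2
      exact hw (Metric.ball_subset_closedBall h2)
  have hKc : IsCompact (z.symm '' Metric.closedBall w₀ ε) :=
    (isCompact_closedBall w₀ ε).image_of_continuousOn (z.continuousOn_symm.mono hsub)
  have hKz : z.symm '' Metric.closedBall w₀ ε ⊆ z.source :=
    image_subset_iff.2 fun w hw => z.map_target (hsub hw)
  have h1 := (hasDerivAt_energy_variation hz hKc hKz hv).unique (hh.critical z hz _ hKc hKz _ hv)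
  have himg : z '' (z.symm '' Metric.closedBall w₀ ε) = Metric.closedBall w₀ ε := by
    rw [image_image]
    exact (image_congr fun w hw => z.right_inv (hsub hw)).trans (image_id _)
  rw [himg, neg_eq_zero, setIntegral_congr_fun (g := fun w => χ w * f w)
    measurableSet_closedBall] at h1
  · exact (setIntegral_bump_mul_neg χ (hfc.mono hsub) fun w hw => (hball hw).2).ne h1
  · intro w hw
    have h2 := fderiv_rotation hz hv h0 hu hd hB (hsub hw)
    simp only [h2]
    exact clm_mul_smul (A := EndCn n) (traceRe n) _ _ _

end EulerLagrange

/-! ### Coordinate changes, rank, and the second fundamental form in a chart. -/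

section ChainRule

/-- The derivative of a holomorphic change of variable is complex linear, so no ∂̄ of g appears.
Hence A' only gets rescaled, and its image is intrinsic. -/
theorem dz_comp_holomorphic {F : Type*} [NormedAddCommGroup F] [NormedSpace ℝ F] [NormedSpace ℂ F]
    [IsScalarTower ℝ ℂ F] {g : ℂ → F} {τ : ℂ → ℂ} {w c : ℂ} (hg : DifferentiableAt ℝ g (τ w))
    (hτ : HasDerivAt τ c w) : dz (g ∘ τ) w = c • dz g (τ w) := by
  have h : ∀ e : ℂ, fderiv ℝ (g ∘ τ) w e = fderiv ℝ g (τ w) (e * c) := fun e => by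
    have h1 := hg.hasFDerivAt.comp w (hτ.hasFDerivAt.restrictScalars ℝ)
    rw [h1.fderiv]
    simp
  have h2 : ∀ e : ℂ, fderiv ℝ g (τ w) e =
      (e.re : ℂ) • fderiv ℝ g (τ w) 1 + (e.im : ℂ) • fderiv ℝ g (τ w) Complex.I := fun e => by
    conv_lhs => rw [show e = e.re • (1 : ℂ) + e.im • Complex.I by simp [Complex.re_add_im]]
    rw [map_add, map_smul, map_smul]
    exact congrArg₂ _ (algebraMap_smul ℂ _ _).symm (algebraMap_smul ℂ _ _).symm
  simp only [dz, partialRe, partialIm, h, one_mul]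
  rw [h2 c, h2 (Complex.I * c)]
  generalize fderiv ℝ g (τ w) 1 = a
  generalize fderiv ℝ g (τ w) Complex.I = b
  nth_rw 5 [← Complex.re_add_im c]
  simp only [Complex.mul_re, Complex.mul_im, Complex.I_re, Complex.I_im]
  match_scalars
  · ring
  · linear_combination (1 / 2 * (c.im : ℂ)) * Complex.I_sq

end ChainRule

section Rank

variable {n : ℕ}

theorem traceRe_starProjection (V : Submodule ℂ (Cn n)) :
    traceRe n V.starProjection = Module.finrank ℂ V := by
  have h : LinearMap.IsProj V (V.starProjection : Cn n →ₗ[ℂ] Cn n) :=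
    ⟨fun x => Submodule.starProjection_apply_mem V x,
      fun x hx => Submodule.starProjection_eq_self_iff.2 hx⟩
  rw [traceRe_apply, h.trace]
  simp

theorem starProjection_injective :
    Function.Injective (fun V : Submodule ℂ (Cn n) => V.starProjection) := fun V W h => by
  have := congrArg (fun T : EndCn n => T.range) h
  simpa using this

variable {M : Type*} [TopologicalSpace M] [ConnectedSpace M] [ChartedSpace ℂ M]

/-- The rank of a smooth subbundle is constant. -/
theorem exists_isSmoothMap {γ : M → Submodule ℂ (Cn n)}
    (hγ : ContMDiff 𝓘(ℝ, ℂ) 𝓘(ℝ, EndCn n) ∞ (proj γ)) : ∃ k, IsSmoothMap k γ := by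
  -- The rank is the trace of the projection, so it depends continuously on the point; being
  -- integer-valued, it is constant on a connected surface.
  have h1 : Continuous fun x => Module.finrank ℂ (γ x) := by
    rw [Nat.isClosedEmbedding_coe_real.isInducing.continuous_iff]
    exact ((traceRe n).continuous.comp hγ.continuous).congr fun x => traceRe_starProjection _
  obtain ⟨x₀⟩ := (inferInstance : Nonempty M)
  exact ⟨Module.finrank ℂ (γ x₀), fun x => PreconnectedSpace.constant inferInstance h1, hγ⟩

end Rank

section SecondFF

variable {M : Type*} [TopologicalSpace M] {n : ℕ} {ψ : M → Submodule ℂ (Cn n)}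
  {z : OpenPartialHomeomorph M ℂ} {x : M}

theorem secondFF_eq (hψ : DifferentiableAt ℝ (proj ψ ∘ z.symm) (z x)) (v : Cn n) :
    secondFF z ψ x v = ((1 - proj ψ x) * dz (proj ψ ∘ z.symm) (z x)) v := by
  have h : projPerp ψ x = 1 - proj ψ x := Submodule.starProjection_orthogonal' _
  rw [secondFF, h]
  exact congrArg _ (dz_clm_apply hψ v)

/-- Since P(∂P)P = 0, the map (∂P)P already takes values in the orthogonal complement, and no
further projection is needed. -/
theorem secondFFImage_eq (hψ : IsSmoothProjection (proj ψ ∘ z.symm) z.target) (hx : x ∈ z.source) :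
    secondFFImage z ψ x =
      (dz (proj ψ ∘ z.symm) (z x) * (proj ψ ∘ z.symm) (z x)).range := by
  have hw := z.map_source hx
  have hP : (proj ψ ∘ z.symm) (z x) = proj ψ x := congrArg (proj ψ) (z.left_inv hx)
  have h1 := hψ.mul_dz_mul z.open_target hw
  rw [hP] at h1 ⊢
  set D := dz (proj ψ ∘ z.symm) (z x)
  have h2 : ∀ v, proj ψ x v = v → secondFF z ψ x v = (D * proj ψ x) v := fun v hv => by
    rw [secondFF_eq (hψ.differentiableAt z.open_target hw)]
    have h3 : (proj ψ x * D * proj ψ x) v = 0 := by rw [h1]; rfl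
    have h4 : proj ψ x (D (proj ψ x v)) = 0 := h3
    change D v - proj ψ x (D v) = D (proj ψ x v)
    rw [hv] at h4 ⊢
    rw [h4, sub_zero]
  have h5 : ∀ v, v ∈ ψ x ↔ proj ψ x v = v := fun v => Submodule.starProjection_eq_self_iff.symm
  ext y
  constructor
  · rintro ⟨v, hv, rfl⟩
    exact ⟨v, (h2 v ((h5 v).1 hv)).symm⟩
  · rintro ⟨v, rfl⟩
    refine ⟨proj ψ x v, Submodule.starProjection_apply_mem _ _, ?_⟩
    have h6 : proj ψ x (proj ψ x v) = proj ψ x v :=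
      Submodule.starProjection_eq_self_iff.2 (Submodule.starProjection_apply_mem _ _)
    rw [h2 _ h6]
    exact congrArg D h6

variable [ChartedSpace ℂ M]

theorem hasDerivAt_transition {z' : OpenPartialHomeomorph M ℂ} (hz : z ∈ coordinates M)
    (hz' : z' ∈ coordinates M) (hx : x ∈ z.source) (hx' : x ∈ z'.source) :
    HasDerivAt (z' ∘ z.symm) (deriv (z' ∘ z.symm) (z x)) (z x) := by
  have h : z x ∈ (z.symm ≫ₕ z').source := by
    rw [OpenPartialHomeomorph.trans_source]
    exact ⟨z.map_source hx, by rw [mem_preimage, z.left_inv hx]; exact hx'⟩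
  exact (((contDiffOn_transition hz hz').contDiffAt
    ((z.symm ≫ₕ z').open_source.mem_nhds h)).differentiableAt (by simp)).hasDerivAt

theorem dz_comp_symm {F : Type*} [NormedAddCommGroup F] [NormedSpace ℝ F] [NormedSpace ℂ F]
    [IsScalarTower ℝ ℂ F] {f : M → F} {z' : OpenPartialHomeomorph M ℂ} (hz : z ∈ coordinates M)
    (hz' : z' ∈ coordinates M) (hx : x ∈ z.source) (hx' : x ∈ z'.source)
    (hf : DifferentiableAt ℝ (f ∘ z'.symm) (z' x)) :
    dz (f ∘ z.symm) (z x) = deriv (z' ∘ z.symm) (z x) • dz (f ∘ z'.symm) (z' x) := by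
  have e : (z' ∘ z.symm) (z x) = z' x := congrArg z' (z.left_inv hx)
  have h := dz_comp_holomorphic (g := f ∘ z'.symm) (by rwa [e]) (hasDerivAt_transition hz hz' hx hx')
  rw [e] at h
  rw [← h]
  refine dz_congr ?_
  have h1 : z.symm ⁻¹' z'.source ∈ 𝓝 (z x) :=
    (z.continuousAt_symm (z.map_source hx)).preimage_mem_nhds
      (by rw [z.left_inv hx]; exact z'.open_source.mem_nhds hx')
  filter_upwards [h1] with w hw
  exact (congrArg f (z'.left_inv hw)).symm

variable [IsManifold 𝓘(ℂ) ω M]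

/-- The image of the second fundamental form does not depend on the local coordinate. -/
theorem range_dz_mul_eq {m : ℕ} (hψ : IsSmoothMap m ψ) {z' : OpenPartialHomeomorph M ℂ}
    (hz : z ∈ coordinates M) (hz' : z' ∈ coordinates M) (hx : x ∈ z.source) (hx' : x ∈ z'.source) :
    (dz (proj ψ ∘ z.symm) (z x) * (proj ψ ∘ z.symm) (z x)).range =
      (dz (proj ψ ∘ z'.symm) (z' x) * (proj ψ ∘ z'.symm) (z' x)).range := by
  have key : ∀ z z' : OpenPartialHomeomorph M ℂ, z ∈ coordinates M → z' ∈ coordinates M →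
      x ∈ z.source → x ∈ z'.source →
      (dz (proj ψ ∘ z.symm) (z x) * (proj ψ ∘ z.symm) (z x)).range ≤
      (dz (proj ψ ∘ z'.symm) (z' x) * (proj ψ ∘ z'.symm) (z' x)).range := by
    rintro z z' hz hz' hx hx' _ ⟨v, rfl⟩
    have h := dz_comp_symm (f := proj ψ) hz hz' hx hx'
      ((hψ.isSmoothProjection hz').differentiableAt z'.open_target (z'.map_source hx'))
    have e : (proj ψ ∘ z.symm) (z x) = (proj ψ ∘ z'.symm) (z' x) := by
      simp only [Function.comp_apply, z.left_inv hx, z'.left_inv hx']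
    rw [h, e]
    exact Submodule.smul_mem _ _ ⟨v, rfl⟩
  exact le_antisymm (key z z' hz hz' hx hx') (key z' z hz' hz hx' hx)

end SecondFF

/-! ### Gauss bundles: existence, uniqueness by continuity, harmonicity. -/

section Density

variable {M : Type*} [TopologicalSpace M] 

theorem tendsto_symm_nhdsNE (z : OpenPartialHomeomorph M ℂ) {w : ℂ} (hw : w ∈ z.target) :
    Tendsto z.symm (𝓝[≠] w) (𝓝[≠] z.symm w) := by
  refine tendsto_nhdsWithin_iff.2 ⟨(z.continuousAt_symm hw).mono_left nhdsWithin_le_nhds, ?_⟩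
  filter_upwards [self_mem_nhdsWithin, nhdsWithin_le_nhds (z.open_target.mem_nhds hw)] with y hy hyt h
  exact hy (z.symm.injOn hyt hw h)

theorem mem_nhdsNE_of_mem_codiscrete {S : Set M} (hS : S ∈ codiscrete M) (x : M) : S ∈ 𝓝[≠] x := by
  simpa using mem_codiscrete.1 hS x

/-- A surface has no isolated points, so a codiscrete set is dense. Identities known where the Gauss
bundle equals the image of A' thereby extend to the filled-out zeros. -/
theorem eqOn_of_eventually_codiscrete {F : Type*} [TopologicalSpace F] [T2Space F]
    {z : OpenPartialHomeomorph M ℂ} {f g : ℂ → F} (hf : ContinuousOn f z.target)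
    (hg : ContinuousOn g z.target)
    (h : ∀ᶠ x in codiscrete M, x ∈ z.source → f (z x) = g (z x)) {w : ℂ} (hw : w ∈ z.target) :
    f w = g w := by
  have h1 := (tendsto_symm_nhdsNE z hw).eventually (mem_nhdsNE_of_mem_codiscrete h _)
  have h2 : ∀ᶠ y in 𝓝[≠] w, f y = g y := by
    filter_upwards [h1, nhdsWithin_le_nhds (z.open_target.mem_nhds hw)] with y hy hyt
    have := hy (z.map_target hyt)
    rwa [z.right_inv hyt] at this
  exact tendsto_nhds_unique_of_eventuallyEq
    ((hf.continuousAt (z.open_target.mem_nhds hw)).mono_left nhdsWithin_le_nhds)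
    ((hg.continuousAt (z.open_target.mem_nhds hw)).mono_left nhdsWithin_le_nhds) h2

end Density

section Gauss

variable {M : Type*} [TopologicalSpace M] [ChartedSpace ℂ M]
  [IsManifold 𝓘(ℂ) ω M] {n m : ℕ} {ψ γ : M → Submodule ℂ (Cn n)}

theorem mul_eq_zero_of_range_eq {s a p : EndCn n} (h : s * a = 0) (hr : p.range = a.range) :
    s * p = 0 := by
  ext1 v
  obtain ⟨u, hu⟩ : p v ∈ a.range := hr ▸ ⟨v, rfl⟩
  have h1 : (s * a) u = 0 := by rw [h]; rfl
  change s (p v) = 0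
  rw [← hu]
  exact h1

/-- The fibre at x is taken from the local extension centred at x. Off its centre each local
extension is the image of A', which is independent of the coordinate, so the extensions are
compatible. -/
theorem exists_isGaussBundle [T2Space M] [ConnectedSpace M] (hh : IsHarmonic m ψ) : ∃ γ, IsGaussBundle ψ γ := by
  have hs := hh.toIsSmoothMap
  have hc := fun x : M => chartAt_mem_coordinates x
  have hxs := fun x : M => mem_chart_source ℂ x
  have hex := fun x : M => exists_local_gauss (hs.isSmoothProjection (hc x))
    (chartAt ℂ x).open_target (hh.equation (hc x)) ((chartAt ℂ x).map_source (hxs x))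
  choose Γ V hVo hxV hVt hΓ hΓe using hex
  let γ : M → Submodule ℂ (Cn n) := fun x => Γ x (chartAt ℂ x x)
  -- off the centre, `Γ x` is the image of the second fundamental form, in any coordinate
  have himg : ∀ x y : M, y ∈ (chartAt ℂ x).source → chartAt ℂ x y ∈ V x → y ≠ x →
      ∀ z ∈ coordinates M, y ∈ z.source → Γ x (chartAt ℂ x y) =
        (dz (proj ψ ∘ z.symm) (z y) * (proj ψ ∘ z.symm) (z y)).range := by
    intro x y hy hyV hyx z hz hyz
    rw [hΓe x _ hyV fun h => hyx ((chartAt ℂ x).injOn hy (hxs x) h)]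
    exact range_dz_mul_eq hs (hc x) hz hy hyz
  have hnhds : ∀ x y : M, y ∈ (chartAt ℂ x).source → chartAt ℂ x y ∈ V x →
      ∀ᶠ y' in 𝓝 y, y' ∈ (chartAt ℂ x).source ∧ chartAt ℂ x y' ∈ V x := fun x y hy hyV =>
    ((chartAt ℂ x).isOpen_inter_preimage (hVo x)).mem_nhds ⟨hy, hyV⟩
  have hcont : ∀ x y : M, y ∈ (chartAt ℂ x).source → chartAt ℂ x y ∈ V x →
      ContinuousAt (fun y' => (Γ x (chartAt ℂ x y')).starProjection) y := fun x y hy hyV =>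
    ContinuousAt.comp (f := chartAt ℂ x) (g := fun w => (Γ x w).starProjection)
      ((hΓ x).continuousOn.continuousAt ((hVo x).mem_nhds hyV)) ((chartAt ℂ x).continuousAt hy)
  have heq : ∀ x y : M, y ∈ (chartAt ℂ x).source → chartAt ℂ x y ∈ V x →
      γ y = Γ x (chartAt ℂ x y) := by
    intro x y hy hyV
    by_cases hyx : y = x
    · rw [hyx]
    -- Near y, but off the two centres, both sides project onto the image of A'. Both are
    -- continuous, so they also agree at y.
    have h1 : ∀ᶠ y' in 𝓝[≠] y, (Γ y (chartAt ℂ y y')).starProjection =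
        (Γ x (chartAt ℂ x y')).starProjection := by
      filter_upwards [nhdsWithin_le_nhds (hnhds x y hy hyV),
        nhdsWithin_le_nhds (hnhds y y (hxs y) (hxV y)), self_mem_nhdsWithin,
        nhdsWithin_le_nhds (isOpen_ne.mem_nhds hyx)] with y' h1 h2 h3 h4
      rw [himg x y' h1.1 h1.2 h4 _ (hc y) h2.1, himg y y' h2.1 h2.2 h3 _ (hc y) h2.1]
    have h2 : (𝓝[≠] y).NeBot := by
      have := tendsto_symm_nhdsNE (chartAt ℂ y) ((chartAt ℂ y).map_source (hxs y))
      rw [(chartAt ℂ y).left_inv (hxs y)] at this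
      exact this.neBot
    exact starProjection_injective (tendsto_nhds_unique_of_eventuallyEq
      ((hcont y y (hxs y) (hxV y)).mono_left nhdsWithin_le_nhds)
      ((hcont x y hy hyV).mono_left nhdsWithin_le_nhds) h1)
  refine ⟨γ, exists_isSmoothMap (contMDiff_of_coordinates fun x =>
    ⟨chartAt ℂ x, hc x, hxs x, ?_⟩), ?_⟩
  · refine ((hΓ x).contDiffAt ((hVo x).mem_nhds (hxV x))).congr_of_eventuallyEq ?_
    filter_upwards [(hVo x).mem_nhds (hxV x)] with w hw
    have hwt := hVt x hw
    have h1 := heq x _ ((chartAt ℂ x).map_target hwt) (by rwa [(chartAt ℂ x).right_inv hwt])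
    rw [(chartAt ℂ x).right_inv hwt] at h1
    exact congrArg (fun W : Submodule ℂ (Cn n) => W.starProjection) h1
  · refine mem_codiscrete.2 fun x => ?_
    rw [disjoint_principal_right, compl_compl]
    filter_upwards [nhdsWithin_le_nhds (hnhds x x (hxs x) (hxV x)), self_mem_nhdsWithin]
      with y hy hyx z hz hyz
    rw [secondFFImage_eq (hs.isSmoothProjection hz) hyz, heq x y hy.1 hy.2,
      himg x y hy.1 hy.2 hyx z hz hyz]

variable {z : OpenPartialHomeomorph M ℂ} {w : ℂ}

theorem IsGaussBundle.eventually_range (hγ : IsGaussBundle ψ γ) (hψ : IsSmoothMap m ψ)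
    (hz : z ∈ coordinates M) : ∀ᶠ x in codiscrete M, x ∈ z.source →
      γ x = (dz (proj ψ ∘ z.symm) (z x) * (proj ψ ∘ z.symm) (z x)).range := by
  filter_upwards [hγ.2] with x hx hxz
  have h := hx z hz hxz
  rw [secondFFImage_eq (hψ.isSmoothProjection hz) hxz] at h
  exact SetLike.coe_injective h

/-- An endomorphism that annihilates the second fundamental form annihilates the Gauss bundle. -/
theorem IsGaussBundle.mul_proj_eq_zero (hγ : IsGaussBundle ψ γ) (hψ : IsSmoothMap m ψ)
    (hz : z ∈ coordinates M) {S : ℂ → EndCn n} (hS : ContinuousOn S z.target)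
    (h : ∀ w ∈ z.target, S w * (dz (proj ψ ∘ z.symm) w * (proj ψ ∘ z.symm) w) = 0)
    (hw : w ∈ z.target) : S w * (proj γ ∘ z.symm) w = 0 := by
  obtain ⟨k, hk⟩ := hγ.1
  refine eqOn_of_eventually_codiscrete (f := fun w => S w * (proj γ ∘ z.symm) w)
    (g := fun _ => 0) (hS.mul (hk.isSmoothProjection hz).smooth.continuousOn) continuousOn_const ?_ hw
  filter_upwards [hγ.eventually_range hψ hz] with x hx hxz
  refine mul_eq_zero_of_range_eq (h _ (z.map_source hxz)) ?_
  rw [← hx hxz]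
  refine (Submodule.range_starProjection _).trans ?_
  rw [z.left_inv hxz]

/-- The Gauss bundle contains the image of the second fundamental form. -/
theorem IsGaussBundle.proj_mul (hγ : IsGaussBundle ψ γ) (hψ : IsSmoothMap m ψ)
    (hz : z ∈ coordinates M) (hw : w ∈ z.target) :
    (proj γ ∘ z.symm) w * (dz (proj ψ ∘ z.symm) w * (proj ψ ∘ z.symm) w) =
      dz (proj ψ ∘ z.symm) w * (proj ψ ∘ z.symm) w := by
  obtain ⟨k, hk⟩ := hγ.1
  have hP := hψ.isSmoothProjection hz
  have hA : ContinuousOn (fun w => dz (proj ψ ∘ z.symm) w * (proj ψ ∘ z.symm) w) z.target :=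
    (contDiffOn_dz z.open_target hP.smooth).continuousOn.mul hP.smooth.continuousOn
  refine eqOn_of_eventually_codiscrete
    (f := fun w => (proj γ ∘ z.symm) w * (dz (proj ψ ∘ z.symm) w * (proj ψ ∘ z.symm) w))
    ((hk.isSmoothProjection hz).smooth.continuousOn.mul hA) hA ?_ hw
  filter_upwards [hγ.eventually_range hψ hz] with x hx hxz
  ext1 v
  refine Submodule.starProjection_eq_self_iff.2 ?_
  rw [z.left_inv hxz, hx hxz]
  exact ⟨v, rfl⟩

end Gauss

section Chart

theorem star_one_sub_sub {R : Type*} [Ring R] [StarRing R] (p q : R) :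
    star (1 - p - q) = 1 - star p - star q := by
  simp

variable {n : ℕ} {P Q : ℂ → EndCn n} {U : Set ℂ}

theorem isSmoothProjection_rest (hP : IsSmoothProjection P U) (hQ : IsSmoothProjection Q U)
    (hPQ : ∀ w ∈ U, P w * Q w = 0) : IsSmoothProjection (fun w => 1 - P w - Q w) U := by
  refine ⟨(contDiffOn_const.sub hP.smooth).sub hQ.smooth, fun w hw => ?_⟩
  have h1 := hPQ w hw
  have h2 := hP.mul_eq_zero_symm hw hPQ hQ
  refine ⟨?_, ?_⟩
  · have := hP.mul_self hw
    have := hQ.mul_self hw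
    simp only [IsIdempotentElem, sub_mul, mul_sub, one_mul, mul_one, *]
    abel
  · have e : star (1 - P w - Q w) = 1 - star (P w) - star (Q w) := star_one_sub_sub _ _
    rw [IsSelfAdjoint, e, hP.star_eq hw, hQ.star_eq hw]

end Chart

section Algebra

variable {R : Type*} [Ring R]

/-- Here primes denote ∂̄ and `a` is the second fundamental form of `q`. Differentiating ra = 0 and
inserting ∂̄a = a(∂̄q) - (∂̄q)a leaves r(∂̄q)a, which vanishes because ∂̄q is off-diagonal while `r`
and `a` both live on the complement of `q`. -/
theorem mul_dbar_mul_of_secondFF {r q r' q' a a' : R} (ha : a = (1 - q) * a) (hra : r * a = 0)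
    (hrq : r * q = 0) (hqr : (1 - q) * q' * (1 - q) = 0) (hd : r' * a + r * a' = 0)
    (ha' : a' = a * q' - q' * a) : r' * a = 0 := by
  have h1 : r * q' * a = 0 := by
    have h2 : r * (1 - q) = r := by rw [mul_sub, hrq, sub_zero, mul_one]
    calc r * q' * a = (r * (1 - q)) * q' * ((1 - q) * a) := by rw [h2, ← ha]
      _ = r * ((1 - q) * q' * (1 - q)) * a := by noncomm_ring
      _ = 0 := by rw [hqr, mul_zero, zero_mul]
  rw [ha', mul_sub, ← mul_assoc, hra, zero_mul, ← mul_assoc, h1, sub_zero, add_zero] at hd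
  exact hd

theorem mul_neg_mul_eq (p l r : R) : p * -l * r = -(p * l * r) := by
  simp

theorem reflection_inverse {p : R} (hp : p * p = p) : (p - (1 - p)) * (p - (1 - p)) = 1 := by
  simp only [sub_mul, mul_sub, one_mul, mul_one, hp]
  abel

/-- The reflection φ = 2p - 1 is an involution and anticommutes with d, so (φd)² = -φ²d² = -d². -/
theorem reflection_mul_sq {A : Type*} [Ring A] [Algebra ℂ A] {p d : A} (hp : p * p = p)
    (hd : d * p + p * d = d) :
    ((1 / 2 : ℂ) • (Ring.inverse (p - (1 - p)) * (d - -d))) ^ 2 = -(d * d) := by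
  have h1 := reflection_inverse hp
  have h2 : Ring.inverse (p - (1 - p)) = p - (1 - p) :=
    Ring.inverse_unit (⟨_, _, h1, h1⟩ : Aˣ)
  have h3 : (p - (1 - p)) * d = -(d * (p - (1 - p))) := by
    simp only [sub_mul, mul_sub, one_mul, mul_one, eq_sub_of_add_eq' hd]
    abel
  have h4 : d - -d = (2 : ℂ) • d := by rw [two_smul]; abel
  rw [h2, h4, mul_smul_comm, smul_smul, sq]
  norm_num
  calc (p - (1 - p)) * d * ((p - (1 - p)) * d)
      = -(d * ((p - (1 - p)) * (p - (1 - p))) * d) := by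
        refine (congrArg (· * ((p - (1 - p)) * d)) h3).trans ?_
        simp only [neg_mul, mul_assoc]
    _ = -(d * d) := by rw [h1, mul_one]

end Algebra

section Gauss

variable {M : Type*} [TopologicalSpace M] [ChartedSpace ℂ M]
  [IsManifold 𝓘(ℂ) ω M] {n m : ℕ} {ψ γ : M → Submodule ℂ (Cn n)}
  {z : OpenPartialHomeomorph M ℂ} {w : ℂ}

theorem IsGaussBundle.orthogonal (hγ : IsGaussBundle ψ γ) (hψ : IsSmoothMap m ψ)
    (hz : z ∈ coordinates M) (hw : w ∈ z.target) :
    (proj ψ ∘ z.symm) w * (proj γ ∘ z.symm) w = 0 :=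
  hγ.mul_proj_eq_zero hψ hz (hψ.isSmoothProjection hz).smooth.continuousOn
    (fun w hw => by
      rw [← mul_assoc]; exact (hψ.isSmoothProjection hz).mul_dz_mul z.open_target hw) hw

theorem IsGaussBundle.orthogonal' (hγ : IsGaussBundle ψ γ) (hψ : IsSmoothMap m ψ)
    (hz : z ∈ coordinates M) (hw : w ∈ z.target) :
    (proj γ ∘ z.symm) w * (proj ψ ∘ z.symm) w = 0 :=
  have ⟨_, hk⟩ := hγ.1
  (hψ.isSmoothProjection hz).mul_eq_zero_symm hw (fun _ hy => hγ.orthogonal hψ hz hy)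
    (hk.isSmoothProjection hz)

/-- The complement of `ψ ⊕ G(ψ)`, in a local coordinate. -/
theorem IsGaussBundle.isSmoothProjection_rest (hγ : IsGaussBundle ψ γ) (hψ : IsSmoothMap m ψ)
    (hz : z ∈ coordinates M) : IsSmoothProjection
      (fun w => 1 - (proj γ ∘ z.symm) w - (proj ψ ∘ z.symm) w) z.target :=
  have ⟨_, hk⟩ := hγ.1
  HarmonicGrassmann.isSmoothProjection_rest (hk.isSmoothProjection hz) (hψ.isSmoothProjection hz)
    fun _ hy => hγ.orthogonal' hψ hz hy

theorem IsGaussBundle.rest_mul_dz_mul (hγ : IsGaussBundle ψ γ) (hψ : IsSmoothMap m ψ)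
    (hz : z ∈ coordinates M) (hw : w ∈ z.target) :
    (1 - (proj γ ∘ z.symm) w - (proj ψ ∘ z.symm) w) *
      (dz (proj ψ ∘ z.symm) w * (proj ψ ∘ z.symm) w) = 0 := by
  rw [sub_mul, sub_mul, one_mul, hγ.proj_mul hψ hz hw, sub_self, zero_sub, ← mul_assoc,
    (hψ.isSmoothProjection hz).mul_dz_mul z.open_target hw]
  exact neg_zero

/-- This is ∂̄-closedness of the Gauss bundle modulo ψ. It holds on the image of A' by the
∂̄-equation for the second fundamental form, and extends to all of γ by continuity. -/
theorem IsGaussBundle.dbar_rest_mul [T2Space M] (hγ : IsGaussBundle ψ γ) (hh : IsHarmonic m ψ)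
    (hz : z ∈ coordinates M) (hw : w ∈ z.target) :
    dbar (fun w => 1 - (proj γ ∘ z.symm) w - (proj ψ ∘ z.symm) w) w * (proj γ ∘ z.symm) w = 0 := by
  have hψ := hh.toIsSmoothMap
  have hQ := hψ.isSmoothProjection hz
  have hR := hγ.isSmoothProjection_rest hψ hz
  refine hγ.mul_proj_eq_zero hψ hz (contDiffOn_dbar z.open_target hR.smooth).continuousOn
    (fun w hw => ?_) hw
  have hQR : ∀ w ∈ z.target,
      (1 - (proj γ ∘ z.symm) w - (proj ψ ∘ z.symm) w) * (proj ψ ∘ z.symm) w = 0 := fun w hw => by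
    rw [sub_mul, sub_mul, one_mul, hγ.orthogonal' hψ hz hw, hQ.mul_self hw, sub_zero, sub_self]
  have h1 : DifferentiableAt ℝ (fun y => dz (proj ψ ∘ z.symm) y * (proj ψ ∘ z.symm) y) w :=
    (hQ.differentiableAt_dz z.open_target hw).mul (hQ.differentiableAt z.open_target hw)
  refine mul_dbar_mul_of_secondFF ?_ (hγ.rest_mul_dz_mul hψ hz hw) (hQR w hw) ?_ ?_
    ((hh.equation hz).dbar_secondFF hQ z.open_target hw)
  · rw [sub_mul, one_mul, ← mul_assoc, hQ.mul_dz_mul z.open_target hw, sub_zero]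
  · have := hQ.one_sub.mul_dbar_mul z.open_target hw
    rw [dbar_const_sub] at this
    exact neg_eq_zero.1 ((mul_neg_mul_eq _ _ _).symm.trans this)
  · rw [← dbar_mul (hR.differentiableAt z.open_target hw) h1]
    exact dbar_eq_zero_of_eqOn z.open_target (fun y hy => hγ.rest_mul_dz_mul hψ hz hy) hw

theorem IsGaussBundle.rest_mul_dbar_mul [T2Space M] (hγ : IsGaussBundle ψ γ) (hh : IsHarmonic m ψ)
    (hz : z ∈ coordinates M) (hw : w ∈ z.target) :
    (1 - (proj γ ∘ z.symm) w - (proj ψ ∘ z.symm) w) * dbar (proj γ ∘ z.symm) w = 0 := by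
  have hψ := hh.toIsSmoothMap
  obtain ⟨k, hk⟩ := hγ.1
  have hP := hk.isSmoothProjection hz
  have hR := hγ.isSmoothProjection_rest hψ hz
  have h := hR.dbar_mul_add hP z.open_target hw fun w hw => by
    rw [sub_mul, sub_mul, one_mul, hγ.orthogonal hψ hz hw, hP.mul_self hw, sub_self, zero_sub]
    exact neg_zero
  rw [hγ.dbar_rest_mul hh hz hw, zero_add] at h
  exact h

/-- The Gauss bundle of a harmonic map is harmonic. -/
theorem IsGaussBundle.isHarmonic [T2Space M] (hγ : IsGaussBundle ψ γ) (hh : IsHarmonic m ψ) :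
    ∃ k, IsHarmonic k γ := by
  have hψ := hh.toIsSmoothMap
  obtain ⟨k, hk⟩ := hγ.1
  refine ⟨k, isHarmonic_of_equation hk fun z hz => ?_⟩
  have hP := hk.isSmoothProjection hz
  have hQ := hψ.isSmoothProjection hz
  refine HarmonicEquation.gauss hP hQ (hγ.isSmoothProjection_rest hψ hz) z.open_target ?_
    (fun w hw => hγ.orthogonal' hψ hz hw) ?_ ?_ ?_ ?_ (hh.equation hz)
  · intro w _
    abel
  · intro w hw
    rw [mul_sub, mul_sub, mul_one, hγ.orthogonal' hψ hz hw, hP.mul_self hw, sub_self, sub_zero]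
  · intro w hw
    rw [mul_sub, mul_sub, mul_one, hγ.orthogonal hψ hz hw, hQ.mul_self hw, sub_zero, sub_self]
  · intro w hw
    rw [mul_assoc]
    exact hγ.rest_mul_dz_mul hψ hz hw
  · intro w hw
    rw [hγ.rest_mul_dbar_mul hh hz hw, zero_mul]

end Gauss

/-! ### 2-nilconformality and missing arrows as identities of projections. -/

section Conditions

variable {M : Type*} [TopologicalSpace M] [ChartedSpace ℂ M] [IsManifold 𝓘(ℂ) ω M] {n m k : ℕ}
  {ψ χ : M → Submodule ℂ (Cn n)}

theorem isTwoNilconformal_iff (hψ : IsSmoothMap m ψ) : IsTwoNilconformal ψ ↔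
    ∀ z ∈ coordinates M, ∀ w ∈ z.target,
      dz (proj ψ ∘ z.symm) w * dz (proj ψ ∘ z.symm) w = 0 := by
  have key : ∀ z ∈ coordinates M, ∀ x ∈ z.source, Az z (cartan ψ) x ^ 2 =
      -(dz (proj ψ ∘ z.symm) (z x) * dz (proj ψ ∘ z.symm) (z x)) := by
    intro z hz x hx
    have hP := hψ.isSmoothProjection hz
    have hw := z.map_source hx
    have e1 : cartan ψ = fun y => proj ψ y - (1 - proj ψ y) := funext fun y =>
      congrArg (proj ψ y - ·) (Submodule.starProjection_orthogonal' _)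
    have e2 : dzAt z (cartan ψ) x = dz (proj ψ ∘ z.symm) (z x) - -dz (proj ψ ∘ z.symm) (z x) := by
      rw [e1]
      refine (dz_sub (f := proj ψ ∘ z.symm) (g := fun y => 1 - (proj ψ ∘ z.symm) y)
        (hP.differentiableAt z.open_target hw)
        (hP.one_sub.differentiableAt z.open_target hw)).trans ?_
      rw [dz_const_sub]
    have e3 : cartan ψ x = (proj ψ ∘ z.symm) (z x) - (1 - (proj ψ ∘ z.symm) (z x)) := by
      rw [e1, Function.comp_apply, z.left_inv hx]
    rw [Az, e2, e3]
    exact reflection_mul_sq (A := EndCn n) (hP.mul_self hw) (hP.dz_mul_self z.open_target hw)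
  constructor
  · intro h z hz w hw
    have h1 := h z hz _ (z.map_target hw)
    rw [key z hz _ (z.map_target hw), z.right_inv hw] at h1
    exact neg_eq_zero.1 h1
  · intro h z hz x hx
    rw [key z hz x hx, h z hz _ (z.map_source hx)]
    exact neg_zero

theorem componentVanishes_iff (hψ : IsSmoothMap m ψ)
    (horth : ∀ x, proj χ x * proj ψ x = 0) : ComponentVanishes ψ χ ↔
    ∀ z ∈ coordinates M, ∀ w ∈ z.target,
      (proj χ ∘ z.symm) w * dz (proj ψ ∘ z.symm) w * (proj ψ ∘ z.symm) w = 0 := by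
  have key : ∀ z ∈ coordinates M, ∀ x ∈ z.source, ∀ v, proj χ x (secondFF z ψ x v) =
      ((proj χ ∘ z.symm) (z x) * dz (proj ψ ∘ z.symm) (z x)) v := by
    intro z hz x hx v
    rw [secondFF_eq ((hψ.isSmoothProjection hz).differentiableAt z.open_target (z.map_source hx)),
      Function.comp_apply, z.left_inv hx]
    change (proj χ x * ((1 - proj ψ x) * _)) v = _
    rw [← mul_assoc, mul_sub, horth, mul_one, sub_zero]
  constructor
  · intro h z hz w hw
    ext1 v
    have h1 := h z hz _ (z.map_target hw) ((proj ψ ∘ z.symm) w v)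
      (Submodule.starProjection_apply_mem _ _)
    rw [key z hz _ (z.map_target hw), z.right_inv hw] at h1
    exact h1
  · intro h z hz x hx v hv
    have h1 := congrArg (fun T : EndCn n => T v) (h z hz _ (z.map_source hx))
    have h2 : (proj ψ ∘ z.symm) (z x) v = v := by
      rw [Function.comp_apply, z.left_inv hx]
      exact Submodule.starProjection_eq_self_iff.2 hv
    rw [key z hz x hx]
    refine Eq.trans ?_ h1
    change _ = ((proj χ ∘ z.symm) (z x) * dz (proj ψ ∘ z.symm) (z x)) ((proj ψ ∘ z.symm) (z x) v)
    rw [h2]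

end Conditions

/-! ### Orthogonal sums and the vertices of a diagram. -/

section Sup

variable {n : ℕ}

theorem starProjection_mul_eq_zero_iff {V W : Submodule ℂ (Cn n)} :
    (V.starProjection * W.starProjection : EndCn n) = 0 ↔ V ⟂ W :=
  Submodule.starProjection_comp_starProjection_eq_zero_iff

theorem starProjection_sup {V W : Submodule ℂ (Cn n)} (h : V ⟂ W) :
    (V ⊔ W).starProjection = V.starProjection + W.starProjection := by
  ext1 v
  refine (Submodule.eq_starProjection_of_mem_orthogonal
    (Submodule.add_mem_sup (Submodule.starProjection_apply_mem V v)
      (Submodule.starProjection_apply_mem W v)) ?_)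
  rw [← Submodule.inf_orthogonal]
  have hVW := Submodule.isOrtho_iff_le.1 h
  have hWV := Submodule.isOrtho_iff_le.1 h.symm
  constructor
  · have h1 := Submodule.sub_starProjection_mem_orthogonal (K := V) v
    have h2 := hWV (Submodule.starProjection_apply_mem W v)
    have := Submodule.sub_mem _ h1 h2
    rwa [sub_sub] at this
  · have h1 := Submodule.sub_starProjection_mem_orthogonal (K := W) v
    have h2 := hVW (Submodule.starProjection_apply_mem V v)
    have := Submodule.sub_mem _ h1 h2
    rwa [sub_sub, add_comm] at this

/-- If `1` is the sum of the mutually orthogonal projections `p i`, and each of them is annihilated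
by `a` or by `b`, then `a b = 0`. -/
theorem mul_eq_zero_of_iSup {ι : Type*} {V : ι → Submodule ℂ (Cn n)}
    (ho : ∀ i j, i ≠ j → V i ⟂ V j) (hs : ⨆ i, V i = ⊤) {a b : EndCn n}
    (h : ∀ i, a * (V i).starProjection = 0 ∨ (V i).starProjection * b = 0) : a * b = 0 := by
  -- Splitting the vertices into two groups avoids writing 1 as a sum over an index set that may be
  -- infinite.
  let I : Set ι := {i | a * (V i).starProjection = 0}
  let W := ⨆ i ∈ I, V i
  let W' := ⨆ i ∈ Iᶜ, V i
  have h1 : W ⟂ W' := by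
    simp only [W, W', Submodule.isOrtho_iSup_left, Submodule.isOrtho_iSup_right]
    intro i hi j hj
    exact ho j i fun e => hi (e ▸ hj)
  have h2 : W ⊔ W' = ⊤ := by
    rw [eq_top_iff, ← hs]
    refine iSup_le fun i => ?_
    by_cases hi : i ∈ I
    · exact le_sup_of_le_left (le_biSup V hi)
    · exact le_sup_of_le_right (le_biSup V (show i ∈ Iᶜ from hi))
  have h3 : W ≤ LinearMap.ker (a : Cn n →ₗ[ℂ] Cn n) := by
    refine iSup₂_le fun i hi v hv => ?_
    have e : (a * (V i).starProjection) v = 0 := by rw [show _ = _ from hi]; rfl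
    have e2 : a ((V i).starProjection v) = 0 := e
    rw [Submodule.starProjection_eq_self_iff.2 hv] at e2
    exact e2
  have h4 : ∀ u ∈ W', ∀ v, inner ℂ u (b v) = 0 := by
    have h5 : W' ≤ (LinearMap.range (b : Cn n →ₗ[ℂ] Cn n))ᗮ := by
      refine iSup₂_le fun i hi => ?_
      rw [← Submodule.isOrtho_iff_le]
      refine Submodule.IsOrtho.symm ?_
      rw [Submodule.isOrtho_iff_le]
      rintro _ ⟨v, rfl⟩
      have e : ((V i).starProjection * b) v = 0 := by rw [(h i).resolve_left hi]; rfl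
      exact (Submodule.starProjection_apply_eq_zero_iff _).1 e
    exact fun u hu v => (Submodule.mem_orthogonal' _ _).1 (h5 hu) _ ⟨v, rfl⟩
  ext1 v
  obtain ⟨x, hx, y, hy, hxy⟩ := Submodule.mem_sup.1 (h2 ▸ Submodule.mem_top : b v ∈ W ⊔ W')
  have h6 : y = 0 := by
    have e := h4 y hy v
    rw [← hxy, inner_add_right, Submodule.isOrtho_iff_inner_eq.1 h1.symm y hy x hx, zero_add] at e
    exact inner_self_eq_zero.1 e
  have h7 : a x = 0 := h3 hx
  change a (b v) = 0
  rw [← hxy, h6, add_zero, h7]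

end Sup

theorem mul_eq_zero_of_add_eq_zero {R : Type*} [Ring R] {a' b a b' c : R} (h : a' * b + a * b' = 0)
    (hc : b * c = 0) : a * b' * c = 0 := by
  rw [eq_neg_of_add_eq_zero_right h, neg_mul, mul_assoc, hc, mul_zero, neg_zero]

section Diagram

variable {M : Type*} [TopologicalSpace M] [ChartedSpace ℂ M] [IsManifold 𝓘(ℂ) ω M] {n : ℕ}
  {t : ℕ∞} {m : ℕ∞ → ℕ} {ψ : ℕ∞ → M → Submodule ℂ (Cn n)} {z : OpenPartialHomeomorph M ℂ} {w : ℂ}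

/-- The projection onto the `i`-th vertex of a diagram, in the local coordinate `z`. -/
def vertexProj (ψ : ℕ∞ → M → Submodule ℂ (Cn n)) (z : OpenPartialHomeomorph M ℂ) (i : ℕ∞) :
    ℂ → EndCn n := proj (ψ i) ∘ z.symm

namespace IsCyclicHarmonicDiagram

variable (h : IsCyclicHarmonicDiagram t m ψ)
include h

omit [IsManifold 𝓘(ℂ) ω M] in
theorem mul_eq_zero {i j : ℕ∞} (hi : i ≤ t) (hj : j ≤ t) (hij : i ≠ j) (w : ℂ) :
    vertexProj ψ z i w * vertexProj ψ z j w = 0 :=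
  starProjection_mul_eq_zero_iff.2 (h.orthogonal i hi j hj hij _)

omit [IsManifold 𝓘(ℂ) ω M] in
theorem mul_eq_zero_of_forall {a b : EndCn n} (w : ℂ)
    (hab : ∀ i ≤ t, a * vertexProj ψ z i w = 0 ∨ vertexProj ψ z i w * b = 0) : a * b = 0 := by
  refine mul_eq_zero_of_iSup (V := fun i : {i // i ≤ t} => ψ i (z.symm w))
    (fun i j hij => h.orthogonal i i.2 j j.2 (fun e => hij (Subtype.ext e)) _) ?_
    fun i => hab i i.2
  rw [← h.sum_eq (z.symm w)]
  exact iSup_subtype' (f := fun i (_ : i ≤ t) => ψ i (z.symm w)) |>.symm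

omit [IsManifold 𝓘(ℂ) ω M] in
theorem eq_zero_of_mul {a : EndCn n} (w : ℂ) (ha : ∀ i ≤ t, a * vertexProj ψ z i w = 0) : a = 0 := by
  rw [← mul_one a]
  exact h.mul_eq_zero_of_forall w fun i hi => Or.inl (ha i hi)

theorem isSmoothProjection (hz : z ∈ coordinates M) {i : ℕ∞} (hi : i ≤ t) :
    IsSmoothProjection (vertexProj ψ z i) z.target :=
  (h.harmonic i hi).toIsSmoothMap.isSmoothProjection hz

theorem mul_dz_mul (hz : z ∈ coordinates M) {i j : ℕ∞} (hi : i ≤ t) (hj : j ≤ t) (hij : i ≠ j)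
    (ha : ¬Arrow t i j) (hw : w ∈ z.target) :
    vertexProj ψ z j w * dz (vertexProj ψ z i) w * vertexProj ψ z i w = 0 :=
  (componentVanishes_iff (h.harmonic i hi).toIsSmoothMap fun x =>
    starProjection_mul_eq_zero_iff.2 (h.orthogonal j hj i hi hij.symm x)).1
      (h.arrows i hi j hj hij ha) z hz w hw

/-- In the absence of an arrow from `i` to `j`, the derivative of `p j` annihilates `p i`. -/
theorem dz_mul_eq_zero (hz : z ∈ coordinates M) {i j : ℕ∞} (hi : i ≤ t) (hj : j ≤ t) (hij : i ≠ j)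
    (ha : ¬Arrow t i j) (hw : w ∈ z.target) :
    dz (vertexProj ψ z j) w * vertexProj ψ z i w = 0 := by
  have h1 := (h.isSmoothProjection hz hj).dz_mul_add (h.isSmoothProjection hz hi) z.open_target hw
    fun w _ => h.mul_eq_zero hj hi hij.symm w
  have h2 := congrArg (· * vertexProj ψ z i w) h1
  simp only [add_mul, h.mul_dz_mul hz hi hj hij ha hw, mul_assoc,
    (h.isSmoothProjection hz hi).mul_self hw] at h2
  rw [add_zero] at h2
  exact h2.trans (zero_mul _)

/-- Differentiating the product of the orthogonal projections i and j replaces the first two factors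
by -(∂pᵢ)pⱼ, and pⱼ annihilates pₖ. -/
theorem mul_dz_mul_of_ne (hz : z ∈ coordinates M) {i j k : ℕ∞} (hi : i ≤ t) (hj : j ≤ t)
    (hk : k ≤ t) (hij : i ≠ j) (hjk : j ≠ k) (hw : w ∈ z.target) :
    vertexProj ψ z i w * dz (vertexProj ψ z j) w * vertexProj ψ z k w = 0 := by
  have e := (h.isSmoothProjection hz hi).dz_mul_add (h.isSmoothProjection hz hj) z.open_target hw
    fun w _ => h.mul_eq_zero hi hj hij w
  exact mul_eq_zero_of_add_eq_zero e (h.mul_eq_zero hj hk hjk w)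

end IsCyclicHarmonicDiagram
end Diagram

/-! ### The arrows near the vertices 0, 1, 2 when t ≥ 3. -/

section Arrows

variable {t : ℕ∞}

theorem not_arrow_of_ne {i j : ℕ∞} (h1 : j ≠ i + 1) (h2 : i ≠ t ∨ j ≠ 0) : ¬Arrow t i j := by
  rintro (⟨_, h⟩ | ⟨h, h'⟩)
  · exact h1 h
  · exact h2.elim (fun e => e h) fun e => e h'

variable (h3 : 3 ≤ t)
include h3

theorem zero_ne_of_three_le : (0 : ℕ∞) ≠ t := by rintro rfl; simp at h3

theorem one_ne_of_three_le : (1 : ℕ∞) ≠ t := by rintro rfl; exact absurd h3 (by decide)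

theorem two_ne_of_three_le : (2 : ℕ∞) ≠ t := by rintro rfl; exact absurd h3 (by decide)

theorem two_le_of_three_le : (2 : ℕ∞) ≤ t := le_trans (by decide) h3

theorem one_le_of_three_le : (1 : ℕ∞) ≤ t := le_trans (by decide) h3

theorem not_arrow_zero {j : ℕ∞} (hj : j ≠ 1) : ¬Arrow t 0 j :=
  not_arrow_of_ne (by simpa using hj) (.inl (zero_ne_of_three_le h3))

theorem not_arrow_one {j : ℕ∞} (hj : j ≠ 2) : ¬Arrow t 1 j :=
  not_arrow_of_ne (by rwa [show (1 : ℕ∞) + 1 = 2 from rfl]) (.inl (one_ne_of_three_le h3))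

/-- This is where t ≥ 3 is essential: for t = 2 the vertex 2 would be the last one, and its arrow
would return to vertex 0. -/
theorem not_arrow_two {j : ℕ∞} (hj : j ≠ 3) : ¬Arrow t 2 j :=
  not_arrow_of_ne (by rwa [show (2 : ℕ∞) + 1 = 3 from rfl]) (.inl (two_ne_of_three_le h3))

omit h3 in
theorem not_arrow_to_one {i : ℕ∞} (hi : i ≠ 0) : ¬Arrow t i 1 := by
  refine not_arrow_of_ne (fun h => hi ?_) (.inr one_ne_zero)
  enat_to_nat <;> omega

end Arrows

/-! ### The sum of the first two vertices: harmonicity and 2-nilconformality. -/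

section Sum

variable {M : Type*} [TopologicalSpace M] [ChartedSpace ℂ M] {n : ℕ}

theorem IsSmoothMap.sup {k l : ℕ} {ψ χ : M → Submodule ℂ (Cn n)} (hψ : IsSmoothMap k ψ)
    (hχ : IsSmoothMap l χ) (h : ∀ x, ψ x ⟂ χ x) : IsSmoothMap (k + l) fun x => ψ x ⊔ χ x := by
  refine ⟨fun x => ?_, (hψ.smooth.add hχ.smooth).congr fun x => starProjection_sup (h x)⟩
  have h1 := traceRe_starProjection (ψ x ⊔ χ x)
  rw [starProjection_sup (h x), map_add, traceRe_starProjection, traceRe_starProjection,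
    hψ.finrank_eq, hχ.finrank_eq] at h1
  exact_mod_cast h1.symm

end Sum

section Algebra

variable {R : Type*} [Ring R]

theorem mul_mul_eq_zero_of_mul_eq {p d q : R} (h : p * d * p = 0) (hq : p * q = q) :
    p * (d * q) = 0 := by
  rw [← hq, ← mul_assoc, ← mul_assoc, h, zero_mul]

theorem sum_dz_mul_zero {p₀ p₁ d₀ d₁ r : R} (hr : r = 1 - p₀ - p₁)
    (h0 : r * (d₀ + d₁) * p₀ = 0) (h1 : (p₀ + p₁) * (d₀ + d₁) * (p₀ + p₁) = 0) 
    (h : (p₀ + p₁) * p₀ = p₀) : (d₀ + d₁) * p₀ = 0 := by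
  have h2 : (p₀ + p₁) * (d₀ + d₁) * p₀ = 0 := by
    rw [mul_assoc]
    exact mul_mul_eq_zero_of_mul_eq h1 h
  have h3 : r + (p₀ + p₁) = 1 := by rw [hr]; abel
  rw [← one_mul (d₀ + d₁), ← h3, add_mul, add_mul, h0, h2, add_zero]

/-- The derivative of the projection onto ψ maps ψᗮ into ψ; without a component along p₁ only the
one along p₀ remains. -/
theorem eq_mul_of_deriv {p₀ p₁ d q : R} (hd : d * (p₀ + p₁) + (p₀ + p₁) * d = d)
    (h1 : p₁ * d * q = 0) (hq : (p₀ + p₁) * q = 0) : d * q = p₀ * (d * q) := by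
  calc d * q = d * ((p₀ + p₁) * q) + p₀ * (d * q) + p₁ * d * q := by
        nth_rw 1 [← hd]; noncomm_ring
    _ = p₀ * (d * q) := by rw [h1, hq, mul_zero, zero_add, add_zero]

theorem mul_eq_zero_of_mul_mul {p q a : R} (h : p * a = 0) (hq : q * p = q) : q * a = 0 := by
  rw [← hq, mul_assoc, h, mul_zero]

end Algebra

section Diagram

variable {M : Type*} [TopologicalSpace M] [ChartedSpace ℂ M] [IsManifold 𝓘(ℂ) ω M] {n : ℕ}
  {t : ℕ∞} {m : ℕ∞ → ℕ} {ψ : ℕ∞ → M → Submodule ℂ (Cn n)} {z : OpenPartialHomeomorph M ℂ} {w : ℂ}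

namespace IsCyclicHarmonicDiagram

variable (h : IsCyclicHarmonicDiagram t m ψ) (h3 : 3 ≤ t)
include h h3

omit [IsManifold 𝓘(ℂ) ω M] in
theorem isOrtho (x : M) : ψ 0 x ⟂ ψ 1 x :=
  h.orthogonal 0 zero_le 1 (one_le_of_three_le h3) zero_ne_one x

omit [IsManifold 𝓘(ℂ) ω M] in
theorem isSmoothMap_sup : IsSmoothMap (m 0 + m 1) fun x => ψ 0 x ⊔ ψ 1 x :=
  (h.harmonic 0 zero_le).toIsSmoothMap.sup
    (h.harmonic 1 (one_le_of_three_le h3)).toIsSmoothMap (h.isOrtho h3)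

omit [IsManifold 𝓘(ℂ) ω M] in
theorem proj_sup_comp : (proj fun x => ψ 0 x ⊔ ψ 1 x) ∘ z.symm =
    fun w => vertexProj ψ z 0 w + vertexProj ψ z 1 w :=
  funext fun _ => starProjection_sup (h.isOrtho h3 _)

omit [IsManifold 𝓘(ℂ) ω M] in
theorem zero_mul_one : vertexProj ψ z 0 w * vertexProj ψ z 1 w = 0 :=
  h.mul_eq_zero zero_le (one_le_of_three_le h3) zero_ne_one w

omit [IsManifold 𝓘(ℂ) ω M] in
theorem one_mul_zero : vertexProj ψ z 1 w * vertexProj ψ z 0 w = 0 :=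
  h.mul_eq_zero (one_le_of_three_le h3) zero_le one_ne_zero w

omit h h3 [ChartedSpace ℂ M] [IsManifold 𝓘(ℂ) ω M] in
theorem vertexProj_mul_self (i : ℕ∞) : vertexProj ψ z i w * vertexProj ψ z i w = vertexProj ψ z i w :=
  isStarProjection_starProjection.isIdempotentElem

omit [IsManifold 𝓘(ℂ) ω M] in
/-- To the right, `1 - p 0 - p 1` only matters against the other vertices. -/
theorem rest_mul_eq_zero {a : EndCn n} 
    (ha : ∀ i ≤ t, i ≠ 0 → i ≠ 1 → vertexProj ψ z i w * a = 0) :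
    (1 - vertexProj ψ z 0 w - vertexProj ψ z 1 w) * a = 0 := by
  have h1 := one_le_of_three_le h3
  refine h.mul_eq_zero_of_forall (z := z) w fun i hi => ?_
  by_cases h0 : i = 0
  · subst h0
    left
    rw [sub_mul, sub_mul, one_mul, vertexProj_mul_self, h.one_mul_zero h3, sub_self, sub_zero]
  by_cases h1 : i = 1
  · subst h1
    left
    rw [sub_mul, sub_mul, one_mul, vertexProj_mul_self, h.zero_mul_one h3, sub_zero, sub_self]
  exact Or.inr (ha i hi h0 h1)

omit [IsManifold 𝓘(ℂ) ω M] in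
theorem mul_rest_eq_zero {a : EndCn n} 
    (ha : ∀ i ≤ t, i ≠ 0 → i ≠ 1 → a * vertexProj ψ z i w = 0) :
    a * (1 - vertexProj ψ z 0 w - vertexProj ψ z 1 w) = 0 := by
  refine h.mul_eq_zero_of_forall (z := z) w fun i hi => ?_
  by_cases h0 : i = 0
  · subst h0
    right
    rw [mul_sub, mul_sub, mul_one, vertexProj_mul_self, h.zero_mul_one h3, sub_self, sub_zero]
  by_cases h1 : i = 1
  · subst h1
    right
    rw [mul_sub, mul_sub, mul_one, vertexProj_mul_self, h.one_mul_zero h3, sub_zero, sub_self]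
  exact Or.inl (ha i hi h0 h1)

theorem isSmoothProjection_rest (hz : z ∈ coordinates M) : IsSmoothProjection
    (fun w => 1 - vertexProj ψ z 0 w - vertexProj ψ z 1 w) z.target :=
  HarmonicGrassmann.isSmoothProjection_rest (h.isSmoothProjection hz zero_le)
    (h.isSmoothProjection hz (one_le_of_three_le h3)) fun _ _ => h.zero_mul_one h3

theorem dz_rest (hz : z ∈ coordinates M) (hw : w ∈ z.target) :
    dz (fun w => 1 - vertexProj ψ z 0 w - vertexProj ψ z 1 w) w =
      -(dz (vertexProj ψ z 0) w + dz (vertexProj ψ z 1) w) := by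
  have d0 := (h.isSmoothProjection hz zero_le).differentiableAt z.open_target hw
  have d1 := (h.isSmoothProjection hz (one_le_of_three_le h3)).differentiableAt z.open_target hw
  simp only [sub_sub]
  rw [dz_const_sub, dz_add d0 d1]

theorem one_mul_dz_mul (hz : z ∈ coordinates M) (hw : w ∈ z.target) {i : ℕ∞} (hi : i ≤ t)
    (h0 : i ≠ 0) (h1 : i ≠ 1) : vertexProj ψ z 1 w *
      (dz (vertexProj ψ z 0) w + dz (vertexProj ψ z 1) w) * vertexProj ψ z i w = 0 := by
  have ht := one_le_of_three_le h3
  rw [mul_assoc, add_mul, h.dz_mul_eq_zero hz hi ht h1 (not_arrow_to_one h0) hw, add_zero]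
  have e := (h.isSmoothProjection hz ht).dz_mul_add (h.isSmoothProjection hz zero_le)
    z.open_target hw fun w _ => h.one_mul_zero h3
  rw [← mul_assoc]
  exact mul_eq_zero_of_add_eq_zero e (h.mul_eq_zero zero_le hi h0.symm w)

/-- With all other vertices merged into one bundle, the diagram becomes a cycle of length three in
which that bundle is the third vertex. -/
theorem harmonicEquation_rest (hz : z ∈ coordinates M) : HarmonicEquation
    (fun w => 1 - vertexProj ψ z 0 w - vertexProj ψ z 1 w) z.target := by
  have ht := one_le_of_three_le h3
  refine HarmonicEquation.of_cycle (h.isSmoothProjection hz zero_le)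
    (h.isSmoothProjection hz ht) (h.isSmoothProjection_rest h3 hz) z.open_target
    (fun w _ => by abel) (fun w _ => h.zero_mul_one h3)
    (fun w _ => ?_) (fun w _ => ?_) (fun w hw => ?_) (fun w hw => ?_) fun w hw => ?_
  · rw [mul_sub, mul_sub, mul_one, vertexProj_mul_self, h.zero_mul_one h3, sub_self, sub_zero]
  · rw [mul_sub, mul_sub, mul_one, vertexProj_mul_self, h.one_mul_zero h3, sub_zero, sub_self]
  · rw [mul_assoc]
    refine h.rest_mul_eq_zero h3 fun i hi h0 h1 => ?_
    rw [← mul_assoc]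
    exact h.mul_dz_mul hz zero_le hi h0.symm (not_arrow_zero h3 h1) hw
  · exact h.mul_dz_mul hz ht zero_le one_ne_zero (not_arrow_one h3 (by decide)) hw
  · refine h.mul_rest_eq_zero h3 fun i hi h0 h1 => ?_
    rw [h.dz_rest h3 hz hw]
    exact mul_neg_mul_eq_zero (h.one_mul_dz_mul h3 hz hw hi h0 h1)

theorem isHarmonic_sup : IsHarmonic (m 0 + m 1) fun x => ψ 0 x ⊔ ψ 1 x := by
  refine isHarmonic_of_equation (h.isSmoothMap_sup h3) fun z hz => ?_
  have := (h.harmonicEquation_rest h3 hz).one_sub (h.isSmoothProjection_rest h3 hz) z.open_target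
  simp only [sub_sub, sub_sub_cancel] at this
  rwa [h.proj_sup_comp h3]

theorem dz_sup (hz : z ∈ coordinates M) (hw : w ∈ z.target) :
    dz ((proj fun x => ψ 0 x ⊔ ψ 1 x) ∘ z.symm) w =
      dz (vertexProj ψ z 0) w + dz (vertexProj ψ z 1) w := by
  rw [h.proj_sup_comp h3, dz_add
    ((h.isSmoothProjection hz zero_le).differentiableAt z.open_target hw)
    ((h.isSmoothProjection hz (one_le_of_three_le h3)).differentiableAt z.open_target hw)]

/-- The derivative d = d₀ + d₁ is evaluated vertex by vertex: ψ₀ ↦ 0, ψ₁ ↦ ψ₂ ↦ 0, and any further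
vertex is mapped into ψ₀ and then to 0. -/
theorem isTwoNilconformal_sup : IsTwoNilconformal fun x => ψ 0 x ⊔ ψ 1 x := by
  rw [isTwoNilconformal_iff (h.isSmoothMap_sup h3)]
  intro z hz w hw
  have ht := one_le_of_three_le h3
  have hP := (h.isSmoothMap_sup h3).isSmoothProjection hz
  have e1 := hP.mul_dz_mul z.open_target hw
  have e2 := hP.dz_mul_self z.open_target hw
  rw [h.dz_sup h3 hz hw] at e1 e2 ⊢
  simp only [h.proj_sup_comp h3] at e1 e2
  set d₀ := dz (vertexProj ψ z 0) w
  set d₁ := dz (vertexProj ψ z 1) w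
  -- the second vertex is the only target of arrows from the first
  have a0 : (d₀ + d₁) * vertexProj ψ z 0 w = 0 := by
    refine sum_dz_mul_zero rfl ?_ e1
      (by rw [add_mul, vertexProj_mul_self, h.one_mul_zero h3, add_zero])
    rw [mul_assoc]
    refine h.rest_mul_eq_zero h3 fun i hi h0 h1 => ?_
    rw [add_mul, mul_add, ← mul_assoc, ← mul_assoc,
      h.mul_dz_mul hz zero_le hi h0.symm (not_arrow_zero h3 h1) hw,
      h.mul_dz_mul_of_ne hz hi ht zero_le h1 one_ne_zero hw]
    exact add_zero _
  -- The only arrow from ψ₂ goes to ψ₃, so nothing returns from ψ₂ to ψ.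
  have a2 : (d₀ + d₁) * vertexProj ψ z 2 w = 0 := by
    have c := two_le_of_three_le h3
    rw [add_mul, h.dz_mul_eq_zero hz c zero_le two_ne_zero (not_arrow_two h3 (by decide)) hw,
      h.dz_mul_eq_zero hz c ht (by decide) (not_arrow_two h3 (by decide)) hw]
    exact add_zero _
  -- A vertex outside ψ can return to ψ only through ψ₀, as the only arrow into ψ₁ comes from ψ₀.
  have ak : ∀ i ≤ t, i ≠ 0 → i ≠ 1 → (d₀ + d₁) * vertexProj ψ z i w =
      vertexProj ψ z 0 w * ((d₀ + d₁) * vertexProj ψ z i w) := by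
    intro i hi h0 h1
    have c1 := h.one_mul_dz_mul h3 hz hw hi h0 h1
    have c2 : (vertexProj ψ z 0 w + vertexProj ψ z 1 w) * vertexProj ψ z i w = 0 := by
      rw [add_mul, h.mul_eq_zero zero_le hi h0.symm, h.mul_eq_zero ht hi h1.symm]
      exact add_zero _
    exact eq_mul_of_deriv e2 c1 c2
  have a1 : (1 - vertexProj ψ z 2 w) * ((d₀ + d₁) * vertexProj ψ z 1 w) = 0 := by
    have c := two_le_of_three_le h3
    have c2 : (vertexProj ψ z 0 w + vertexProj ψ z 1 w) * vertexProj ψ z 1 w = vertexProj ψ z 1 w := by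
      rw [add_mul, h.zero_mul_one h3, vertexProj_mul_self, zero_add]
    have c3 := mul_mul_eq_zero_of_mul_eq e1 c2
    refine h.mul_eq_zero_of_forall (z := z) w fun i hi => ?_
    by_cases i2 : i = 2
    · subst i2
      left
      rw [sub_mul, one_mul, vertexProj_mul_self, sub_self]
    right
    by_cases i0 : i = 0
    · subst i0
      refine mul_eq_zero_of_mul_mul c3 ?_
      rw [mul_add, vertexProj_mul_self, h.zero_mul_one h3, add_zero]
    by_cases i1 : i = 1
    · subst i1
      refine mul_eq_zero_of_mul_mul c3 ?_
      rw [mul_add, vertexProj_mul_self, h.one_mul_zero h3, zero_add]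
    rw [add_mul, mul_add, ← mul_assoc, ← mul_assoc,
      h.mul_dz_mul hz ht hi (Ne.symm i1) (not_arrow_one h3 i2) hw,
      h.mul_dz_mul_of_ne hz hi zero_le ht i0 zero_ne_one hw]
    exact add_zero _
  refine h.eq_zero_of_mul (z := z) w fun i hi => ?_
  rw [mul_assoc]
  by_cases i0 : i = 0
  · subst i0
    rw [a0]
    exact mul_zero _
  by_cases i1 : i = 1
  · subst i1
    rw [sub_mul, one_mul, sub_eq_zero] at a1
    rw [a1, ← mul_assoc, a2]
    exact zero_mul _
  rw [ak i hi i0 i1, ← mul_assoc, a0]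
  exact zero_mul _

end IsCyclicHarmonicDiagram
end Diagram

/-! ### Iterated Gauss bundles and the isotropy order. -/

section GaussSequence

variable {M : Type*} [TopologicalSpace M] [T2Space M] [ConnectedSpace M] [ChartedSpace ℂ M]
  [IsManifold 𝓘(ℂ) ω M] {n : ℕ}

/-- Harmonicity is carried along the iteration, since the existence of each Gauss bundle depends on
it. -/
theorem exists_gaussSequence {m : ℕ} {ψ : M → Submodule ℂ (Cn n)} (hh : IsHarmonic m ψ) :
    ∃ G : ℕ → M → Submodule ℂ (Cn n), G 0 = ψ ∧ (∀ i, ∃ k, IsHarmonic k (G i)) ∧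
      ∀ i, IsGaussBundle (G i) (G (i + 1)) := by
  have hex : ∀ γ : {γ : M → Submodule ℂ (Cn n) // ∃ k, IsHarmonic k γ},
      ∃ γ' : {γ : M → Submodule ℂ (Cn n) // ∃ k, IsHarmonic k γ}, IsGaussBundle γ.1 γ'.1 := by
    rintro ⟨γ, k, hk⟩
    obtain ⟨γ', h⟩ := exists_isGaussBundle hk
    exact ⟨⟨γ', h.isHarmonic hk⟩, h⟩
  choose f hf using hex
  refine ⟨fun i => (f^[i] ⟨ψ, m, hh⟩).1, rfl, fun i => (f^[i] ⟨ψ, m, hh⟩).2, fun i => ?_⟩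
  simp only [Function.iterate_succ_apply']
  exact hf _

end GaussSequence

section Isotropy

variable {M : Type*} [TopologicalSpace M] [ChartedSpace ℂ M] [IsManifold 𝓘(ℂ) ω M] {n : ℕ}
  {t : ℕ∞} {m : ℕ∞ → ℕ} {ψ : ℕ∞ → M → Submodule ℂ (Cn n)}

theorem mul_eq_zero_of_add_eq_zero_left {R : Type*} [Ring R] {a' b a b' : R}
    (h : a' * b + a * b' = 0) (hc : a' * b = 0) : a * (b' * b) = 0 := by
  rw [hc, zero_add] at h
  rw [← mul_assoc, h, zero_mul]

/-- If `V` is contained in the sum of the vertices `ψ i`, `i ∈ J`, its Gauss bundle is orthogonal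
to the vertices that are neither in `J` nor attained by arrows from `J`. -/
theorem IsCyclicHarmonicDiagram.proj_mul_gaussBundle (h : IsCyclicHarmonicDiagram t m ψ) {k : ℕ}
    {V G : M → Submodule ℂ (Cn n)} (hV : IsSmoothMap k V) (hG : IsGaussBundle V G) {J : Set ℕ∞}
    (hJ : ∀ i ≤ t, i ∉ J → ∀ x, proj (ψ i) x * proj V x = 0) {j : ℕ∞} (hj : j ≤ t) (hjJ : j ∉ J)
    (ha : ∀ i ∈ J, i ≤ t → ¬Arrow t i j) (x : M) : proj (ψ j) x * proj G x = 0 := by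
  set z := chartAt ℂ x
  have hz : z ∈ coordinates M := chartAt_mem_coordinates x
  have hx : x ∈ z.source := mem_chart_source ℂ x
  have hPj := h.isSmoothProjection hz hj
  have h1 := hG.mul_proj_eq_zero hV hz (S := vertexProj ψ z j) hPj.smooth.continuousOn
    (fun w hw => ?_) (z.map_source hx)
  · simp only [vertexProj, Function.comp_apply, z.left_inv hx] at h1
    exact h1
  · refine mul_eq_zero_of_add_eq_zero_left (hPj.dz_mul_add (hV.isSmoothProjection hz) z.open_target hw
      fun w _ => hJ j hj hjJ _) ?_
    refine h.mul_eq_zero_of_forall (z := z) w fun i hi => ?_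
    by_cases hiJ : i ∈ J
    · exact Or.inl (h.dz_mul_eq_zero hz hi hj (fun e => hjJ (e ▸ hiJ)) (ha i hiJ hi) hw)
    · exact Or.inr (hJ i hi hiJ _)

theorem IsGaussBundle.isOrtho {k : ℕ} {V G : M → Submodule ℂ (Cn n)} (hV : IsSmoothMap k V)
    (hG : IsGaussBundle V G) (x : M) : V x ⟂ G x := by
  have hx := mem_chart_source ℂ x
  have h1 := hG.orthogonal hV (chartAt_mem_coordinates x) ((chartAt ℂ x).map_source hx)
  simp only [Function.comp_apply, (chartAt ℂ x).left_inv hx] at h1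
  exact starProjection_mul_eq_zero_iff.1 h1

/-- A dual form of the inclusion of G^{(j)}(ψ) in ψ₂ ⊕ ⋯ ⊕ ψ_{j+1}. Each Gauss bundle advances one
arrow, and j + 1 ≤ t ensures that the closing arrow to ψ₀ has not yet been used. -/
theorem IsCyclicHarmonicDiagram.proj_mul_gaussSequence (h : IsCyclicHarmonicDiagram t m ψ)
    (h3 : 3 ≤ t) {G : ℕ → M → Submodule ℂ (Cn n)} (hG0 : G 0 = fun x => ψ 0 x ⊔ ψ 1 x)
    (hGs : ∀ i, ∃ k, IsHarmonic k (G i)) (hG : ∀ i, IsGaussBundle (G i) (G (i + 1))) {j : ℕ}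
    (hj : 1 ≤ j) : (j : ℕ∞) + 1 ≤ t → ∀ k ≤ t, (k < 2 ∨ (j : ℕ∞) + 1 < k) → ∀ x,
      proj (ψ k) x * proj (G j) x = 0 := by
  have ht := one_le_of_three_le h3
  induction j, hj using Nat.le_induction with
  | base =>
    intro _ k hk hk2 x
    obtain ⟨l, hl⟩ := hGs 0
    -- For these two vertices arrows do not suffice, as one leads from 0 to 1; instead, the Gauss
    -- bundle is orthogonal to its source ψ₀ ⊕ ψ₁.
    by_cases hk01 : k = 0 ∨ k = 1
    · have h1 := (hG 0).isOrtho hl.toIsSmoothMap x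
      rw [hG0] at h1
      refine starProjection_mul_eq_zero_iff.2 (h1.mono_left ?_)
      rcases hk01 with rfl | rfl
      · exact le_sup_left
      · exact le_sup_right
    · rw [not_or] at hk01
      have hk2' : k ≠ 2 := by
        rintro rfl
        revert hk2
        decide
      refine h.proj_mul_gaussBundle hl.toIsSmoothMap (hG 0) (J := {0, 1}) ?_ hk (by simpa using hk01)
        ?_ x
      · intro i hi hi01 y
        simp only [mem_insert_iff, mem_singleton_iff, not_or] at hi01
        refine starProjection_mul_eq_zero_iff.2 ?_
        rw [hG0]
        exact Submodule.isOrtho_sup_right.2 ⟨h.orthogonal i hi 0 zero_le hi01.1 y,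
          h.orthogonal i hi 1 ht hi01.2 y⟩
      · rintro i (rfl | rfl) _
        · exact not_arrow_zero h3 hk01.2
        · exact not_arrow_one h3 hk2'
  | succ j hj ih =>
    intro hjt k hk hk2 x
    obtain ⟨l, hl⟩ := hGs j
    push_cast at hjt hk2
    have hjt' : (j : ℕ∞) + 1 ≤ t := by enat_to_nat; omega
    -- By induction G^{(j)}(ψ) lives on the vertices 2, …, j + 1, whose arrows end at 3, …, j + 2.
    refine h.proj_mul_gaussBundle hl.toIsSmoothMap (hG j) (J := {i | 2 ≤ i ∧ i ≤ (j : ℕ∞) + 1})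
      (fun i hi hiJ y => ih hjt' i hi ?_ y) hk ?_ ?_ x
    · by_contra hc
      rw [not_or, not_lt, not_lt] at hc
      exact hiJ hc
    · rintro ⟨h1, h2⟩
      rcases hk2 with hk2 | hk2
      · exact not_lt_of_ge h1 hk2
      · exact not_lt_of_ge (h2.trans le_self_add) hk2
    · rintro i ⟨h1, h2⟩ hi
      refine not_arrow_of_ne ?_ (.inl ?_)
      · rintro rfl
        rcases hk2 with hk2 | hk2
        · exact not_lt_of_ge (h1.trans le_self_add) hk2
        · exact not_lt_of_ge (add_le_add_left h2 1) hk2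
      -- A vertex of `J` is at most j + 1, hence below t, so it is not the source of the closing
      -- arrow.
      · rintro rfl
        have := hjt.trans h2
        exact absurd this (by enat_to_nat; omega)

/-- The isotropy order is tested on finite indices only, so t = ∞ needs no separate treatment. -/
theorem IsCyclicHarmonicDiagram.le_isotropyOrder [T2Space M] [ConnectedSpace M]
    (h : IsCyclicHarmonicDiagram t m ψ)
    (h3 : 3 ≤ t) : t - 1 ≤ isotropyOrder (fun x => ψ 0 x ⊔ ψ 1 x) := by
  obtain ⟨G, hG0, hGs, hG⟩ := exists_gaussSequence (h.isHarmonic_sup h3)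
  refine le_sSup fun i hi => ⟨G, hG0, fun j _ => hG j, fun j hj hji x => ?_⟩
  have hjt : (j : ℕ∞) + 1 ≤ t := by
    have h1 : (j : ℕ∞) ≤ t - 1 := le_trans (by exact_mod_cast hji) hi
    calc (j : ℕ∞) + 1 ≤ t - 1 + 1 := add_le_add_left h1 1
      _ = t := tsub_add_cancel_of_le (one_le_of_three_le h3)
  have key := h.proj_mul_gaussSequence h3 hG0 hGs hG hj hjt
  exact Submodule.isOrtho_sup_left.2
    ⟨starProjection_mul_eq_zero_iff.1 (key 0 zero_le (.inl (by decide)) x),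
      starProjection_mul_eq_zero_iff.1 (key 1 (one_le_of_three_le h3) (.inl (by decide)) x)⟩

end Isotropy

/-! ### The converse: splitting a 2-nilconformal harmonic map. -/

section Algebra

variable {R : Type*} [Ring R]

theorem mul_deriv_mul_of_le {s q q' p p' : R} (hd : q' * p + q * p' = p') (hs : s * q = 0) :
    s * p' * p = s * q' * (p * p) := by
  rw [← hd, mul_add, ← mul_assoc, ← mul_assoc, hs, zero_mul, add_zero, mul_assoc, mul_assoc]

end Algebra

section Splitting

variable {M : Type*} [TopologicalSpace M] [ChartedSpace ℂ M] [IsManifold 𝓘(ℂ) ω M] {n m : ℕ}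
  {ψ γ : M → Submodule ℂ (Cn n)} {z : OpenPartialHomeomorph M ℂ} {w : ℂ}

omit [ChartedSpace ℂ M] [IsManifold 𝓘(ℂ) ω M] in
theorem proj_orthogonal_comp : (proj fun x => (ψ x)ᗮ) ∘ z.symm =
    fun w => 1 - (proj ψ ∘ z.symm) w :=
  funext fun _ => Submodule.starProjection_orthogonal' _

theorem IsHarmonic.orthogonal [T2Space M] [ConnectedSpace M] (hh : IsHarmonic m ψ) :
    ∃ k, IsHarmonic k fun x => (ψ x)ᗮ := by
  have h1 : ContMDiff 𝓘(ℝ, ℂ) 𝓘(ℝ, EndCn n) ∞ (proj fun x => (ψ x)ᗮ) :=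
    (contMDiff_const.sub hh.smooth).congr fun x => Submodule.starProjection_orthogonal' _
  obtain ⟨k, hk⟩ := exists_isSmoothMap h1
  refine ⟨k, isHarmonic_of_equation hk fun z hz => ?_⟩
  rw [proj_orthogonal_comp]
  exact (hh.equation hz).one_sub (hh.toIsSmoothMap.isSmoothProjection hz) z.open_target

theorem IsTwoNilconformal.orthogonal {k : ℕ} (hψ : IsSmoothMap m ψ)
    (hψ' : IsSmoothMap k fun x => (ψ x)ᗮ) (hn : IsTwoNilconformal ψ) :
    IsTwoNilconformal fun x => (ψ x)ᗮ := by
  rw [isTwoNilconformal_iff hψ'] 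
  rw [isTwoNilconformal_iff hψ] at hn
  intro z hz w hw
  rw [proj_orthogonal_comp, dz_const_sub]
  exact (neg_mul_neg _ _).trans (hn z hz w hw)

/-- On the image of A' this is (∂P)²P = 0; continuity extends it to the filled-out zeros. It
excludes arrows from the Gauss bundle back to ψ. -/
theorem IsGaussBundle.dz_mul_proj (hγ : IsGaussBundle ψ γ) (hψ : IsSmoothMap m ψ)
    (hn : IsTwoNilconformal ψ) (hz : z ∈ coordinates M) (hw : w ∈ z.target) :
    dz (proj ψ ∘ z.symm) w * (proj γ ∘ z.symm) w = 0 := by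
  refine hγ.mul_proj_eq_zero hψ hz
    (contDiffOn_dz z.open_target (hψ.isSmoothProjection hz).smooth).continuousOn (fun w hw => ?_) hw
  rw [← mul_assoc, (isTwoNilconformal_iff hψ).1 hn z hz w hw]
  exact zero_mul _

/-- The adjoint of ∂̄-closedness: no arrow leads from the complement to the Gauss bundle. -/
theorem IsGaussBundle.mul_dz_rest [T2Space M] (hγ : IsGaussBundle ψ γ) (hh : IsHarmonic m ψ)
    (hz : z ∈ coordinates M) (hw : w ∈ z.target) : (proj γ ∘ z.symm) w *
      dz (fun w => 1 - (proj γ ∘ z.symm) w - (proj ψ ∘ z.symm) w) w = 0 := by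
  obtain ⟨k, hk⟩ := hγ.1
  have h := congrArg star (hγ.dbar_rest_mul hh hz hw)
  rw [star_mul, (hk.isSmoothProjection hz).star_eq hw,
    (hγ.isSmoothProjection_rest hh.toIsSmoothMap hz).star_dbar z.open_target hw] at h
  exact h.trans star_endCn_zero

omit [ChartedSpace ℂ M] [IsManifold 𝓘(ℂ) ω M] in
theorem proj_rest_comp (h : ∀ x, γ x ⟂ ψ x) : (proj fun x => (γ x ⊔ ψ x)ᗮ) ∘ z.symm =
    fun w => 1 - (proj γ ∘ z.symm) w - (proj ψ ∘ z.symm) w := by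
  funext w
  refine (Submodule.starProjection_orthogonal' _).trans ?_
  rw [starProjection_sup (h _), sub_sub]
  rfl

/-- The complement of `ψ ⊕ G(ψ)` is harmonic if `ψ` is harmonic and 2-nilconformal. -/
theorem IsGaussBundle.isHarmonic_rest [T2Space M] [ConnectedSpace M] (hγ : IsGaussBundle ψ γ)
    (hh : IsHarmonic m ψ) (hn : IsTwoNilconformal ψ) :
    ∃ k, IsHarmonic k fun x => (γ x ⊔ ψ x)ᗮ := by
  obtain ⟨l, hl⟩ := hγ.1
  have hψ := hh.toIsSmoothMap
  have ho : ∀ x, γ x ⟂ ψ x := fun x => (hγ.isOrtho hψ x).symm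
  have h1 : ContMDiff 𝓘(ℝ, ℂ) 𝓘(ℝ, EndCn n) ∞ (proj fun x => (γ x ⊔ ψ x)ᗮ) := by
    refine ((contMDiff_const (c := (1 : EndCn n))).sub (hl.smooth.add hψ.smooth)).congr fun x => ?_
    refine (Submodule.starProjection_orthogonal' _).trans ?_
    rw [starProjection_sup (ho _)]
    rfl
  obtain ⟨k, hk⟩ := exists_isSmoothMap h1
  refine ⟨k, isHarmonic_of_equation hk fun z hz => ?_⟩
  rw [proj_rest_comp ho]
  have hQ := hψ.isSmoothProjection hz
  have hP := hl.isSmoothProjection hz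
  -- The cycle is ψ → γ → complement → ψ. Its missing arrows come, in order, from the inclusion of
  -- the image of A' in γ, from 2-nilconformality, and from ∂̄-closedness of γ.
  refine HarmonicEquation.of_cycle hQ hP (hγ.isSmoothProjection_rest hψ hz) z.open_target
    (fun w _ => by abel) (fun w hw => hγ.orthogonal hψ hz hw) (fun w hw => ?_) (fun w hw => ?_)
    (fun w hw => ?_) (fun w hw => ?_) fun w hw => ?_
  · rw [mul_sub, mul_sub, mul_one, hγ.orthogonal hψ hz hw, hQ.mul_self hw, sub_zero, sub_self]
  · rw [mul_sub, mul_sub, mul_one, hγ.orthogonal' hψ hz hw, hP.mul_self hw, sub_self, sub_zero]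
  · rw [mul_assoc]
    exact hγ.rest_mul_dz_mul hψ hz hw
  · rw [mul_assoc]
    exact mul_eq_zero_of_add_eq_zero_left (hQ.dz_mul_add hP z.open_target hw
      fun w hw => hγ.orthogonal hψ hz hw) (hγ.dz_mul_proj hψ hn hz hw)
  · rw [hγ.mul_dz_rest hh hz hw]
    exact zero_mul _

/-- The derivative of a subbundle of `ψ`, in the directions orthogonal to `ψ`. -/
theorem mul_dz_mul_of_le {l : ℕ} {χ : M → Submodule ℂ (Cn n)} (hψ : IsSmoothMap m ψ)
    (hχ : IsSmoothMap l χ) (hle : ∀ x, χ x ≤ ψ x) (ho : ∀ x, γ x ⟂ ψ x)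
    (hz : z ∈ coordinates M) (hw : w ∈ z.target) :
    (proj γ ∘ z.symm) w * dz (proj χ ∘ z.symm) w * (proj χ ∘ z.symm) w =
      (proj γ ∘ z.symm) w * dz (proj ψ ∘ z.symm) w * (proj χ ∘ z.symm) w := by
  have hQ := hψ.isSmoothProjection hz
  have hP := hχ.isSmoothProjection hz
  have h1 : ∀ w, (proj ψ ∘ z.symm) w * (proj χ ∘ z.symm) w = (proj χ ∘ z.symm) w := fun w =>
    ContinuousLinearMap.ext fun v => Submodule.starProjection_eq_self_iff.2
      (hle _ (Submodule.starProjection_apply_mem _ v))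
  have h2 : dz (proj ψ ∘ z.symm) w * (proj χ ∘ z.symm) w +
      (proj ψ ∘ z.symm) w * dz (proj χ ∘ z.symm) w = dz (proj χ ∘ z.symm) w := by
    rw [← dz_mul (hQ.differentiableAt z.open_target hw) (hP.differentiableAt z.open_target hw)]
    exact dz_congr (.of_forall h1)
  have h3 := mul_deriv_mul_of_le h2 (starProjection_mul_eq_zero_iff.2 (ho (z.symm w)))
  rw [hP.mul_self hw] at h3
  exact h3

end Splitting

/-! ### Diagrams with four vertices, and the construction for a given map. -/

section FourVertices

variable {M : Type*} [TopologicalSpace M] [ChartedSpace ℂ M] {n : ℕ}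

theorem le_three_cases {i : ℕ∞} (hi : i ≤ 3) : i = 0 ∨ i = 1 ∨ i = 2 ∨ i = 3 := by
  lift i to ℕ using ne_top_of_le_ne_top (by decide) hi
  have h : i ≤ 3 := by exact_mod_cast hi
  interval_cases i <;> simp

/-- The family with the vertices `a`, `b`, `c`, `d` at the indices `0`, `1`, `2`, `3`. -/
def fourVertices {α : Type*} (a b c d : α) (i : ℕ∞) : α :=
  if i = 0 then a else if i = 1 then b else if i = 2 then c else d

theorem isCyclicHarmonicDiagram_fourVertices {φ₀ φ₁ φ₂ φ₃ : M → Submodule ℂ (Cn n)}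
    {m₀ m₁ m₂ m₃ : ℕ} (h₀ : IsHarmonic m₀ φ₀) (h₁ : IsHarmonic m₁ φ₁) (h₂ : IsHarmonic m₂ φ₂)
    (h₃ : IsHarmonic m₃ φ₃) (o₀₁ : ∀ x, φ₀ x ⟂ φ₁ x) (o₀₂ : ∀ x, φ₀ x ⟂ φ₂ x)
    (o₀₃ : ∀ x, φ₀ x ⟂ φ₃ x) (o₁₂ : ∀ x, φ₁ x ⟂ φ₂ x) (o₁₃ : ∀ x, φ₁ x ⟂ φ₃ x)
    (o₂₃ : ∀ x, φ₂ x ⟂ φ₃ x) (hs : ∀ x, φ₀ x ⊔ φ₁ x ⊔ (φ₂ x ⊔ φ₃ x) = ⊤)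
    (c₀₂ : ComponentVanishes φ₀ φ₂) (c₀₃ : ComponentVanishes φ₀ φ₃)
    (c₁₀ : ComponentVanishes φ₁ φ₀) (c₁₃ : ComponentVanishes φ₁ φ₃)
    (c₂₀ : ComponentVanishes φ₂ φ₀) (c₂₁ : ComponentVanishes φ₂ φ₁)
    (c₃₁ : ComponentVanishes φ₃ φ₁) (c₃₂ : ComponentVanishes φ₃ φ₂) :
    IsCyclicHarmonicDiagram 3 (fourVertices m₀ m₁ m₂ m₃) (fourVertices φ₀ φ₁ φ₂ φ₃) := by
  refine ⟨fun i hi => ?_, fun i hi j hj hij x => ?_, fun x => ?_, fun i hi j hj hij ha => ?_⟩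
  · rcases le_three_cases hi with rfl | rfl | rfl | rfl
    exacts [h₀, h₁, h₂, h₃]
  · rcases le_three_cases hi with rfl | rfl | rfl | rfl <;>
      rcases le_three_cases hj with rfl | rfl | rfl | rfl
    exacts [absurd rfl hij, o₀₁ x, o₀₂ x, o₀₃ x, (o₀₁ x).symm, absurd rfl hij, o₁₂ x, o₁₃ x,
      (o₀₂ x).symm, (o₁₂ x).symm, absurd rfl hij, o₂₃ x, (o₀₃ x).symm, (o₁₃ x).symm, (o₂₃ x).symm,
      absurd rfl hij]
  · rw [eq_top_iff, ← hs x]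
    have key : ∀ i : ℕ∞, i ≤ 3 → fourVertices φ₀ φ₁ φ₂ φ₃ i x ≤
        ⨆ i, ⨆ _ : i ≤ 3, fourVertices φ₀ φ₁ φ₂ φ₃ i x := fun i hi =>
      le_iSup₂ (f := fun i (_ : i ≤ 3) => fourVertices φ₀ φ₁ φ₂ φ₃ i x) i hi
    exact sup_le (sup_le (key 0 (by decide)) (key 1 (by decide)))
      (sup_le (key 2 (by decide)) (key 3 (by decide)))
  · rcases le_three_cases hi with rfl | rfl | rfl | rfl <;>
      rcases le_three_cases hj with rfl | rfl | rfl | rfl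
    exacts [absurd rfl hij, absurd (.inl ⟨by decide, rfl⟩) ha, c₀₂, c₀₃,
      c₁₀, absurd rfl hij, absurd (.inl ⟨by decide, rfl⟩) ha, c₁₃,
      c₂₀, c₂₁, absurd rfl hij, absurd (.inl ⟨by decide, rfl⟩) ha,
      absurd (.inr ⟨rfl, rfl⟩) ha, c₃₁, c₃₂, absurd rfl hij]

end FourVertices

section Converse

variable {M : Type*} [TopologicalSpace M] [ChartedSpace ℂ M]
  [IsManifold 𝓘(ℂ) ω M] {n m k : ℕ} {ψ γ γ' : M → Submodule ℂ (Cn n)}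

theorem sup_orthogonal_sup {V W : Submodule ℂ (Cn n)} (h : V ⟂ W) : V ⊔ (V ⊔ W)ᗮ = Wᗮ := by
  rw [← Submodule.inf_orthogonal]
  exact Submodule.sup_orthogonal_inf_of_hasOrthogonalProjection (Submodule.isOrtho_iff_le.1 h)

/-- No arrow leads from `G(ψ)` to a subbundle of `ψ`. -/
theorem IsGaussBundle.componentVanishes (hγ : IsGaussBundle ψ γ) (hψ : IsSmoothMap m ψ)
    (hψ' : IsSmoothMap k fun x => (ψ x)ᗮ) (hn : IsTwoNilconformal ψ)
    {χ : M → Submodule ℂ (Cn n)} (hle : ∀ x, χ x ≤ ψ x) :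
    ComponentVanishes γ χ := by
  obtain ⟨j, hj⟩ := hγ.1
  have h1 : ∀ x, γ x ≤ (ψ x)ᗮ := fun x => Submodule.isOrtho_iff_le.1 (hγ.isOrtho hψ x).symm
  have h2 : ∀ x, χ x ⟂ (ψ x)ᗮ := fun x =>
    (Submodule.isOrtho_orthogonal_right (ψ x)).mono_left (hle x)
  refine (componentVanishes_iff hj fun x => starProjection_mul_eq_zero_iff.2
    ((h2 x).mono_right (h1 x))).2 fun z hz w hw => ?_
  rw [mul_dz_mul_of_le hψ' hj h1 h2 hz hw, proj_orthogonal_comp, dz_const_sub]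
  refine mul_neg_mul_eq_zero ?_
  rw [mul_assoc, hγ.dz_mul_proj hψ hn hz hw]
  exact mul_zero _

/-- No arrow leads from a subbundle of `ψ` to the complement of `ψ ⊕ G(ψ)`. -/
theorem IsGaussBundle.componentVanishes_rest (hγ : IsGaussBundle ψ γ) (hψ : IsSmoothMap m ψ) {l : ℕ}
    {χ : M → Submodule ℂ (Cn n)} (hχ : IsSmoothMap l χ) (hle : ∀ x, χ x ≤ ψ x) :
    ComponentVanishes χ fun x => (γ x ⊔ ψ x)ᗮ := by
  have h2 : ∀ x, (γ x ⊔ ψ x)ᗮ ⟂ ψ x := fun x =>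
    (Submodule.isOrtho_orthogonal_left (γ x ⊔ ψ x)).mono_right le_sup_right
  refine (componentVanishes_iff hχ fun x => starProjection_mul_eq_zero_iff.2
    ((h2 x).mono_right (hle x))).2 fun z hz w hw => ?_
  rw [mul_dz_mul_of_le hψ hχ hle h2 hz hw, proj_rest_comp fun x => (hγ.isOrtho hψ x).symm]
  have h3 : (proj ψ ∘ z.symm) w * (proj χ ∘ z.symm) w = (proj χ ∘ z.symm) w :=
    ContinuousLinearMap.ext fun v => Submodule.starProjection_eq_self_iff.2
      (hle _ (Submodule.starProjection_apply_mem _ v))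
  rw [← h3, mul_assoc, ← mul_assoc (dz _ _), ← mul_assoc, hγ.rest_mul_dz_mul hψ hz hw]
  exact zero_mul _

/-- No arrow leads from the complement of `ψ ⊕ G(ψ)` to `G(ψ)`. -/
theorem IsGaussBundle.componentVanishes_of_rest [T2Space M] (hγ : IsGaussBundle ψ γ) (hh : IsHarmonic m ψ)
    {j : ℕ} (hr : IsSmoothMap j fun x => (γ x ⊔ ψ x)ᗮ) :
    ComponentVanishes (fun x => (γ x ⊔ ψ x)ᗮ) γ := by
  refine (componentVanishes_iff hr fun x => starProjection_mul_eq_zero_iff.2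
    ((Submodule.isOrtho_orthogonal_right (γ x ⊔ ψ x)).mono_left le_sup_left)).2 fun z hz w hw => ?_
  rw [proj_rest_comp fun x => (hγ.isOrtho hh.toIsSmoothMap x).symm, hγ.mul_dz_rest hh hz hw]
  exact zero_mul _

/-- The hypotheses are symmetric in ψ and ψᗮ. Each of the two is split into the Gauss bundle of the
other and what remains, and the eight missing arrows are four statements about ψ together with the
same four about ψᗮ. -/
theorem IsHarmonic.exists_diagram [T2Space M] [ConnectedSpace M] (hh : IsHarmonic m ψ) (hn : IsTwoNilconformal ψ) :
    ∃ (m' : ℕ∞ → ℕ) (φ : ℕ∞ → M → Submodule ℂ (Cn n)), IsCyclicHarmonicDiagram 3 m' φ ∧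
      m = m' 0 + m' 1 ∧ ∀ x, ψ x = φ 0 x ⊔ φ 1 x := by
  have hψ := hh.toIsSmoothMap
  obtain ⟨k, hh'⟩ := hh.orthogonal
  have hψ' := hh'.toIsSmoothMap
  have hn' := hn.orthogonal hψ hψ'
  obtain ⟨φ₂, hφ₂⟩ := exists_isGaussBundle hh
  obtain ⟨φ₀, hφ₀⟩ := exists_isGaussBundle hh'
  obtain ⟨m₀, h₀⟩ := hφ₀.isHarmonic hh'
  obtain ⟨m₂, h₂⟩ := hφ₂.isHarmonic hh
  obtain ⟨m₁, h₁⟩ := hφ₀.isHarmonic_rest hh' hn'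
  obtain ⟨m₃, h₃⟩ := hφ₂.isHarmonic_rest hh hn
  have hoo : ∀ x, (ψ x)ᗮᗮ = ψ x := fun x => Submodule.orthogonal_orthogonal _
  have o₂ : ∀ x, φ₂ x ⟂ ψ x := fun x => (hφ₂.isOrtho hψ x).symm
  have o₀ : ∀ x, φ₀ x ⟂ (ψ x)ᗮ := fun x => (hφ₀.isOrtho hψ' x).symm
  have s₀ : ∀ x, φ₀ x ⊔ (φ₀ x ⊔ (ψ x)ᗮ)ᗮ = ψ x := fun x =>
    (sup_orthogonal_sup (o₀ x)).trans (hoo x)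
  have s₂ : ∀ x, φ₂ x ⊔ (φ₂ x ⊔ ψ x)ᗮ = (ψ x)ᗮ := fun x => sup_orthogonal_sup (o₂ x)
  have l₀ : ∀ x, φ₀ x ≤ ψ x := fun x => s₀ x ▸ le_sup_left
  have l₁ : ∀ x, (φ₀ x ⊔ (ψ x)ᗮ)ᗮ ≤ ψ x := fun x => by
    conv_rhs => rw [← s₀ x]
    exact le_sup_right
  have l₂ : ∀ x, φ₂ x ≤ (ψ x)ᗮ := fun x => by
    conv_rhs => rw [← s₂ x]
    exact le_sup_left
  have l₃ : ∀ x, (φ₂ x ⊔ ψ x)ᗮ ≤ (ψ x)ᗮ := fun x => Submodule.orthogonal_le le_sup_right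
  have hoψ : ∀ x, ψ x ⟂ (ψ x)ᗮ := fun x => Submodule.isOrtho_orthogonal_right _
  have hψ'' : IsSmoothMap m fun x => (ψ x)ᗮᗮ := by simpa only [hoo] using hψ
  have o₀₁ : ∀ x, φ₀ x ⟂ (φ₀ x ⊔ (ψ x)ᗮ)ᗮ := fun x =>
    (Submodule.isOrtho_orthogonal_right (φ₀ x ⊔ (ψ x)ᗮ)).mono_left le_sup_left
  refine ⟨_, _, isCyclicHarmonicDiagram_fourVertices h₀ h₁ h₂ h₃ o₀₁
    (fun x => (hoψ x).mono (l₀ x) (l₂ x)) (fun x => (hoψ x).mono (l₀ x) (l₃ x))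
    (fun x => (hoψ x).mono (l₁ x) (l₂ x)) (fun x => (hoψ x).mono (l₁ x) (l₃ x))
    (fun x => (Submodule.isOrtho_orthogonal_right (φ₂ x ⊔ ψ x)).mono_left le_sup_left)
    (fun x => by rw [s₀, s₂]; exact Submodule.sup_orthogonal_of_hasOrthogonalProjection)
    (hφ₀.componentVanishes hψ' hψ'' hn' l₂)
    (hφ₀.componentVanishes hψ' hψ'' hn' l₃)
    (hφ₀.componentVanishes_of_rest hh' h₁.toIsSmoothMap)
    (hφ₂.componentVanishes_rest hψ h₁.toIsSmoothMap l₁)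
    (hφ₂.componentVanishes hψ hψ' hn l₀)
    (hφ₂.componentVanishes hψ hψ' hn l₁)
    (hφ₀.componentVanishes_rest hψ' h₃.toIsSmoothMap l₃)
    (hφ₂.componentVanishes_of_rest hh h₃.toIsSmoothMap), ?_, fun x => (s₀ x).symm⟩
  obtain ⟨x⟩ := (inferInstance : Nonempty M)
  have h := (h₀.toIsSmoothMap.sup h₁.toIsSmoothMap o₀₁).finrank_eq x
  rw [s₀, hψ.finrank_eq] at h
  exact h

end Converse

end HarmonicGrassmann

end

open HarmonicGrassmann
theorem proposition4p2 {M : Type*} [TopologicalSpace M] [T2Space M] [ConnectedSpace M]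
    [ChartedSpace ℂ M] [IsManifold 𝓘(ℂ) ω M] (n : ℕ) :
    (∀ (t : ℕ∞) (m : ℕ∞ → ℕ) (ψ : ℕ∞ → M → Submodule ℂ (Cn n)),
      3 ≤ t → IsCyclicHarmonicDiagram t m ψ →
        IsHarmonic (m 0 + m 1) (fun x => ψ 0 x ⊔ ψ 1 x) ∧
        IsTwoNilconformal (fun x => ψ 0 x ⊔ ψ 1 x) ∧
        t - 1 ≤ isotropyOrder (fun x => ψ 0 x ⊔ ψ 1 x)) ∧
    (∀ (m : ℕ) (ψ : M → Submodule ℂ (Cn n)),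
      IsHarmonic m ψ → IsTwoNilconformal ψ →
        ∃ (t : ℕ∞) (m' : ℕ∞ → ℕ) (φ : ℕ∞ → M → Submodule ℂ (Cn n)),
          3 ≤ t ∧ IsCyclicHarmonicDiagram t m' φ ∧
          m = m' 0 + m' 1 ∧ ∀ x, ψ x = φ 0 x ⊔ φ 1 x) := by
  refine ⟨fun t m ψ h3 h => ⟨h.isHarmonic_sup h3, h.isTwoNilconformal_sup h3,
    h.le_isotropyOrder h3⟩, fun m ψ hh hn => ?_⟩
  obtain ⟨m', φ, h⟩ := hh.exists_diagram hn
  exact ⟨3, m', φ, le_rfl, h⟩
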